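/- Let $n\ge 1$ be an integer and $\lambda>1$. Write $|z|^2=\sum_i|z_i|^2$ and $t=\log|z|^2$ on $\mathbb C^n$. Call a smooth function $u:\mathbb R\to\mathbb R$ a Cao profile if $\varphi=u'$ satisfies $\varphi>0$, $\varphi'>0$ and, on all of $\mathbb R$, $$\varphi'=\frac{1}{\lambda^{n+1}\varphi^{n-1}}\Big(\lambda^n\varphi^n+\sum_{j=0}^{n-1}(-1)^{n-j}\frac{n!}{j!}(1-\lambda)(\lambda\varphi)^j+(-1)^{n-1}n!\,(1-\lambda)\,e^{-\lambda\varphi}\Big).$$ Cao profiles exist. For every Cao profile $u$ the function $z\mapsto u(\log|z|^2)$, extended to the origin by $\lim_{t\to-\infty}u(t)$, is smooth on $\mathbb C^n$, and $g_{\alpha\bar\beta}=\partial_\alpha\partial_{\bar\beta}u(\log|z|^2)$ has the following properties. Lengths are measured by $|v|^2=\sum g_{\alpha\bar\beta}v^\alpha\overline{v^\beta}$, volumes by $\det(g_{\alpha\bar\beta})$ times Lebesgue measure, $d$ is the Riemannian distance, $B(x,r)$ are the open geodesic balls, and $R_{\alpha\bar\beta\gamma\bar\eta}=-\partial_\gamma\partial_{\bar\eta}g_{\alpha\bar\beta}+g^{\xi\bar\zeta}\,\partial_{\bar\eta}g_{\xi\bar\beta}\,\partial_\gamma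 g_{\alpha\bar\zeta}$, $R_{\alpha\bar\beta}=g^{\gamma\bar\eta}R_{\alpha\bar\beta\gamma\bar\eta}$, $R=g^{\alpha\bar\beta}R_{\alpha\bar\beta}$; $\mathrm{Rm}$ is the real curvature tensor with these components. 1. $g$ is an expanding gradient Kähler–Ricci soliton: there is a smooth real function $f$ on $\mathbb C^n$ with $R_{\alpha\bar\beta}=\nabla_\alpha\nabla_{\bar\beta}f-g_{\alpha\bar\beta}$ and $\nabla_\alpha\nabla_\beta f=\nabla_{\bar\alpha}\nabla_{\bar\beta}f=0$. 2. The curvature operator is strictly positive on $(1,1)$-forms: at every point of $\mathbb C^n$, $\sum R_{\alpha\bar\beta\gamma\bar\eta}\,\xi^{\alpha\bar\beta}\,\overline{\xi^{\eta\bar\gamma}}>0$ for every nonzero $\xi=(\xi^{\alpha\bar\beta})\in\mathbb C^{n\times n}$. 3. $g$ has Euclidean volume growth: there is $c>0$ with $\mathrm{Vol}(B(x,r))\ge c\,r^{2n}$ for all $x\in\mathbb C^n$ and $r\ge 0$. At the origin, $\mathrm{Vol}(B(0,r))\ge\frac{\pi^n}{n!\,\lambda^n}r^{2n}$ for all $r\ge0$,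 and $\mathrm{Vol}(B(0,r))/r^{2n}\to\frac{\pi^n}{n!\,\lambda^n}$ as $r\to\infty$. 4. The curvature decays quadratically: there is a constant $C$ such that at every $z\in\mathbb C^n$ one has $|\mathrm{Rm}(X,Y,Z,W)|\le\frac{C}{1+d(0,z)^2}|X||Y||Z||W|$ for all tangent vectors $X,Y,Z,W$, and $|R(z)|\le\frac{C}{1+d(0,z)^2}$. 5. Consequently $(\mathbb C^n,g)$ is a complete noncompact Kähler manifold with bounded curvature and nonnegative curvature operator (on all real 2-forms), and for some point $x_0$ and some $c_1>0$ one has $\mathrm{Vol}(B(x_0,r))\ge c_1r^{2n}$ for all $r\ge0$. -/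

import Mathlib

open MeasureTheory Filter Topology
open scoped ENNReal ContDiff Manifold ComplexOrder

noncomputable section

namespace CaoSoliton

/-! ### Wirtinger derivatives on `ℂⁿ`

Points of `ℂⁿ` are functions `Fin n → ℂ`; its volume is Lebesgue measure on `ℝ²ⁿ`. -/

/-- `∂F/∂z_α = (∂F/∂x_α - i ∂F/∂y_α) / 2`. -/
def dz {n : ℕ} (α : Fin n) (F : (Fin n → ℂ) → ℂ) (z : Fin n → ℂ) : ℂ :=
  (fderiv ℝ F z (Pi.single α 1) - Complex.I * fderiv ℝ F z (Pi.single α Complex.I)) / 2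

/-- `∂F/∂z̄_α = (∂F/∂x_α + i ∂F/∂y_α) / 2`. -/
def dzbar {n : ℕ} (α : Fin n) (F : (Fin n → ℂ) → ℂ) (z : Fin n → ℂ) : ℂ :=
  (fderiv ℝ F z (Pi.single α 1) + Complex.I * fderiv ℝ F z (Pi.single α Complex.I)) / 2

/-! ### Kähler geometry on `ℂⁿ` in the standard holomorphic coordinates -/

/-- A field of matrices `g z α β = g_{α β̄}(z)` on `ℂⁿ`. -/
abbrev MetricField (n : ℕ) : Type := (Fin n → ℂ) → Matrix (Fin n) (Fin n) ℂ

/-- A smooth Kähler metric: smooth positive definite Hermitian matrices with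
`∂_γ g_{α β̄} = ∂_α g_{γ β̄}`, i.e. the associated `(1,1)`-form is closed. -/
structure IsKahler {n : ℕ} (g : MetricField n) : Prop where
  smooth : ∀ α β, ContDiff ℝ ∞ fun z => g z α β
  posDef : ∀ z, (g z).PosDef
  closed : ∀ α β γ z, dz γ (fun w => g w α β) z = dz α (fun w => g w γ β) z

/-- The inverse metric `g^{α β̄}`, characterised by `∑_β g^{α β̄} g_{γ β̄} = δ_{α γ}`. -/
def inv {n : ℕ} (g : MetricField n) (z : Fin n → ℂ) (α β : Fin n) : ℂ := (g z)⁻¹ β α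

/-- The Christoffel symbols `Γ^γ_{α β} = ∑_δ g^{γ δ̄} ∂_α g_{β δ̄}` of a Kähler metric. -/
def christoffel {n : ℕ} (g : MetricField n) (z : Fin n → ℂ) (γ α β : Fin n) : ℂ :=
  ∑ δ, inv g z γ δ * dz α (fun w => g w β δ) z

/-- The curvature tensor of a Kähler metric,
`R_{α β̄ γ η̄} = - ∂_γ ∂_η̄ g_{α β̄} + ∑ g^{ξ ζ̄} ∂_η̄ g_{ξ β̄} ∂_γ g_{α ζ̄}`. -/
def curv {n : ℕ} (g : MetricField n) (z : Fin n → ℂ) (α β γ η : Fin n) : ℂ :=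
  -dz γ (dzbar η fun w => g w α β) z +
    ∑ ξ, ∑ ζ, inv g z ξ ζ * dzbar η (fun w => g w ξ β) z * dz γ (fun w => g w α ζ) z

/-- The Ricci tensor `R_{α β̄} = ∑ g^{γ η̄} R_{α β̄ γ η̄}`. -/
def ricci {n : ℕ} (g : MetricField n) (z : Fin n → ℂ) (α β : Fin n) : ℂ :=
  ∑ γ, ∑ η, inv g z γ η * curv g z α β γ η

/-- The scalar curvature `R = ∑ g^{α β̄} R_{α β̄}`. -/
def scalarCurv {n : ℕ} (g : MetricField n) (z : Fin n → ℂ) : ℂ :=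
  ∑ α, ∑ β, inv g z α β * ricci g z α β

/-- The Hermitian form of the curvature operator on `(1,1)`-vectors `ξ = (ξ^{α β̄})`. The conjugate
of `ξ` has components `conj (ξ^{η γ̄})` in the slot `γ η̄`. -/
def curvForm {n : ℕ} (g : MetricField n) (z : Fin n → ℂ) (ξ : Matrix (Fin n) (Fin n) ℂ) : ℂ :=
  ∑ α, ∑ β, ∑ γ, ∑ η, curv g z α β γ η * ξ α β * star (ξ η γ)

/-- The curvature operator is strictly positive on the space of `(1,1)`-forms. -/
def HasPositiveCurvatureOperatorOn11 {n : ℕ} (g : MetricField n) : Prop :=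
  ∀ z, ∀ ξ : Matrix (Fin n) (Fin n) ℂ, ξ ≠ 0 → 0 < curvForm g z ξ

/-- The Riemannian curvature tensor `Rm(X, Y, Z, W)` on real tangent vectors. A vector `X ∈ ℂⁿ`
stands for the real vector `∑ (X^α ∂_α + conj X^α ∂_ᾱ)`; of the components of the complexified
tensor only `R_{α β̄ γ η̄}` and those obtained by the symmetries in the first and in the second
pair are non-zero. The sign is such that sectional curvatures are positive multiples of
`Rm(X, Y, Y, X)`. -/
def Rm {n : ℕ} (g : MetricField n) (z X Y Z W : Fin n → ℂ) : ℂ :=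
  ∑ α, ∑ β, ∑ γ, ∑ η, curv g z α β γ η *
    (X α * star (Y β) - Y α * star (X β)) * (Z γ * star (W η) - W γ * star (Z η))

/-- The curvature operator is nonnegative on the whole of `Λ²` of the real tangent bundle: an
arbitrary element of `Λ²` is a sum `∑_i X_i ∧ Y_i`. -/
def HasNonnegCurvatureOperator {n : ℕ} (g : MetricField n) : Prop :=
  ∀ z, ∀ (m : ℕ) (X Y : Fin m → Fin n → ℂ),
    0 ≤ ∑ i, ∑ j, Rm g z (X i) (Y i) (Y j) (X j)

/-- The length of a tangent vector: `|v|² = ∑ g_{α β̄} v^α conj v^β`. -/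
def vecNorm {n : ℕ} (g : MetricField n) (z v : Fin n → ℂ) : ℝ :=
  √(∑ α, ∑ β, g z α β * v α * star (v β)).re

/-- The Riemannian distance: the infimum of the lengths of `C¹` paths. -/
def gdist {n : ℕ} (g : MetricField n) (x y : Fin n → ℂ) : ℝ≥0∞ :=
  letI : ∀ z : Fin n → ℂ, ENorm (TangentSpace 𝓘(ℝ, Fin n → ℂ) z) :=
    fun z => ⟨fun v => ENNReal.ofReal (vecNorm g z v)⟩
  Manifold.riemannianEDist 𝓘(ℝ, Fin n → ℂ) x y

/-- The open geodesic ball `B(x, r)`. -/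
def gball {n : ℕ} (g : MetricField n) (x : Fin n → ℂ) (r : ℝ) : Set (Fin n → ℂ) :=
  {y | gdist g x y < ENNReal.ofReal r}

/-- The Riemannian volume, `det (g_{α β̄})` times Lebesgue measure. -/
def gvol {n : ℕ} (g : MetricField n) : Measure (Fin n → ℂ) :=
  volume.withDensity fun z => ENNReal.ofReal (g z).det.re

/-- The metric is complete: Cauchy sequences for the Riemannian distance converge. -/
def IsCompleteMetric {n : ℕ} (g : MetricField n) : Prop :=
  ∀ x : ℕ → Fin n → ℂ,
    (∀ ε : ℝ, 0 < ε → ∃ N, ∀ i ≥ N, ∀ j ≥ N, gdist g (x i) (x j) < ENNReal.ofReal ε) →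
    ∃ y, Tendsto (fun i => gdist g (x i) y) atTop (𝓝 0)

/-- The curvature is bounded. -/
def HasBoundedCurvature {n : ℕ} (g : MetricField n) : Prop :=
  ∃ K : ℝ, ∀ z X Y Z W, ‖Rm g z X Y Z W‖ ≤
    K * (vecNorm g z X * vecNorm g z Y * vecNorm g z Z * vecNorm g z W)

/-- The curvature decays quadratically in the distance from the origin: both the full curvature
tensor and the scalar curvature are `O(d⁻²)` (and bounded). -/
def HasQuadraticCurvatureDecay {n : ℕ} (g : MetricField n) : Prop :=
  ∃ C : ℝ, ∀ z,
    (∀ X Y Z W, ‖Rm g z X Y Z W‖ ≤ C / (1 + (gdist g 0 z).toReal ^ 2) *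
      (vecNorm g z X * vecNorm g z Y * vecNorm g z Z * vecNorm g z W)) ∧
    ‖scalarCurv g z‖ ≤ C / (1 + (gdist g 0 z).toReal ^ 2)

/-- Maximal (Euclidean) volume growth at the base point `x₀` with constant `c₁`. -/
def HasEuclideanVolumeGrowthAt {n : ℕ} (g : MetricField n) (x₀ : Fin n → ℂ) (c₁ : ℝ) : Prop :=
  ∀ r : ℝ, 0 ≤ r → ENNReal.ofReal (c₁ * r ^ (2 * n)) ≤ gvol g (gball g x₀ r)

/-- `(ℂⁿ, g)` is a complete noncompact Kähler manifold with bounded and nonnegative curvature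
operator and with Euclidean volume growth. -/
structure IsMaximalVolumeGrowthKahler {n : ℕ} (g : MetricField n) : Prop where
  kahler : IsKahler g
  complete : IsCompleteMetric g
  noncompact : NoncompactSpace (Fin n → ℂ)
  bounded : HasBoundedCurvature g
  nonneg : HasNonnegCurvatureOperator g
  volumeGrowth : ∃ x₀ : Fin n → ℂ, ∃ c₁ : ℝ, 0 < c₁ ∧ HasEuclideanVolumeGrowthAt g x₀ c₁

/-- An expanding gradient Kähler–Ricci soliton: for some real function `f`,
`R_{α β̄} = ∇_α ∇_β̄ f - ρ g_{α β̄}` and `∇_α ∇_β f = ∇_ᾱ ∇_β̄ f = 0`. -/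
def IsExpandingGradientSoliton {n : ℕ} (g : MetricField n) (ρ : ℝ) : Prop :=
  0 < ρ ∧ ∃ f : (Fin n → ℂ) → ℝ, ContDiff ℝ ∞ f ∧ ∀ z α β,
    ricci g z α β = dz α (dzbar β fun w => (f w : ℂ)) z - ρ * g z α β ∧
    dz α (dz β fun w => (f w : ℂ)) z -
      ∑ γ, christoffel g z γ α β * dz γ (fun w => (f w : ℂ)) z = 0 ∧
    dzbar α (dzbar β fun w => (f w : ℂ)) z -
      ∑ γ, star (christoffel g z γ α β) * dzbar γ (fun w => (f w : ℂ)) z = 0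

/-! ### Cao's metrics -/

/-- A smooth function `u` of `t = log |z|²` whose derivative `φ = u'` is a solution on the whole
line, with `φ > 0` and `φ' > 0`, of
`φ' = (λⁿ φⁿ + ∑_{j<n} (-1)^{n-j} (n!/j!) (1-λ) (λφ)^j + c e^{-λφ}) / (λ^{n+1} φ^{n-1})`
with `c = (-1)^{n-1} n! (1-λ)`. It is used for `n ≥ 1` only. -/
structure IsCaoProfile (n : ℕ) (lam : ℝ) (u : ℝ → ℝ) : Prop where
  smooth : ContDiff ℝ ∞ u
  pos : ∀ t, 0 < deriv u t
  deriv_pos : ∀ t, 0 < deriv (deriv u) t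
  ode : ∀ t, deriv (deriv u) t =
    1 / (lam ^ (n + 1) * deriv u t ^ (n - 1)) *
      (lam ^ n * deriv u t ^ n
        + ∑ j ∈ Finset.range n, (-1) ^ (n - j) * ((n.factorial : ℝ) / (j.factorial : ℝ))
            * (1 - lam) * (lam * deriv u t) ^ j
        + (-1) ^ (n - 1) * (n.factorial : ℝ) * (1 - lam) * Real.exp (-(lam * deriv u t)))

/-- The Kähler potential `z ↦ u(log |z|²)` on `ℂⁿ`, with the limit value at the origin. -/
def caoPotential {n : ℕ} (u : ℝ → ℝ) (z : Fin n → ℂ) : ℝ :=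
  open scoped Classical in
  if z = 0 then limUnder atBot u else u (Real.log (∑ i, ‖z i‖ ^ 2))

/-- Cao's metric `g_{α β̄} = ∂_α ∂_β̄ u(log |z|²)` on `ℂⁿ`. -/
def caoMetric (n : ℕ) (u : ℝ → ℝ) : MetricField n := fun z =>
  Matrix.of fun α β => dz α (dzbar β fun w => (caoPotential u w : ℂ)) z

end CaoSoliton

end

noncomputable section

namespace CaoSoliton

/-! ### Laplace transforms of the weights `σ^p (1-σ)^q` on `[0, 1]` -/

/-! Everything depends on s = |z|² only, and one function carries the analysis: k(y) = (λ-1) ∫_0^1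
(1-σ)^n e^{-λyσ} dσ. The sum and the exponential in the profile equation form a Taylor remainder of
e^{-λφ}; its integral form (`exp_remainder_eq`) turns the equation into φ' = φG with G = 1 - φk(φ)
(`profile_rhs_eq`).

The coordinate P(y) = y exp ∫_0^y k/(1-vk) satisfies P'/P = 1/(yG), so P(φ(t)) = C e^t = C s. Hence
φ is a function of s that is differentiable at s = 0 too, and a = φ/s solves a' = -a² k(sa). The
right hand side is smooth, so bootstrapping gives smoothness across the origin; the same formula
produces profiles.

The metric a δ + a' z̄ ⊗ z has eigenvalues a (transversal) and aG (radial). In a unit frame its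
curvature is given by k (transversal), (yk)' (mixed) and (y²k)'' (radial). Integration by parts
yields a linear first order equation for k, and this equation is what the soliton identity with f =
λφ comes down to; the gradient of f is λ times the Euler field. The same recurrences write the three
curvature functions as positive Laplace transforms, which gives their signs and their O(1/(1+φ))
decay. On (1,1)-forms the only coupled block is transversal trace against radial entry. Its
positivity needs (n-1) mixed² < n · radial · k, a strict Cauchy–Schwarz inequality
(`mixedCurv_sq_lt`). A Kähler curvature operator sees only the (1,1)-part of a real 2-form, so it is
nonnegative on all of them.

For the metric geometry, λG > 1 and λφG ≤ φ + (λ-1)n/λ give √(λφ + (λ-1)n) - √((λ-1)n) ≤ d(0,z) ≤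
√(λφ) (`le_gdist_zero`, `gdist_zero_le`), and the volume of {|z|² < S} is exactly π^n φ^n / n!
(`gvol_nsq_lt`). Completeness, quadratic decay and the sharp volume constant follow. For a general
centre, a large ball contains a ball about the origin, and a small one contains a Euclidean ball on
the far side of its centre. -/

/-- `∫_0^1 σ^p (1-σ)^q e^{-xσ} dσ`. -/
def laplaceBeta (p q : ℕ) (x : ℝ) : ℝ :=
  ∫ σ in (0 : ℝ)..1, σ ^ p * (1 - σ) ^ q * Real.exp (-(x * σ))

theorem laplaceBeta_integrable (p q : ℕ) (x : ℝ) :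
    IntervalIntegrable (fun σ : ℝ => σ ^ p * (1 - σ) ^ q * Real.exp (-(x * σ))) volume 0 1 :=
  Continuous.intervalIntegrable (by fun_prop) _ _

theorem hasDerivAt_laplaceBeta (p q : ℕ) (x : ℝ) :
    HasDerivAt (laplaceBeta p q) (-laplaceBeta (p + 1) q x) x := by
  have key := intervalIntegral.hasDerivAt_integral_of_dominated_loc_of_deriv_le
    (μ := volume) (a := (0 : ℝ)) (b := 1) (𝕜 := ℝ) (x₀ := x)
    (F := fun x σ => σ ^ p * (1 - σ) ^ q * Real.exp (-(x * σ)))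
    (F' := fun x σ => -(σ ^ (p + 1) * (1 - σ) ^ q * Real.exp (-(x * σ))))
    (s := Metric.ball x 1) (bound := fun _ => Real.exp (|x| + 1))
    (Metric.ball_mem_nhds x one_pos)
    (Eventually.of_forall fun y => (Continuous.aestronglyMeasurable (by fun_prop)))
    (laplaceBeta_integrable p q x)
    (Continuous.aestronglyMeasurable (by fun_prop))
    (Eventually.of_forall fun σ hσ y hy => ?_)
    intervalIntegrable_const
    (Eventually.of_forall fun σ hσ y hy => ?_)
  · have := key.2
    rwa [intervalIntegral.integral_neg] at this
  · rw [Set.uIoc_of_le zero_le_one] at hσ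
    have h1 : |σ| ≤ 1 := abs_le.2 ⟨by linarith [hσ.1], hσ.2⟩
    have h2 : |1 - σ| ≤ 1 := abs_le.2 ⟨by linarith [hσ.2], by linarith [hσ.1]⟩
    have h3 : |y| ≤ |x| + 1 := by
      have : |y - x| < 1 := by simpa [Real.dist_eq] using hy
      have := abs_sub_abs_le_abs_sub y x
      linarith
    rw [norm_neg, norm_mul, norm_mul, norm_pow, norm_pow, Real.norm_eq_abs, Real.norm_eq_abs,
      Real.norm_eq_abs, Real.abs_exp]
    calc |σ| ^ (p + 1) * |1 - σ| ^ q * Real.exp (-(y * σ))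
        ≤ 1 * 1 * Real.exp (|x| + 1) := by
          gcongr
          · exact pow_le_one₀ (abs_nonneg _) h1
          · exact pow_le_one₀ (abs_nonneg _) h2
          · calc -(y * σ) ≤ |y * σ| := neg_le_abs _
              _ = |y| * |σ| := abs_mul _ _
              _ ≤ (|x| + 1) * 1 := by gcongr
              _ = |x| + 1 := mul_one _
      _ = _ := by ring
  · have : HasDerivAt (fun y : ℝ => -(y * σ)) (-σ) y := by
      simpa using ((hasDerivAt_id' y).mul_const σ).fun_neg
    have h := (this.exp).const_mul (σ ^ p * (1 - σ) ^ q)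
    exact h.congr_deriv (by ring)

theorem contDiff_laplaceBeta (p q : ℕ) : ContDiff ℝ ∞ (laplaceBeta p q) := by
  have h : ∀ m : ℕ, ∀ p, ContDiff ℝ m (laplaceBeta p q) := by
    intro m
    induction m with
    | zero =>
      intro p
      exact contDiff_zero.2
        (continuous_iff_continuousAt.2 fun x => (hasDerivAt_laplaceBeta p q x).continuousAt)
    | succ m ih =>
      intro p
      rw [show ((m + 1 : ℕ) : WithTop ℕ∞) = (m : WithTop ℕ∞) + 1 by simp, contDiff_succ_iff_deriv]
      refine ⟨fun x => (hasDerivAt_laplaceBeta p q x).differentiableAt, by simp, ?_⟩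
      have : deriv (laplaceBeta p q) = fun x => -laplaceBeta (p + 1) q x :=
        funext fun x => (hasDerivAt_laplaceBeta p q x).deriv
      rw [this]
      exact (ih (p + 1)).neg
  exact contDiff_infty.2 fun m => h m p

theorem laplaceBeta_pos (p q : ℕ) (x : ℝ) : 0 < laplaceBeta p q x := by
  refine intervalIntegral.intervalIntegral_pos_of_pos_on (laplaceBeta_integrable p q x)
    (fun σ hσ => ?_) one_pos
  have h1 : 0 < σ := hσ.1
  have h2 : 0 < 1 - σ := sub_pos.2 hσ.2
  positivity

theorem mul_laplaceBeta_zero_zero (x : ℝ) : x * laplaceBeta 0 0 x = 1 - Real.exp (-x) := by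
  have h : ∀ σ ∈ Set.uIcc (0 : ℝ) 1, HasDerivAt (fun σ : ℝ => -Real.exp (-(x * σ)))
      (x * (σ ^ 0 * (1 - σ) ^ 0 * Real.exp (-(x * σ)))) σ := by
    intro σ _
    have : HasDerivAt (fun σ : ℝ => -(x * σ)) (-x) σ := by
      simpa using ((hasDerivAt_id' σ).const_mul x).fun_neg
    exact this.exp.fun_neg.congr_deriv (by ring)
  have := intervalIntegral.integral_eq_sub_of_hasDerivAt h
    ((laplaceBeta_integrable 0 0 x).const_mul x)
  rw [intervalIntegral.integral_const_mul] at this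
  rw [laplaceBeta, this]
  simp
  ring

/-- Integration by parts; the boundary term at σ = 1 vanishes because the exponent q + 1 is
positive. All later recurrences are derivatives of this identity or of its q = 0 analogue
`mul_laplaceBeta_zero_zero`, where an exponential survives. -/
theorem mul_laplaceBeta_zero (q : ℕ) (x : ℝ) :
    x * laplaceBeta 0 (q + 1) x = 1 - (q + 1) * laplaceBeta 0 q x := by
  have h : ∀ σ ∈ Set.uIcc (0 : ℝ) 1, HasDerivAt
      (fun σ : ℝ => -((1 - σ) ^ (q + 1) * Real.exp (-(x * σ))))
      (x * (σ ^ 0 * (1 - σ) ^ (q + 1) * Real.exp (-(x * σ)))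
        + (q + 1) * (σ ^ 0 * (1 - σ) ^ q * Real.exp (-(x * σ)))) σ := by
    intro σ _
    have h1 : HasDerivAt (fun σ : ℝ => -(x * σ)) (-x) σ := by
      simpa using ((hasDerivAt_id' σ).const_mul x).fun_neg
    have h2 : HasDerivAt (fun σ : ℝ => 1 - σ) (-1) σ := by
      simpa using (hasDerivAt_id σ).const_sub 1
    refine ((h2.fun_pow (q + 1)).fun_mul h1.exp).fun_neg.congr_deriv ?_
    push_cast
    simp
    ring
  have := intervalIntegral.integral_eq_sub_of_hasDerivAt h
    (((laplaceBeta_integrable 0 (q + 1) x).const_mul x).add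
      ((laplaceBeta_integrable 0 q x).const_mul (q + 1)))
  rw [intervalIntegral.integral_add ((laplaceBeta_integrable 0 (q + 1) x).const_mul x)
      ((laplaceBeta_integrable 0 q x).const_mul _),
    intervalIntegral.integral_const_mul, intervalIntegral.integral_const_mul] at this
  simp only [← laplaceBeta.eq_1] at this
  simp at this
  linarith

theorem laplaceBeta_succ_left (p q : ℕ) (x : ℝ) :
    laplaceBeta (p + 1) q x = laplaceBeta p q x - laplaceBeta p (q + 1) x := by
  rw [laplaceBeta, laplaceBeta, laplaceBeta, ← intervalIntegral.integral_sub
    (laplaceBeta_integrable p q x) (laplaceBeta_integrable p (q + 1) x)]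
  congr 1
  ext σ
  ring

theorem hasDerivAt_mul_laplaceBeta (p q : ℕ) (x : ℝ) :
    HasDerivAt (fun x => x * laplaceBeta p q x)
      (laplaceBeta p q x - x * laplaceBeta (p + 1) q x) x := by
  exact ((hasDerivAt_id' x).fun_mul (hasDerivAt_laplaceBeta p q x)).congr_deriv (by ring)

theorem laplaceBeta_one_zero (x : ℝ) :
    laplaceBeta 0 0 x - x * laplaceBeta 1 0 x = Real.exp (-x) := by
  have h := hasDerivAt_mul_laplaceBeta 0 0 x
  simp only [mul_laplaceBeta_zero_zero] at h
  refine h.unique ?_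
  convert ((hasDerivAt_neg x).exp.const_sub 1) using 1
  ring

theorem laplaceBeta_two_zero (x : ℝ) :
    2 * laplaceBeta 1 0 x - x * laplaceBeta 2 0 x = Real.exp (-x) := by
  have h := (hasDerivAt_laplaceBeta 0 0 x).sub (hasDerivAt_mul_laplaceBeta 1 0 x)
  have e : (laplaceBeta 0 0 - fun x => x * laplaceBeta 1 0 x) = fun x => Real.exp (-x) :=
    funext laplaceBeta_one_zero
  rw [e] at h
  have := h.unique (hasDerivAt_neg x).exp
  norm_num at this
  linarith

/-- The derivative in x of `mul_laplaceBeta_zero`. A difference of unclear sign becomes a single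
positive Laplace transform, which is how the curvature functions get their signs. -/
theorem laplaceBeta_one_succ (q : ℕ) (x : ℝ) :
    laplaceBeta 0 (q + 1) x - x * laplaceBeta 1 (q + 1) x = (q + 1) * laplaceBeta 1 q x := by
  have h := hasDerivAt_mul_laplaceBeta 0 (q + 1) x
  simp only [mul_laplaceBeta_zero] at h
  refine h.unique ?_
  convert (((hasDerivAt_laplaceBeta 0 q x).const_mul ((q : ℝ) + 1)).const_sub 1) using 1
  ring

theorem laplaceBeta_two_succ (q : ℕ) (x : ℝ) :
    2 * laplaceBeta 1 (q + 1) x - x * laplaceBeta 2 (q + 1) x = (q + 1) * laplaceBeta 2 q x := by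
  have h := (hasDerivAt_laplaceBeta 0 (q + 1) x).sub (hasDerivAt_mul_laplaceBeta 1 (q + 1) x)
  have e : (laplaceBeta 0 (q + 1) - fun x => x * laplaceBeta 1 (q + 1) x)
      = fun x => ((q : ℝ) + 1) * laplaceBeta 1 q x :=
    funext (laplaceBeta_one_succ q)
  rw [e] at h
  have := h.unique ((hasDerivAt_laplaceBeta 1 q x).const_mul ((q : ℝ) + 1))
  norm_num at this
  linarith

/-- For x ≥ 0 the weight only decreases the integral, so `laplaceBeta 0 0` bounds it; that one is at
most 1, and x times it is 1 - e^{-x} ≤ 1. -/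
theorem laplaceBeta_mul_le (p q : ℕ) {x : ℝ} (hx : 0 ≤ x) : (1 + x) * laplaceBeta p q x ≤ 2 := by
  have h1 : laplaceBeta p q x ≤ laplaceBeta 0 0 x := by
    refine intervalIntegral.integral_mono_on zero_le_one (laplaceBeta_integrable p q x)
      (laplaceBeta_integrable 0 0 x) fun σ hσ => ?_
    have h1 : 0 ≤ σ := hσ.1
    have h2 : 0 ≤ 1 - σ := sub_nonneg.2 hσ.2
    have h3 : σ ^ p ≤ 1 := pow_le_one₀ h1 hσ.2
    have h4 : (1 - σ) ^ q ≤ 1 := pow_le_one₀ h2 (by linarith)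
    rw [pow_zero, pow_zero]
    gcongr
  have h2 : laplaceBeta 0 0 x ≤ 1 := by
    have := intervalIntegral.integral_mono_on zero_le_one (laplaceBeta_integrable 0 0 x)
      (intervalIntegrable_const (c := (1 : ℝ)) (μ := volume)) fun σ hσ => by
        simpa using mul_nonneg hx hσ.1
    simpa [laplaceBeta] using this
  have h3 := mul_laplaceBeta_zero_zero x
  have h4 := Real.exp_pos (-x)
  nlinarith

/-- Strict Cauchy–Schwarz inequality. -/
theorem laplaceBeta_sq_lt (q : ℕ) (x : ℝ) :
    laplaceBeta 1 (q + 1) x ^ 2 < laplaceBeta 2 q x * laplaceBeta 0 (q + 2) x := by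
  have hpos := laplaceBeta_pos 0 (q + 2) x
  -- The minimiser over c of the integral of (σ - c(1-σ))² against (1-σ)^q e^{-xσ}. At this c the
  -- integral is the Gram determinant divided by `laplaceBeta 0 (q + 2) x`. It is strictly positive
  -- since the integrand equals c² > 0 at σ = 0.
  set c := laplaceBeta 1 (q + 1) x / laplaceBeta 0 (q + 2) x with hc
  have hI : 0 < ∫ σ in (0 : ℝ)..1, (σ - c * (1 - σ)) ^ 2 * ((1 - σ) ^ q * Real.exp (-(x * σ))) := by
    have hcpos : 0 < c := div_pos (laplaceBeta_pos _ _ _) hpos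
    refine intervalIntegral.integral_pos one_pos (by fun_prop) (fun σ hσ => ?_)
      ⟨0, by simp, ?_⟩
    · have h2 : 0 ≤ 1 - σ := sub_nonneg.2 hσ.2
      positivity
    · simp
      positivity
  have e : (∫ σ in (0 : ℝ)..1, (σ - c * (1 - σ)) ^ 2 * ((1 - σ) ^ q * Real.exp (-(x * σ))))
      = laplaceBeta 2 q x - 2 * c * laplaceBeta 1 (q + 1) x + c ^ 2 * laplaceBeta 0 (q + 2) x := by
    rw [laplaceBeta, laplaceBeta, laplaceBeta, ← intervalIntegral.integral_const_mul,
      ← intervalIntegral.integral_const_mul, ← intervalIntegral.integral_sub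
        (laplaceBeta_integrable _ _ x) ((laplaceBeta_integrable _ _ x).const_mul _),
      ← intervalIntegral.integral_add
        ((laplaceBeta_integrable _ _ x).sub ((laplaceBeta_integrable _ _ x).const_mul _))
        ((laplaceBeta_integrable _ _ x).const_mul _)]
    congr 1
    ext σ
    ring
  rw [e] at hI
  have h : c * laplaceBeta 0 (q + 2) x = laplaceBeta 1 (q + 1) x := by
    rw [hc]; field_simp
  have h' : 0 < laplaceBeta 2 q x - c * laplaceBeta 1 (q + 1) x := by
    have : c ^ 2 * laplaceBeta 0 (q + 2) x = c * laplaceBeta 1 (q + 1) x := by rw [← h]; ring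
    linarith
  have := mul_pos h' hpos
  nlinarith

/-- The remainder of the exponential series of `e^{-x}` as a Laplace transform. -/
theorem exp_remainder_eq (n : ℕ) (hn : 1 ≤ n) (x : ℝ) :
    (n.factorial : ℝ) * (∑ j ∈ Finset.range n, (-1) ^ (n - j) * (x ^ j / (j.factorial : ℝ))
      + (-1) ^ (n - 1) * Real.exp (-x)) = -(x ^ n * (n * laplaceBeta 0 (n - 1) x)) := by
  induction n, hn using Nat.le_induction with
  | base =>
    simp [mul_laplaceBeta_zero_zero]
    ring
  | succ n hn ih =>
    obtain ⟨m, rfl⟩ : ∃ m, n = m + 1 := ⟨n - 1, by omega⟩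
    have h := mul_laplaceBeta_zero m x
    -- Raising n by one flips every sign of the old sum and adds one term.
    rw [Finset.sum_range_succ, Finset.sum_congr rfl (g := fun j =>
      -((-1) ^ (m + 1 - j) * (x ^ j / (j.factorial : ℝ)))) fun j hj => ?_]
    · rw [Finset.sum_neg_distrib]
      have hf : ((m + 1).factorial : ℝ) ≠ 0 := by positivity
      have h2 : ((m + 1 + 1).factorial : ℝ) = (m + 2) * (m + 1).factorial := by
        rw [Nat.factorial_succ (m + 1)]; push_cast; ring
      simp only [Nat.add_sub_cancel] at ih ⊢
      set S := ∑ j ∈ Finset.range (m + 1), (-1 : ℝ) ^ (m + 1 - j) * (x ^ j / (j.factorial : ℝ))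
      have h3 : ((m + 1).factorial : ℝ) * (x ^ (m + 1) / ((m + 1).factorial : ℝ)) = x ^ (m + 1) := by
        field_simp
      rw [h2]
      have h4 : m + 1 + 1 - (m + 1) = 1 := by omega
      rw [h4]
      push_cast at ih ⊢
      linear_combination (-(m + 2 : ℝ)) * ih - (m + 2 : ℝ) * h3 + (m + 2 : ℝ) * x ^ (m + 1) * h
    · rw [Finset.mem_range] at hj
      rw [show m + 1 + 1 - j = (m + 1 - j) + 1 by omega, pow_succ]
      ring

/-! ### The curvature function of the profile equation

The profile equation reads `φ' = φ (1 - φ k(φ))` with `k = curvFun n lam`. -/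

/-- `k(y) = (λ-1) ∫_0^1 (1-σ)^n e^{-λyσ} dσ`. -/
def curvFun (n : ℕ) (lam y : ℝ) : ℝ := (lam - 1) * laplaceBeta 0 n (lam * y)

/-- The derivative of `curvFun`. -/
def curvFun₁ (n : ℕ) (lam y : ℝ) : ℝ := -(lam * (lam - 1) * laplaceBeta 1 n (lam * y))

/-- The second derivative of `curvFun`. -/
def curvFun₂ (n : ℕ) (lam y : ℝ) : ℝ := lam ^ 2 * (lam - 1) * laplaceBeta 2 n (lam * y)

theorem hasDerivAt_laplaceBeta_comp (p q : ℕ) (lam y : ℝ) :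
    HasDerivAt (fun y => laplaceBeta p q (lam * y)) (-(lam * laplaceBeta (p + 1) q (lam * y))) y := by
  have h : HasDerivAt (fun y => lam * y) lam y := by
    simpa using (hasDerivAt_id' y).const_mul lam
  exact ((hasDerivAt_laplaceBeta p q (lam * y)).comp y h).congr_deriv (by ring)

theorem hasDerivAt_curvFun (n : ℕ) (lam y : ℝ) :
    HasDerivAt (curvFun n lam) (curvFun₁ n lam y) y :=
  ((hasDerivAt_laplaceBeta_comp 0 n lam y).const_mul (lam - 1)).congr_deriv
    (by rw [curvFun₁]; ring)

theorem hasDerivAt_curvFun₁ (n : ℕ) (lam y : ℝ) :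
    HasDerivAt (curvFun₁ n lam) (curvFun₂ n lam y) y :=
  ((hasDerivAt_laplaceBeta_comp 1 n lam y).const_mul (lam * (lam - 1))).fun_neg.congr_deriv
    (by rw [curvFun₂]; ring)

theorem contDiff_curvFun (n : ℕ) (lam : ℝ) : ContDiff ℝ ∞ (curvFun n lam) :=
  contDiff_const.mul ((contDiff_laplaceBeta 0 n).comp (contDiff_const.mul contDiff_id))

/-- The linear first order equation for k that integration by parts provides. Together with its
derivative `mul_curvFun₂` it is the only analytic input of the Ricci and scalar curvature
identities. -/
theorem mul_curvFun₁ (n : ℕ) (lam y : ℝ) :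
    y * curvFun₁ n lam y = lam - 1 - lam * y * curvFun n lam y - (n + 1) * curvFun n lam y := by
  have h1 := laplaceBeta_succ_left 0 n (lam * y)
  have h2 := mul_laplaceBeta_zero n (lam * y)
  rw [curvFun, curvFun₁, h1]
  linear_combination (lam - 1) * h2

theorem mul_curvFun₂ (n : ℕ) (lam y : ℝ) :
    y * curvFun₂ n lam y =
      -lam * curvFun n lam y - lam * y * curvFun₁ n lam y - (n + 2) * curvFun₁ n lam y := by
  have h1 := (hasDerivAt_id' y).fun_mul (hasDerivAt_curvFun₁ n lam y)
  have h2 := (((((hasDerivAt_id' y).const_mul lam).fun_mul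
    (hasDerivAt_curvFun n lam y)).const_sub (lam - 1))).fun_sub
      ((hasDerivAt_curvFun n lam y).const_mul ((n : ℝ) + 1))
  rw [show (fun y => y * curvFun₁ n lam y) = _ from funext fun y => mul_curvFun₁ n lam y] at h1
  have := h1.unique h2
  linear_combination this

theorem curvFun_pos (n : ℕ) {lam : ℝ} (hlam : 1 < lam) (y : ℝ) : 0 < curvFun n lam y :=
  mul_pos (sub_pos.2 hlam) (laplaceBeta_pos _ _ _)

theorem curvFun₁_neg (n : ℕ) {lam : ℝ} (hlam : 1 < lam) (y : ℝ) : curvFun₁ n lam y < 0 := by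
  have := laplaceBeta_pos 1 n (lam * y)
  have h1 : 0 < lam - 1 := sub_pos.2 hlam
  have h2 : 0 < lam := by linarith
  rw [curvFun₁, neg_lt_zero]
  positivity

/-- The mixed curvature, the derivative of `y k`. -/
def mixedCurv (n : ℕ) (lam y : ℝ) : ℝ := curvFun n lam y + y * curvFun₁ n lam y

/-- The radial curvature, the second derivative of `y² k`. -/
def radialCurv (n : ℕ) (lam y : ℝ) : ℝ :=
  2 * curvFun n lam y + 4 * y * curvFun₁ n lam y + y ^ 2 * curvFun₂ n lam y

theorem mixedCurv_eq (m : ℕ) (lam y : ℝ) :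
    mixedCurv (m + 1) lam y = (lam - 1) * ((m + 1) * laplaceBeta 1 m (lam * y)) := by
  rw [mixedCurv, curvFun, curvFun₁, ← laplaceBeta_one_succ]
  ring

theorem radialCurv_eq (m : ℕ) (lam y : ℝ) :
    radialCurv (m + 1) lam y = (lam - 1) * ((m + 1) *
      (2 * laplaceBeta 1 m (lam * y) - lam * y * laplaceBeta 2 m (lam * y))) := by
  rw [radialCurv, curvFun, curvFun₁, curvFun₂]
  linear_combination (lam - 1) * 2 * laplaceBeta_one_succ m (lam * y)
    - (lam - 1) * (lam * y) * laplaceBeta_two_succ m (lam * y)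

theorem radialCurv_one (lam y : ℝ) :
    radialCurv 1 lam y = (lam - 1) * Real.exp (-(lam * y)) := by
  rw [radialCurv_eq 0, laplaceBeta_two_zero]
  simp

/-- Here the power of 1-σ can be lowered twice, which requires n ≥ 2. For n = 1 the second
integration by parts leaves the boundary term of `radialCurv_one` instead, hence the case splits
below. -/
theorem radialCurv_add_two (m : ℕ) (lam y : ℝ) :
    radialCurv (m + 2) lam y =
      (lam - 1) * ((m + 2) * ((m + 1) * laplaceBeta 2 m (lam * y))) := by
  rw [radialCurv_eq (m + 1), laplaceBeta_two_succ]
  push_cast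
  ring

theorem mixedCurv_pos {n : ℕ} (hn : 1 ≤ n) {lam : ℝ} (hlam : 1 < lam)
    (y : ℝ) : 0 < mixedCurv n lam y := by
  obtain ⟨m, rfl⟩ : ∃ m, n = m + 1 := ⟨n - 1, by omega⟩
  have := laplaceBeta_pos 1 m (lam * y)
  have h1 : 0 < lam - 1 := sub_pos.2 hlam
  rw [mixedCurv_eq]
  positivity

theorem radialCurv_pos {n : ℕ} (hn : 1 ≤ n) {lam : ℝ} (hlam : 1 < lam)
    (y : ℝ) : 0 < radialCurv n lam y := by
  have h1 : 0 < lam - 1 := sub_pos.2 hlam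
  obtain rfl | ⟨m, rfl⟩ : n = 1 ∨ ∃ m, n = m + 2 := by
    rcases Nat.lt_or_ge n 2 with h | h
    · left; omega
    · right; exact ⟨n - 2, by omega⟩
  · rw [radialCurv_one]
    positivity
  · have := laplaceBeta_pos 2 m (lam * y)
    rw [radialCurv_add_two]
    positivity

/-- In Laplace form both sides carry the same factor (n-1) n² (λ-1)² when n ≥ 2, and
`laplaceBeta_sq_lt` remains. The weights n-1 and n are exactly those required by the trace
inequality on the transversal block in `quadratic_pos`. -/
theorem mixedCurv_sq_lt {n : ℕ} (hn : 1 ≤ n) {lam : ℝ} (hlam : 1 < lam)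
    (y : ℝ) :
    (n - 1) * mixedCurv n lam y ^ 2 < n * (radialCurv n lam y * curvFun n lam y) := by
  have h1 : 0 < lam - 1 := sub_pos.2 hlam
  obtain rfl | ⟨m, rfl⟩ : n = 1 ∨ ∃ m, n = m + 2 := by
    rcases Nat.lt_or_ge n 2 with h | h
    · left; omega
    · right; exact ⟨n - 2, by omega⟩
  · have := mul_pos (radialCurv_pos le_rfl hlam y) (curvFun_pos 1 hlam y)
    simpa using this
  · have h := laplaceBeta_sq_lt m (lam * y)
    rw [radialCurv_add_two, mixedCurv_eq (m + 1), curvFun]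
    have h2 : (0 : ℝ) < (m + 1) * (m + 2) ^ 2 * (lam - 1) ^ 2 := by positivity
    have := mul_lt_mul_of_pos_left h h2
    push_cast
    nlinarith

/-- Integration by parts again. The excess of λG over 1 is a positive Laplace transform: its sign
controls distances from above, its decay controls them from below, and the formula itself identifies
the right hand side of the profile equation. -/
theorem one_sub_mul_curvFun {n : ℕ} (hn : 1 ≤ n) (lam y : ℝ) :
    lam * (1 - y * curvFun n lam y) = 1 + (lam - 1) * (n * laplaceBeta 0 (n - 1) (lam * y)) := by
  obtain ⟨m, rfl⟩ : ∃ m, n = m + 1 := ⟨n - 1, by omega⟩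
  have h := mul_laplaceBeta_zero m (lam * y)
  rw [curvFun]
  rw [Nat.add_sub_cancel]
  push_cast
  linear_combination (-(lam - 1)) * h

theorem one_lt_mul_one_sub {n : ℕ} (hn : 1 ≤ n) {lam : ℝ} (hlam : 1 < lam)
    (y : ℝ) : 1 < lam * (1 - y * curvFun n lam y) := by
  have h1 : 0 < lam - 1 := sub_pos.2 hlam
  have h2 : (0 : ℝ) < n := by exact_mod_cast hn
  have := laplaceBeta_pos 0 (n - 1) (lam * y)
  rw [one_sub_mul_curvFun hn]
  have : 0 < (lam - 1) * (n * laplaceBeta 0 (n - 1) (lam * y)) := by positivity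
  linarith

theorem one_sub_mul_curvFun_pos {n : ℕ} (hn : 1 ≤ n) {lam : ℝ} (hlam : 1 < lam)
    (y : ℝ) : 0 < 1 - y * curvFun n lam y := by
  have := one_lt_mul_one_sub hn hlam y
  by_contra h
  nlinarith

/-- The excess in `one_sub_mul_curvFun` is (λ-1)n times a transform L with λyL ≤ 1. The resulting
additive constant is the shift in the lower distance bound `le_gdist_zero`. -/
theorem mul_one_sub_le {n : ℕ} (hn : 1 ≤ n) {lam : ℝ} (hlam : 1 < lam) (y : ℝ) :
    lam * (y * (1 - y * curvFun n lam y)) ≤ y + (lam - 1) * n / lam := by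
  have h0 : 0 < lam := by linarith
  have h1 : 0 < lam - 1 := sub_pos.2 hlam
  have h2 : (0 : ℝ) < n := by exact_mod_cast hn
  have h := one_sub_mul_curvFun hn lam y
  have h3 : lam * y * laplaceBeta 0 (n - 1) (lam * y) ≤ 1 := by
    rcases Nat.exists_eq_succ_of_ne_zero (show n ≠ 0 by omega) with ⟨m, rfl⟩
    rcases m with _ | m
    · have h4 := mul_laplaceBeta_zero_zero (lam * y)
      have := Real.exp_pos (-(lam * y))
      change lam * y * laplaceBeta 0 0 (lam * y) ≤ 1
      rw [h4]
      linarith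
    · have h4 := mul_laplaceBeta_zero m (lam * y)
      have := laplaceBeta_pos 0 m (lam * y)
      have : 0 < ((m : ℝ) + 1) * laplaceBeta 0 m (lam * y) := by positivity
      change lam * y * laplaceBeta 0 (m + 1) (lam * y) ≤ 1
      rw [h4]
      linarith
  rw [show lam * (y * (1 - y * curvFun n lam y)) = y * (lam * (1 - y * curvFun n lam y)) by ring, h,
    mul_add, mul_one]
  gcongr
  rw [le_div_iff₀ h0]
  have : (lam - 1) * n * (lam * y * laplaceBeta 0 (n - 1) (lam * y)) ≤ (lam - 1) * n * 1 := by
    gcongr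
  linarith

/-! ### Decay of the three curvature functions. -/

theorem curvFun_le {n : ℕ} {lam : ℝ} (hlam : 1 < lam)
    {y : ℝ} (hy : 0 ≤ y) : curvFun n lam y ≤ 2 * (lam - 1) / (1 + y) := by
  have h1 : 0 < lam - 1 := sub_pos.2 hlam
  have h2 := laplaceBeta_mul_le 0 n (x := lam * y) (by positivity)
  have h3 := laplaceBeta_pos 0 n (lam * y)
  rw [le_div_iff₀ (by positivity), curvFun]
  nlinarith [mul_nonneg (mul_nonneg hy h1.le) h3.le]

theorem mixedCurv_le {n : ℕ} {lam : ℝ} (hlam : 1 < lam)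
    {y : ℝ} (hy : 0 ≤ y) : mixedCurv n lam y ≤ 2 * (lam - 1) / (1 + y) := by
  refine le_trans ?_ (curvFun_le (n := n) hlam hy)
  rw [mixedCurv]
  nlinarith [curvFun₁_neg n hlam y]

theorem radialCurv_le {n : ℕ} (hn : 1 ≤ n) {lam : ℝ} (hlam : 1 < lam)
    {y : ℝ} (hy : 0 ≤ y) :
    radialCurv n lam y ≤ 2 * (lam - 1) * n ^ 2 / (1 + y) := by
  have h1 : 0 < lam - 1 := sub_pos.2 hlam
  have hly : y ≤ lam * y := by nlinarith
  rw [le_div_iff₀ (by positivity)]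
  obtain rfl | ⟨m, rfl⟩ : n = 1 ∨ ∃ m, n = m + 2 := by
    rcases Nat.lt_or_ge n 2 with h | h
    · left; omega
    · right; exact ⟨n - 2, by omega⟩
  · rw [radialCurv_one, mul_assoc]
    have h4 : Real.exp (-(lam * y)) * (1 + y) ≤ 1 := by
      rw [Real.exp_neg, inv_mul_le_iff₀ (Real.exp_pos _)]
      have := Real.add_one_le_exp (lam * y)
      linarith
    have := mul_le_mul_of_nonneg_left h4 h1.le
    norm_num
    linarith
  · have h2 := laplaceBeta_mul_le 2 m (x := lam * y) (by positivity)
    have h3 := laplaceBeta_pos 2 m (lam * y)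
    rw [radialCurv_add_two]
    have h5 : laplaceBeta 2 m (lam * y) * (1 + y) ≤ 2 := by nlinarith
    calc (lam - 1) * ((m + 2) * ((m + 1) * laplaceBeta 2 m (lam * y))) * (1 + y)
        = (lam - 1) * ((m + 2) * (m + 1)) * (laplaceBeta 2 m (lam * y) * (1 + y)) := by ring
      _ ≤ (lam - 1) * ((m + 2) * (m + 2)) * 2 := by
        gcongr
        norm_num
      _ = _ := by push_cast; ring

/-- The right hand side of the profile equation. -/
theorem profile_rhs_eq {n : ℕ} (hn : 1 ≤ n) {lam : ℝ} (hlam : 1 < lam)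
    {y : ℝ} (hy : 0 < y) :
    1 / (lam ^ (n + 1) * y ^ (n - 1)) *
      (lam ^ n * y ^ n
        + ∑ j ∈ Finset.range n, (-1) ^ (n - j) * ((n.factorial : ℝ) / (j.factorial : ℝ))
            * (1 - lam) * (lam * y) ^ j
        + (-1) ^ (n - 1) * (n.factorial : ℝ) * (1 - lam) * Real.exp (-(lam * y)))
      = y * (1 - y * curvFun n lam y) := by
  have h0 : 0 < lam := by linarith
  have h := exp_remainder_eq n hn (lam * y)
  have hG := one_sub_mul_curvFun hn lam y
  -- Exposes the sum as 1-λ times the Taylor polynomial in `exp_remainder_eq`, taken at λy.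
  have hs : ∑ j ∈ Finset.range n, (-1) ^ (n - j) * ((n.factorial : ℝ) / (j.factorial : ℝ))
            * (1 - lam) * (lam * y) ^ j = (1 - lam) * (n.factorial * ∑ j ∈ Finset.range n,
              (-1) ^ (n - j) * ((lam * y) ^ j / (j.factorial : ℝ))) := by
    rw [Finset.mul_sum, Finset.mul_sum]
    refine Finset.sum_congr rfl fun j _ => ?_
    ring
  rw [hs, one_div_mul_eq_div, div_eq_iff (by positivity)]
  obtain ⟨m, rfl⟩ : ∃ m, n = m + 1 := ⟨n - 1, by omega⟩
  rw [Nat.add_sub_cancel] at *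
  have e : (lam * y) ^ (m + 1) = lam ^ (m + 1) * (y * y ^ m) := by ring
  rw [e] at h
  linear_combination (1 - lam) * h - lam ^ (m + 1) * y * y ^ m * hG

/-! ### Linearization of the profile equation at the origin -/

/-- A solution of a first order equation with smooth right hand side is smooth. -/
theorem contDiff_of_hasFDerivAt_comp {E : Type*} [NormedAddCommGroup E] [NormedSpace ℝ E]
    {f : E → ℝ} {H : E × ℝ → E →L[ℝ] ℝ} (hH : ContDiff ℝ ∞ H)
    (hf : ∀ w, HasFDerivAt f (H (w, f w)) w) : ContDiff ℝ ∞ f := by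
  refine contDiff_infty.2 fun m => ?_
  induction m with
  | zero => exact contDiff_zero.2 (continuous_iff_continuousAt.2 fun w => (hf w).continuousAt)
  | succ m ih =>
    rw [show ((m + 1 : ℕ) : WithTop ℕ∞) = (m : WithTop ℕ∞) + 1 by simp, contDiff_succ_iff_fderiv]
    refine ⟨fun w => (hf w).differentiableAt, by simp, ?_⟩
    rw [show fderiv ℝ f = fun w => H (w, f w) from funext fun w => (hf w).fderiv]
    exact (contDiff_infty.1 hH m).comp (contDiff_id.prodMk ih)

/-- `K(y) = ∫_0^y k / (1 - yk)`. -/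
def linExponent (n : ℕ) (lam y : ℝ) : ℝ :=
  ∫ v in (0 : ℝ)..y, curvFun n lam v / (1 - v * curvFun n lam v)

/-- The linearizing coordinate `P(y) = y e^{K(y)}`. -/
def linCoord (n : ℕ) (lam y : ℝ) : ℝ := y * Real.exp (linExponent n lam y)

/-- The inverse of the linearizing coordinate. -/
def linInv (n : ℕ) (lam : ℝ) : ℝ → ℝ := Function.invFun (linCoord n lam)

/-- `J(y) = ∫_0^y 1 / (1 - yk)`. -/
def potFun (n : ℕ) (lam y : ℝ) : ℝ :=
  ∫ v in (0 : ℝ)..y, 1 / (1 - v * curvFun n lam v)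

section

variable {n : ℕ} {lam : ℝ}

theorem continuous_curvFun : Continuous (curvFun n lam) := (contDiff_curvFun n lam).continuous

theorem hasDerivAt_linExponent (hn : 1 ≤ n) (hlam : 1 < lam) (y : ℝ) :
    HasDerivAt (linExponent n lam) (curvFun n lam y / (1 - y * curvFun n lam y)) y := by
  have hc : Continuous fun v => curvFun n lam v / (1 - v * curvFun n lam v) :=
    continuous_curvFun.div (continuous_const.sub (continuous_id.mul continuous_curvFun))
      fun v => (one_sub_mul_curvFun_pos hn hlam v).ne'
  exact intervalIntegral.integral_hasDerivAt_right (hc.intervalIntegrable _ _)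
    hc.aestronglyMeasurable.stronglyMeasurableAtFilter hc.continuousAt

theorem hasDerivAt_potFun (hn : 1 ≤ n) (hlam : 1 < lam) (y : ℝ) :
    HasDerivAt (potFun n lam) (1 / (1 - y * curvFun n lam y)) y := by
  have hc : Continuous fun v => 1 / (1 - v * curvFun n lam v) :=
    continuous_const.div (continuous_const.sub (continuous_id.mul continuous_curvFun))
      fun v => (one_sub_mul_curvFun_pos hn hlam v).ne'
  exact intervalIntegral.integral_hasDerivAt_right (hc.intervalIntegrable _ _)
    hc.aestronglyMeasurable.stronglyMeasurableAtFilter hc.continuousAt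

theorem hasDerivAt_linCoord (hn : 1 ≤ n) (hlam : 1 < lam) (y : ℝ) :
    HasDerivAt (linCoord n lam)
      (Real.exp (linExponent n lam y) / (1 - y * curvFun n lam y)) y := by
  have hG := (one_sub_mul_curvFun_pos hn hlam y).ne'
  refine ((hasDerivAt_id' y).fun_mul (hasDerivAt_linExponent hn hlam y).exp).congr_deriv ?_
  field_simp
  ring

theorem linCoord_deriv_pos (hn : 1 ≤ n) (hlam : 1 < lam) (y : ℝ) :
    0 < Real.exp (linExponent n lam y) / (1 - y * curvFun n lam y) :=
  div_pos (Real.exp_pos _) (one_sub_mul_curvFun_pos hn hlam y)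

theorem strictMono_linCoord (hn : 1 ≤ n) (hlam : 1 < lam) : StrictMono (linCoord n lam) :=
  strictMono_of_deriv_pos fun y => by
    rw [(hasDerivAt_linCoord hn hlam y).deriv]
    exact linCoord_deriv_pos hn hlam y

theorem linCoord_zero : linCoord n lam 0 = 0 := zero_mul _

theorem continuous_linCoord (hn : 1 ≤ n) (hlam : 1 < lam) : Continuous (linCoord n lam) :=
  continuous_iff_continuousAt.2 fun y => (hasDerivAt_linCoord hn hlam y).continuousAt

/-- Openness makes `linInv` a true inverse on a full neighbourhood of every s ≥ 0. In particular its
derivative at s = 0, which is the origin of ℂⁿ, is two-sided. -/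
theorem isOpenEmbedding_linCoord (hn : 1 ≤ n) (hlam : 1 < lam) :
    IsOpenEmbedding (linCoord n lam) := by
  refine .of_continuous_injective_isOpenMap (continuous_linCoord hn hlam)
    (strictMono_linCoord hn hlam).injective ?_
  refine isOpenMap_of_hasStrictDerivAt (f' := fun y => Real.exp (linExponent n lam y) /
    (1 - y * curvFun n lam y)) (fun y => ?_) fun y => (linCoord_deriv_pos hn hlam y).ne'
  refine hasStrictDerivAt_of_hasDerivAt_of_continuousAt
    (Eventually.of_forall (hasDerivAt_linCoord hn hlam)) ?_
  refine ContinuousAt.div (hasDerivAt_linExponent hn hlam y).continuousAt.rexp ?_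
    (one_sub_mul_curvFun_pos hn hlam y).ne'
  exact (continuous_const.sub (continuous_id.mul continuous_curvFun)).continuousAt

theorem linExponent_nonneg (hn : 1 ≤ n) (hlam : 1 < lam) {y : ℝ} (hy : 0 ≤ y) :
    0 ≤ linExponent n lam y :=
  intervalIntegral.integral_nonneg hy fun v _ =>
    (div_pos (curvFun_pos n hlam v) (one_sub_mul_curvFun_pos hn hlam v)).le

theorem le_linCoord (hn : 1 ≤ n) (hlam : 1 < lam) {y : ℝ} (hy : 0 ≤ y) : y ≤ linCoord n lam y :=
  le_mul_of_one_le_right hy (Real.one_le_exp (linExponent_nonneg hn hlam hy))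

theorem exists_linCoord_eq (hn : 1 ≤ n) (hlam : 1 < lam) {s : ℝ} (hs : 0 ≤ s) :
    ∃ y, linCoord n lam y = s := by
  have h := intermediate_value_Icc hs (continuous_linCoord hn hlam).continuousOn
  obtain ⟨y, -, hy⟩ := h ⟨by rwa [linCoord_zero], le_linCoord hn hlam hs⟩
  exact ⟨y, hy⟩

theorem linInv_linCoord (hn : 1 ≤ n) (hlam : 1 < lam) (y : ℝ) :
    linInv n lam (linCoord n lam y) = y :=
  Function.leftInverse_invFun (strictMono_linCoord hn hlam).injective y

theorem linCoord_linInv (hn : 1 ≤ n) (hlam : 1 < lam) {s : ℝ} (hs : 0 ≤ s) :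
    linCoord n lam (linInv n lam s) = s := by
  obtain ⟨y, rfl⟩ := exists_linCoord_eq hn hlam hs
  rw [linInv_linCoord hn hlam]

theorem hasDerivAt_linInv (hn : 1 ≤ n) (hlam : 1 < lam) {s : ℝ} (hs : 0 ≤ s) :
    HasDerivAt (linInv n lam) ((1 - linInv n lam s * curvFun n lam (linInv n lam s)) *
      Real.exp (-linExponent n lam (linInv n lam s))) s := by
  obtain ⟨y, rfl⟩ := exists_linCoord_eq hn hlam hs
  have he := isOpenEmbedding_linCoord hn hlam
  have hc : ContinuousAt (linInv n lam) (linCoord n lam y) := by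
    rw [← he.continuousAt_iff]
    exact continuousAt_id.congr (Eventually.of_forall fun y => (linInv_linCoord hn hlam y).symm)
  have hr : ∀ᶠ s in 𝓝 (linCoord n lam y), linCoord n lam (linInv n lam s) = s := by
    filter_upwards [he.isOpen_range.mem_nhds ⟨y, rfl⟩] with s hs
    obtain ⟨v, rfl⟩ := hs
    rw [linInv_linCoord hn hlam]
  have := HasDerivAt.of_local_left_inverse hc
    (hasDerivAt_linCoord hn hlam _) (linCoord_deriv_pos hn hlam _).ne' hr
  refine this.congr_deriv ?_
  rw [inv_div, Real.exp_neg]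
  rfl

theorem linInv_pos (hn : 1 ≤ n) (hlam : 1 < lam) {s : ℝ} (hs : 0 < s) : 0 < linInv n lam s := by
  rw [← (strictMono_linCoord hn hlam).lt_iff_lt, linCoord_zero, linCoord_linInv hn hlam hs.le]
  exact hs

end

/-! ### Radial solutions and their correspondence with Cao profiles. -/

/-- The radial data of a rotationally symmetric soliton in terms of `s = |z|²`: the potential is
`Φ(s)`, `a = Φ'`, and `φ = s a` is the moment coordinate. -/
structure IsRadialSoliton (n : ℕ) (lam : ℝ) (Φ a : ℝ → ℝ) : Prop where
  pos : ∀ s, 0 ≤ s → 0 < a s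
  hasDerivAt_pot : ∀ s, 0 ≤ s → HasDerivAt Φ (a s) s
  -- The profile equation s (sa)' = sa (1 - sa k) after subtracting sa and dividing by s²; in this
  -- form it makes sense at s = 0.
  hasDerivAt : ∀ s, 0 ≤ s → HasDerivAt a (-(a s ^ 2 * curvFun n lam (s * a s))) s
  surj : ∀ y, 0 ≤ y → ∃ s, 0 ≤ s ∧ s * a s = y

/-- The solution of the radial equation with `a(0) = C`. -/
def radialSol (n : ℕ) (lam C s : ℝ) : ℝ := C * Real.exp (-linExponent n lam (linInv n lam (C * s)))

section

variable {n : ℕ} {lam : ℝ}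

theorem mul_radialSol (hn : 1 ≤ n) (hlam : 1 < lam) {C : ℝ} (hC : 0 < C) {s : ℝ} (hs : 0 ≤ s) :
    s * radialSol n lam C s = linInv n lam (C * s) := by
  have h := linCoord_linInv hn hlam (mul_nonneg hC.le hs)
  rw [radialSol, ← mul_assoc, mul_comm s C]
  nth_rw 1 [← h]
  rw [linCoord, mul_assoc, ← Real.exp_add]
  simp

theorem isRadialSoliton_radialSol (hn : 1 ≤ n) (hlam : 1 < lam) {C : ℝ} (hC : 0 < C) (c : ℝ) :
    IsRadialSoliton n lam (fun s => c + potFun n lam (linInv n lam (C * s)))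
      (radialSol n lam C) where
  pos s _ := mul_pos hC (Real.exp_pos _)
  hasDerivAt_pot s hs := by
    have h1 : HasDerivAt (fun s => C * s) C s := by simpa using (hasDerivAt_id' s).const_mul C
    have h2 := (hasDerivAt_linInv hn hlam (mul_nonneg hC.le hs)).comp s h1
    refine (((hasDerivAt_potFun hn hlam (linInv n lam (C * s))).comp s h2).const_add c).congr_deriv ?_
    have := (one_sub_mul_curvFun_pos hn hlam (linInv n lam (C * s))).ne'
    rw [radialSol]
    field_simp
  hasDerivAt s hs := by
    have h1 : HasDerivAt (fun s => C * s) C s := by simpa using (hasDerivAt_id' s).const_mul C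
    have h2 := (hasDerivAt_linInv hn hlam (mul_nonneg hC.le hs)).comp s h1
    have h3 := ((hasDerivAt_linExponent hn hlam (linInv n lam (C * s))).comp s h2).fun_neg.exp
    refine (h3.const_mul C).congr_deriv ?_
    have := (one_sub_mul_curvFun_pos hn hlam (linInv n lam (C * s))).ne'
    rw [mul_radialSol hn hlam hC hs, radialSol]
    simp only [Function.comp_apply]
    generalize 1 - linInv n lam (C * s) * curvFun n lam (linInv n lam (C * s)) = G at this ⊢
    field_simp
  surj y hy := by
    have h0 : 0 ≤ linCoord n lam y := hy.trans (le_linCoord hn hlam hy)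
    have h1 : 0 ≤ linCoord n lam y / C := div_nonneg h0 hC.le
    refine ⟨linCoord n lam y / C, h1, ?_⟩
    rw [mul_radialSol hn hlam hC h1, mul_div_cancel₀ _ hC.ne', linInv_linCoord hn hlam]

theorem IsCaoProfile.exists_isRadialSoliton (hn : 1 ≤ n) (hlam : 1 < lam) {u : ℝ → ℝ}
    (hu : IsCaoProfile n lam u) :
    ∃ Φ a, IsRadialSoliton n lam Φ a ∧ ∀ t, u t = Φ (Real.exp t) := by
  have hode : ∀ t, deriv (deriv u) t = deriv u t * (1 - deriv u t * curvFun n lam (deriv u t)) :=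
    fun t => by rw [hu.ode t, profile_rhs_eq hn hlam (hu.pos t)]
  have hdu : ∀ t, HasDerivAt u (deriv u t) t := fun t =>
    (hu.smooth.differentiable (by simp) t).hasDerivAt
  have hddu : ∀ t, HasDerivAt (deriv u)
      (deriv u t * (1 - deriv u t * curvFun n lam (deriv u t))) t := fun t => by
    rw [← hode t]
    exact ((contDiff_infty_iff_deriv.1 hu.smooth).2.differentiable (by simp) t).hasDerivAt
  set φ := deriv u
  -- The logarithmic derivative of P is 1/(yG) while φ' = φG, so P(φ(t)) e^{-t} is constant.
  have hlin : ∀ t, linCoord n lam (φ t) = linCoord n lam (φ 0) * Real.exp t := by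
    have hd : ∀ t, HasDerivAt (fun t => linCoord n lam (φ t) * Real.exp (-t)) 0 t := fun t => by
      refine (((hasDerivAt_linCoord hn hlam (φ t)).comp t (hddu t)).fun_mul
        (hasDerivAt_neg t).exp).congr_deriv ?_
      have := (one_sub_mul_curvFun_pos hn hlam (φ t)).ne'
      simp only [Function.comp_apply, linCoord]
      field_simp
      ring
    intro t
    have h := is_const_of_deriv_eq_zero (fun t => (hd t).differentiableAt)
      (fun t => (hd t).deriv) t 0
    simp only [neg_zero, Real.exp_zero, mul_one] at h
    rw [← h, mul_assoc, ← Real.exp_add]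
    simp
  set C := linCoord n lam (φ 0)
  have hC : 0 < C := by
    have := strictMono_linCoord hn hlam (hu.pos 0)
    rwa [linCoord_zero] at this
  have hφ : ∀ t, φ t = linInv n lam (C * Real.exp t) := fun t => by
    rw [← hlin t, linInv_linCoord hn hlam]
  -- The additive constant makes the two potentials agree at t = 0; they have the same derivative φ.
  refine ⟨_, _, isRadialSoliton_radialSol hn hlam hC
    (u 0 - potFun n lam (linInv n lam (C * Real.exp 0))), fun t => ?_⟩
  have hr := isRadialSoliton_radialSol hn hlam hC 0
  have hd : ∀ t, HasDerivAt (fun t => u t - (0 + potFun n lam (linInv n lam (C * Real.exp t)))) 0 t :=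
    fun t => by
      refine ((hdu t).fun_sub ((hr.hasDerivAt_pot _ (Real.exp_pos t).le).comp t
        (Real.hasDerivAt_exp t))).congr_deriv ?_
      rw [mul_comm, mul_radialSol hn hlam hC (Real.exp_pos t).le, ← hφ]
      exact sub_self _
  have h := is_const_of_deriv_eq_zero (fun t => (hd t).differentiableAt)
    (fun t => (hd t).deriv) t 0
  linarith

/-- The choice C = 1 loses nothing, since another C is a translation in t. Smoothness of φ is
bootstrapped from its autonomous equation, and `potFun` supplies a primitive: J' = 1/G turns φ' = φG
into (J ∘ φ)' = φ. -/
theorem exists_isCaoProfile (hn : 1 ≤ n) (hlam : 1 < lam) : ∃ u, IsCaoProfile n lam u := by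
  have hr := isRadialSoliton_radialSol hn hlam one_pos 0
  set φ : ℝ → ℝ := fun t => linInv n lam (Real.exp t) with hφ
  have hpos : ∀ t, 0 < φ t := fun t => linInv_pos hn hlam (Real.exp_pos t)
  have hdφ : ∀ t, HasDerivAt φ (φ t * (1 - φ t * curvFun n lam (φ t))) t := fun t => by
    refine ((hasDerivAt_linInv hn hlam (Real.exp_pos t).le).comp t
      (Real.hasDerivAt_exp t)).congr_deriv ?_
    have h : linCoord n lam (φ t) = Real.exp t := linCoord_linInv hn hlam (Real.exp_pos t).le
    rw [linCoord] at h
    change (1 - φ t * curvFun n lam (φ t)) * Real.exp (-linExponent n lam (φ t)) * Real.exp t = _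
    rw [← h, mul_assoc, mul_left_comm (Real.exp _) (φ t), ← Real.exp_add]
    simp
    ring
  have hdu : ∀ t, HasDerivAt (fun t => potFun n lam (φ t)) (φ t) t := fun t => by
    refine ((hasDerivAt_potFun hn hlam (φ t)).comp t (hdφ t)).congr_deriv ?_
    have := (one_sub_mul_curvFun_pos hn hlam (φ t)).ne'
    field_simp
  have hsm : ContDiff ℝ ∞ φ := by
    refine contDiff_of_hasFDerivAt_comp (H := fun p => ContinuousLinearMap.toSpanSingleton ℝ
      (p.2 * (1 - p.2 * curvFun n lam p.2))) ?_ fun t => (hdφ t).hasFDerivAt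
    have h1 : ContDiff ℝ ∞ fun p : ℝ × ℝ => p.2 * (1 - p.2 * curvFun n lam p.2) :=
      contDiff_snd.mul (contDiff_const.sub (contDiff_snd.mul
        ((contDiff_curvFun n lam).comp contDiff_snd)))
    exact (ContinuousLinearMap.toSpanSingletonCLE (𝕜 := ℝ) (E := ℝ)).contDiff.comp h1
  have e1 : deriv (fun t => potFun n lam (φ t)) = φ := funext fun t => (hdu t).deriv
  have e2 : ∀ t, deriv φ t = φ t * (1 - φ t * curvFun n lam (φ t)) := fun t => (hdφ t).deriv
  refine ⟨fun t => potFun n lam (φ t), ?_, ?_, ?_, ?_⟩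
  · rw [contDiff_infty_iff_deriv, e1]
    exact ⟨fun t => (hdu t).differentiableAt, hsm⟩
  · rw [e1]; exact hpos
  · intro t
    rw [e1, e2]
    exact mul_pos (hpos t) (one_sub_mul_curvFun_pos hn hlam _)
  · intro t
    rw [e1, e2, profile_rhs_eq hn hlam (hpos t)]

end

/-! ### Wirtinger calculus of radial functions -/

/-- `|z|²`. -/
def nsq {n : ℕ} (z : Fin n → ℂ) : ℝ := ∑ i, ‖z i‖ ^ 2

theorem nsq_nonneg {n : ℕ} (z : Fin n → ℂ) : 0 ≤ nsq z := Finset.sum_nonneg fun _ _ => by positivity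

theorem nsq_eq_zero {n : ℕ} {z : Fin n → ℂ} : nsq z = 0 ↔ z = 0 := by
  rw [nsq, Finset.sum_eq_zero_iff_of_nonneg fun _ _ => by positivity]
  simp [funext_iff]

theorem nsq_zero {n : ℕ} : nsq (0 : Fin n → ℂ) = 0 := nsq_eq_zero.2 rfl

theorem nsq_pos {n : ℕ} {z : Fin n → ℂ} (hz : z ≠ 0) : 0 < nsq z :=
  (nsq_nonneg z).lt_of_ne fun h => hz (nsq_eq_zero.1 h.symm)

theorem ofReal_nsq {n : ℕ} (z : Fin n → ℂ) : (nsq z : ℂ) = ∑ i, star (z i) * z i := by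
  rw [nsq]
  push_cast
  refine Finset.sum_congr rfl fun i _ => ?_
  rw [Complex.star_def, Complex.conj_mul']

/-- The differential of `|z|²`, `v ↦ 2 Re ∑ conj z_i v_i`. -/
def nsqDeriv {n : ℕ} (z : Fin n → ℂ) : (Fin n → ℂ) →L[ℝ] ℝ :=
  ∑ i, 2 • (innerSL ℝ (z i)).comp (ContinuousLinearMap.proj i)

theorem hasFDerivAt_nsq {n : ℕ} (z : Fin n → ℂ) : HasFDerivAt nsq (nsqDeriv z) z :=
  HasFDerivAt.fun_sum fun i _ => (hasFDerivAt_apply (𝕜 := ℝ) i z).norm_sq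

theorem nsqDeriv_apply {n : ℕ} (z v : Fin n → ℂ) :
    nsqDeriv z v = 2 * (∑ i, star (z i) * v i).re := by
  simp only [nsqDeriv, _root_.sum_apply, Complex.re_sum, Finset.mul_sum]
  refine Finset.sum_congr rfl fun i _ => ?_
  simp [Complex.inner]
  ring

theorem contDiff_nsq {n : ℕ} : ContDiff ℝ ∞ (nsq (n := n)) :=
  ContDiff.sum fun i _ => (contDiff_apply ℝ ℂ i).norm_sq ℝ

theorem contDiff_nsqDeriv {n : ℕ} : ContDiff ℝ ∞ (nsqDeriv (n := n)) := by
  have : nsqDeriv (n := n) = fderiv ℝ nsq := funext fun z => (hasFDerivAt_nsq z).fderiv.symm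
  rw [this]
  exact (contDiff_infty_iff_fderiv.1 contDiff_nsq).2

/-- `F` is real differentiable at `z` with `∂_α F = p` and `∂_ᾱ F = q`. -/
def HasWirtinger {n : ℕ} (α : Fin n) (F : (Fin n → ℂ) → ℂ) (p q : ℂ) (z : Fin n → ℂ) : Prop :=
  DifferentiableAt ℝ F z ∧ dz α F z = p ∧ dzbar α F z = q

section

variable {n : ℕ} {α : Fin n} {F F' : (Fin n → ℂ) → ℂ} {p q p' q' : ℂ} {z : Fin n → ℂ}

theorem HasFDerivAt.hasWirtinger {D : (Fin n → ℂ) →L[ℝ] ℂ} (h : HasFDerivAt F D z) (α : Fin n) :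
    HasWirtinger α F ((D (Pi.single α 1) - Complex.I * D (Pi.single α Complex.I)) / 2)
      ((D (Pi.single α 1) + Complex.I * D (Pi.single α Complex.I)) / 2) z :=
  ⟨h.differentiableAt, by rw [dz, h.fderiv], by rw [dzbar, h.fderiv]⟩

theorem HasWirtinger.congr (h : HasWirtinger α F p q z) (hp : p = p') (hq : q = q') :
    HasWirtinger α F p' q' z := hp ▸ hq ▸ h

theorem HasWirtinger.add (h : HasWirtinger α F p q z) (h' : HasWirtinger α F' p' q' z) :
    HasWirtinger α (fun w => F w + F' w) (p + p') (q + q') z := by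
  obtain ⟨h1, rfl, rfl⟩ := h
  obtain ⟨h2, rfl, rfl⟩ := h'
  refine (HasFDerivAt.hasWirtinger (h1.hasFDerivAt.fun_add h2.hasFDerivAt) α).congr ?_ ?_ <;>
    simp [dz, dzbar] <;> ring

theorem HasWirtinger.mul (h : HasWirtinger α F p q z) (h' : HasWirtinger α F' p' q' z) :
    HasWirtinger α (fun w => F w * F' w) (F z * p' + p * F' z) (F z * q' + q * F' z) z := by
  obtain ⟨h1, rfl, rfl⟩ := h
  obtain ⟨h2, rfl, rfl⟩ := h'
  refine (HasFDerivAt.hasWirtinger (h1.hasFDerivAt.fun_mul h2.hasFDerivAt) α).congr ?_ ?_ <;>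
    simp [dz, dzbar] <;> ring

theorem hasWirtinger_const (c : ℂ) : HasWirtinger α (fun _ => c) 0 0 z :=
  (HasFDerivAt.hasWirtinger (hasFDerivAt_const c z) α).congr (by simp) (by simp)

/-- The Kronecker symbol. -/
def kron (α β : Fin n) : ℂ := if α = β then 1 else 0

theorem kron_comm (α β : Fin n) : kron α β = kron β α := by simp [kron, eq_comm]

theorem star_kron (α β : Fin n) : star (kron α β) = kron α β := by
  simp only [kron]; split_ifs <;> simp

theorem sum_kron_mul (α : Fin n) (f : Fin n → ℂ) : ∑ β, kron β α * f β = f α := by simp [kron]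

theorem sum_kron_mul' (α : Fin n) (f : Fin n → ℂ) : ∑ β, kron α β * f β = f α := by simp [kron]

theorem sum_kron_self : ∑ α : Fin n, kron α α = n := by simp [kron]

theorem hasWirtinger_coord (β : Fin n) : HasWirtinger α (fun w => w β) (kron α β) 0 z := by
  refine (HasFDerivAt.hasWirtinger (hasFDerivAt_apply (𝕜 := ℝ) β z) α).congr ?_ ?_ <;>
    by_cases h : α = β
  · subst h; simp [kron]
  · simp [kron, h]
  · subst h; simp
  · simp [Pi.single_eq_of_ne (Ne.symm h)]

theorem hasWirtinger_conj (β : Fin n) : HasWirtinger α (fun w => star (w β)) 0 (kron α β) z := by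
  have hd : HasFDerivAt (fun w : Fin n → ℂ => star (w β))
      ((Complex.conjCLE : ℂ →L[ℝ] ℂ).comp (ContinuousLinearMap.proj β)) z :=
    (Complex.conjCLE : ℂ →L[ℝ] ℂ).hasFDerivAt.comp z (hasFDerivAt_apply (𝕜 := ℝ) β z)
  refine (HasFDerivAt.hasWirtinger hd α).congr ?_ ?_ <;>
    by_cases h : α = β
  · subst h; simp
  · simp [Pi.single_eq_of_ne (Ne.symm h)]
  · subst h; simp [kron]
  · simp [kron, h]

theorem hasFDerivAt_radial {f : ℝ → ℝ} {f' : ℝ} (hf : HasDerivAt f f' (nsq z)) :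
    HasFDerivAt (fun w => f (nsq w)) (f' • nsqDeriv z) z :=
  hf.comp_hasFDerivAt z (hasFDerivAt_nsq z)

theorem hasWirtinger_radial {f : ℝ → ℝ} {f' : ℝ} (hf : HasDerivAt f f' (nsq z)) :
    HasWirtinger α (fun w => (f (nsq w) : ℂ)) (f' * star (z α)) (f' * z α) z := by
  have hd := Complex.ofRealCLM.hasFDerivAt.comp z (hasFDerivAt_radial hf)
  have h1 : nsqDeriv z (Pi.single α 1) = 2 * (z α).re := by
    rw [nsqDeriv_apply, Finset.sum_eq_single α] <;> simp +contextual
  have h2 : nsqDeriv z (Pi.single α Complex.I) = 2 * (z α).im := by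
    rw [nsqDeriv_apply, Finset.sum_eq_single α] <;> simp +contextual
  refine (HasFDerivAt.hasWirtinger hd α).congr ?_ ?_ <;>
    simp only [ContinuousLinearMap.comp_apply, _root_.smul_apply, h1, h2,
      Complex.ofRealCLM_apply, smul_eq_mul]
  · push_cast
    rw [Complex.star_def, ← Complex.re_add_im ((starRingEnd ℂ) (z α))]
    simp
    ring
  · push_cast
    nth_rw 3 [← Complex.re_add_im (z α)]
    ring

end

/-! ### Curvature of radial Kähler metrics -/

/-- The matrices `a δ_{αβ} + a₁ conj z_α z_β` with coefficients depending on `|z|²`. -/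
def radialMetric (n : ℕ) (a a₁ : ℝ → ℝ) : MetricField n := fun z =>
  Matrix.of fun α β => (a (nsq z) : ℂ) * kron α β + a₁ (nsq z) * (star (z α) * z β)

section

variable {n : ℕ} {a a₁ a₂ a₃ : ℝ → ℝ} {z : Fin n → ℂ}

theorem radialMetric_apply (α β : Fin n) : radialMetric n a a₁ z α β =
    (a (nsq z) : ℂ) * kron α β + a₁ (nsq z) * (star (z α) * z β) := rfl

theorem dz_dzbar_radial {f f' f'' : ℝ → ℝ} (hf : ∀ s, 0 ≤ s → HasDerivAt f (f' s) s)
    (hf' : ∀ s, 0 ≤ s → HasDerivAt f' (f'' s) s) (z : Fin n → ℂ) (α β : Fin n) :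
    dz α (dzbar β fun w => (f (nsq w) : ℂ)) z = radialMetric n f' f'' z α β := by
  have h : (dzbar β fun w : Fin n → ℂ => (f (nsq w) : ℂ)) = fun w => (f' (nsq w) : ℂ) * w β :=
    funext fun w => (hasWirtinger_radial (α := β) (hf _ (nsq_nonneg w))).2.2
  rw [h, ((hasWirtinger_radial (hf' _ (nsq_nonneg z))).mul (hasWirtinger_coord β)).2.1,
    radialMetric_apply]
  ring

theorem dz_dz_radial {f f' f'' : ℝ → ℝ} (hf : ∀ s, 0 ≤ s → HasDerivAt f (f' s) s)
    (hf' : ∀ s, 0 ≤ s → HasDerivAt f' (f'' s) s) (z : Fin n → ℂ) (α β : Fin n) :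
    dz α (dz β fun w => (f (nsq w) : ℂ)) z = f'' (nsq z) * (star (z α) * star (z β)) := by
  have h : (dz β fun w : Fin n → ℂ => (f (nsq w) : ℂ)) = fun w => (f' (nsq w) : ℂ) * star (w β) :=
    funext fun w => (hasWirtinger_radial (α := β) (hf _ (nsq_nonneg w))).2.1
  rw [h, ((hasWirtinger_radial (hf' _ (nsq_nonneg z))).mul (hasWirtinger_conj β)).2.1]
  ring

theorem dzbar_dzbar_radial {f f' f'' : ℝ → ℝ} (hf : ∀ s, 0 ≤ s → HasDerivAt f (f' s) s)
    (hf' : ∀ s, 0 ≤ s → HasDerivAt f' (f'' s) s) (z : Fin n → ℂ) (α β : Fin n) :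
    dzbar α (dzbar β fun w => (f (nsq w) : ℂ)) z = f'' (nsq z) * (z α * z β) := by
  have h : (dzbar β fun w : Fin n → ℂ => (f (nsq w) : ℂ)) = fun w => (f' (nsq w) : ℂ) * w β :=
    funext fun w => (hasWirtinger_radial (α := β) (hf _ (nsq_nonneg w))).2.2
  rw [h, ((hasWirtinger_radial (hf' _ (nsq_nonneg z))).mul (hasWirtinger_coord β)).2.2]
  ring

theorem hasWirtinger_radialMetric (ha : ∀ s, 0 ≤ s → HasDerivAt a (a₁ s) s)
    (ha₁ : ∀ s, 0 ≤ s → HasDerivAt a₁ (a₂ s) s) (η α β : Fin n) :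
    HasWirtinger η (fun w => radialMetric n a a₁ w α β)
      (a₁ (nsq z) * (star (z η) * kron α β + star (z α) * kron η β)
        + a₂ (nsq z) * (star (z η) * star (z α) * z β))
      (a₁ (nsq z) * (z η * kron α β + z β * kron η α)
        + a₂ (nsq z) * (z η * z β * star (z α))) z := by
  refine HasWirtinger.congr (((hasWirtinger_radial (ha _ (nsq_nonneg z))).mul
    (hasWirtinger_const (kron α β))).add ((hasWirtinger_radial (ha₁ _ (nsq_nonneg z))).mul
      ((hasWirtinger_conj α).mul (hasWirtinger_coord β)))) ?_ ?_ <;> ring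

theorem dz_dzbar_radialMetric (ha : ∀ s, 0 ≤ s → HasDerivAt a (a₁ s) s)
    (ha₁ : ∀ s, 0 ≤ s → HasDerivAt a₁ (a₂ s) s) (ha₂ : ∀ s, 0 ≤ s → HasDerivAt a₂ (a₃ s) s)
    (α β γ η : Fin n) :
    dz γ (dzbar η fun w => radialMetric n a a₁ w α β) z =
      a₁ (nsq z) * (kron α β * kron γ η + kron α η * kron γ β)
      + a₂ (nsq z) * (z η * star (z γ) * kron α β + z β * star (z γ) * kron α η
        + kron γ η * (star (z α) * z β) + z η * star (z α) * kron γ β)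
      + a₃ (nsq z) * (star (z α) * star (z γ) * (z β * z η)) := by
  have h : (dzbar η fun w => radialMetric n a a₁ w α β) = fun w =>
      (a₁ (nsq w) : ℂ) * (w η * kron α β + w β * kron η α)
        + a₂ (nsq w) * (w η * w β * star (w α)) :=
    funext fun w => (hasWirtinger_radialMetric ha ha₁ η α β).2.2
  rw [h, (HasWirtinger.add ((hasWirtinger_radial (ha₁ _ (nsq_nonneg z))).mul
    (((hasWirtinger_coord η).mul (hasWirtinger_const (kron α β))).add
      ((hasWirtinger_coord β).mul (hasWirtinger_const (kron η α)))))
    ((hasWirtinger_radial (ha₂ _ (nsq_nonneg z))).mul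
      (((hasWirtinger_coord η).mul (hasWirtinger_coord β)).mul (hasWirtinger_conj α)))).2.1,
    kron_comm α η]
  ring

theorem sum_radial_vec (c₁ c₂ : ℂ) (β η : Fin n) (y X : Fin n → ℂ) :
    ∑ ξ, (c₁ * (y η * kron ξ β + y β * kron η ξ) + c₂ * (y η * y β * star (y ξ))) * X ξ =
      c₁ * (y η * X β + y β * X η) + c₂ * (y η * y β * ∑ ξ, star (y ξ) * X ξ) := by
  have : ∀ ξ, (c₁ * (y η * kron ξ β + y β * kron η ξ) + c₂ * (y η * y β * star (y ξ))) * X ξ =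
      c₁ * y η * (kron ξ β * X ξ) + c₁ * y β * (kron η ξ * X ξ)
        + c₂ * y η * y β * (star (y ξ) * X ξ) := fun ξ => by ring
  simp only [this, Finset.sum_add_distrib, ← Finset.mul_sum, sum_kron_mul, sum_kron_mul']
  ring

/-- Contraction with a tensor `p δ_{ξζ} - q z_ξ conj z_ζ`. -/
theorem sum_radial_inv (p q : ℂ) (z V W : Fin n → ℂ) :
    ∑ ξ, ∑ ζ, (p * kron ξ ζ - q * (z ξ * star (z ζ))) * V ξ * W ζ =
      p * ∑ ξ, V ξ * W ξ - q * ((∑ ξ, z ξ * V ξ) * ∑ ζ, star (z ζ) * W ζ) := by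
  have : ∀ ξ ζ, (p * kron ξ ζ - q * (z ξ * star (z ζ))) * V ξ * W ζ =
      p * V ξ * (kron ξ ζ * W ζ) - q * (z ξ * V ξ) * (star (z ζ) * W ζ) := fun ξ ζ => by ring
  simp only [this, Finset.sum_sub_distrib, ← Finset.mul_sum, sum_kron_mul']
  rw [← Finset.sum_mul, ← Finset.mul_sum]
  simp only [mul_assoc, ← Finset.mul_sum]

/-- The Sherman–Morrison formula: the metric is a multiple of the identity plus a rank one matrix,
with radial eigenvalue a + s a'. -/
theorem inv_radialMetric (h0 : a (nsq z) ≠ 0) (hb : a (nsq z) + nsq z * a₁ (nsq z) ≠ 0)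
    (α β : Fin n) :
    inv (radialMetric n a a₁) z α β = (1 / a (nsq z) : ℂ) * kron α β
      - (a₁ (nsq z) / (a (nsq z) * (a (nsq z) + nsq z * a₁ (nsq z))) : ℂ)
        * (z α * star (z β)) := by
  have h0' : (a (nsq z) : ℂ) ≠ 0 := by exact_mod_cast h0
  have hb' : (a (nsq z) + nsq z * a₁ (nsq z) : ℂ) ≠ 0 := by exact_mod_cast hb
  have hS := ofReal_nsq z
  set A : ℂ := (a (nsq z) : ℂ)
  set A₁ : ℂ := (a₁ (nsq z) : ℂ)
  set S : ℂ := (nsq z : ℂ)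
  have key : radialMetric n a a₁ z * Matrix.of (fun β α => (1 / A : ℂ) * kron α β
      - (A₁ / (A * (A + S * A₁)) : ℂ) * (z α * star (z β))) = 1 := by
    ext α γ
    rw [Matrix.mul_apply]
    have : ∀ β, radialMetric n a a₁ z α β * Matrix.of (fun β α => (1 / A : ℂ) * kron α β
      - (A₁ / (A * (A + S * A₁)) : ℂ) * (z α * star (z β))) β γ =
        A * (kron α β * ((1 / A : ℂ) * kron γ β - (A₁ / (A * (A + S * A₁)) : ℂ) * (z γ * star (z β))))
        + A₁ / A * star (z α) * (kron γ β * z β)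
        - A₁ * star (z α) * (A₁ / (A * (A + S * A₁)) : ℂ) * z γ * (star (z β) * z β) := fun β => by
      rw [radialMetric_apply, Matrix.of_apply]
      ring
    simp only [this, Finset.sum_add_distrib, Finset.sum_sub_distrib, ← Finset.mul_sum,
      sum_kron_mul', ← hS]
    rw [Matrix.one_apply, show (if α = γ then (1 : ℂ) else 0) = kron γ α by simp [kron, eq_comm]]
    have hb'' : A + A₁ * S ≠ 0 := by rwa [mul_comm A₁]
    field_simp
    ring
  rw [CaoSoliton.inv, Matrix.inv_eq_right_inv key, Matrix.of_apply]

/-- The model tensor of a radial Kähler curvature. -/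
def radialTensor (A B C : ℂ) (z : Fin n → ℂ) (α β γ η : Fin n) : ℂ :=
  A * (kron α β * kron γ η + kron α η * kron γ β)
    + B * (z η * star (z γ) * kron α β + z β * star (z γ) * kron α η
        + kron γ η * (star (z α) * z β) + z η * star (z α) * kron γ β)
    + C * (star (z α) * star (z γ) * (z β * z η))

/-- The second derivatives of g and the contracted product of first derivatives are both
combinations of the same three unitarily invariant tensors, so the curvature is fixed by three
scalar coefficients. -/
theorem curv_radialMetric (ha : ∀ s, 0 ≤ s → HasDerivAt a (a₁ s) s)
    (ha₁ : ∀ s, 0 ≤ s → HasDerivAt a₁ (a₂ s) s) (ha₂ : ∀ s, 0 ≤ s → HasDerivAt a₂ (a₃ s) s)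
    (h0 : a (nsq z) ≠ 0) (hb : a (nsq z) + nsq z * a₁ (nsq z) ≠ 0) (α β γ η : Fin n) :
    curv (radialMetric n a a₁) z α β γ η = radialTensor (-a₁ (nsq z))
      (-a₂ (nsq z) + a₁ (nsq z) ^ 2 / a (nsq z))
      (-a₃ (nsq z) + (4 * a₁ (nsq z) * a₂ (nsq z) + nsq z * a₂ (nsq z) ^ 2
        - 4 * a₁ (nsq z) ^ 3 / a (nsq z)) / (a (nsq z) + nsq z * a₁ (nsq z))) z α β γ η := by
  have h0' : (a (nsq z) : ℂ) ≠ 0 := by exact_mod_cast h0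
  have hb' : (a (nsq z) + nsq z * a₁ (nsq z) : ℂ) ≠ 0 := by exact_mod_cast hb
  rw [curv, dz_dzbar_radialMetric ha ha₁ ha₂]
  simp only [inv_radialMetric h0 hb, (hasWirtinger_radialMetric ha ha₁ _ _ _).2.1,
    (hasWirtinger_radialMetric ha ha₁ _ _ _).2.2]
  rw [sum_radial_inv]
  have hS := ofReal_nsq z
  set A : ℂ := (a (nsq z) : ℂ)
  set A₁ : ℂ := (a₁ (nsq z) : ℂ)
  set A₂ : ℂ := (a₂ (nsq z) : ℂ)
  set A₃ : ℂ := (a₃ (nsq z) : ℂ)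
  set S : ℂ := (nsq z : ℂ)
  have hS' : ∑ ξ, star (z ξ) * z ξ = S := hS.symm
  have e1 : ∑ ζ, star (z ζ) * (A₁ * (star (z γ) * kron α ζ + star (z α) * kron γ ζ)
      + A₂ * (star (z γ) * star (z α) * z ζ)) =
      2 * A₁ * star (z γ) * star (z α) + A₂ * S * (star (z γ) * star (z α)) := by
    have := sum_radial_vec A₁ A₂ α γ (fun i => star (z i)) (fun i => star (z i))
    simp only [star_star] at this
    rw [Finset.sum_congr rfl fun i _ => mul_comm (z i) (star (z i)), hS'] at this
    refine Eq.trans (Finset.sum_congr rfl fun ζ _ => ?_) (this.trans (by ring))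
    rw [kron_comm α ζ, mul_comm]
  have e2 : ∑ ξ, z ξ * (A₁ * (z η * kron ξ β + z β * kron η ξ) + A₂ * (z η * z β * star (z ξ))) =
      2 * A₁ * z η * z β + A₂ * S * (z η * z β) := by
    rw [Finset.sum_congr rfl fun i _ => mul_comm (z i) _, sum_radial_vec, hS']
    ring
  rw [e1, e2, sum_radial_vec, e1, radialTensor]
  have hb'' : A + A₁ * S ≠ 0 := by rwa [mul_comm A₁]
  field_simp
  ring

end

/-! ### Contractions of the model tensor -/

section

variable {n : ℕ}

/-- `∑ conj z_α z_β M_{αβ}`. -/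
def radialPart (z : Fin n → ℂ) (M : Fin n → Fin n → ℂ) : ℂ := ∑ α, ∑ β, star (z α) * z β * M α β

theorem sum_radialTensor_right (A B C : ℂ) (z : Fin n → ℂ) (N : Fin n → Fin n → ℂ) (α β : Fin n) :
    ∑ γ, ∑ η, radialTensor A B C z α β γ η * N γ η =
      A * (kron α β * ∑ γ, N γ γ + N β α)
        + B * (kron α β * radialPart z N + z β * ∑ γ, star (z γ) * N γ α
          + star (z α) * z β * ∑ γ, N γ γ + star (z α) * ∑ η, z η * N β η)
        + C * (star (z α) * z β * radialPart z N) := by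
  have h : ∀ γ η, radialTensor A B C z α β γ η * N γ η =
      A * kron α β * (kron γ η * N γ η) + A * (kron γ β * (kron α η * N γ η))
      + B * kron α β * (star (z γ) * z η * N γ η) + B * z β * (star (z γ) * (kron α η * N γ η))
      + B * star (z α) * z β * (kron γ η * N γ η) + B * star (z α) * (kron γ β * (z η * N γ η))
      + C * star (z α) * z β * (star (z γ) * z η * N γ η) := fun γ η => by
    rw [radialTensor]; ring
  simp only [h, Finset.sum_add_distrib, ← Finset.mul_sum, sum_kron_mul, sum_kron_mul', radialPart]
  ring

theorem sum_radialTensor (A B C : ℂ) (z : Fin n → ℂ) (M N : Fin n → Fin n → ℂ) :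
    ∑ α, ∑ β, ∑ γ, ∑ η, radialTensor A B C z α β γ η * M α β * N γ η =
      A * ((∑ α, M α α) * (∑ γ, N γ γ) + ∑ α, ∑ β, M α β * N β α)
        + B * ((∑ α, M α α) * radialPart z N
          + ∑ α, (∑ β, z β * M α β) * (∑ γ, star (z γ) * N γ α)
          + radialPart z M * (∑ γ, N γ γ)
          + ∑ β, (∑ α, star (z α) * M α β) * ∑ η, z η * N β η)
        + C * (radialPart z M * radialPart z N) := by
  have h : ∀ α β, ∑ γ, ∑ η, radialTensor A B C z α β γ η * M α β * N γ η =
      A * (∑ γ, N γ γ) * (kron α β * M α β) + A * (M α β * N β α)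
      + B * radialPart z N * (kron α β * M α β)
      + B * ((z β * M α β) * ∑ γ, star (z γ) * N γ α)
      + B * (∑ γ, N γ γ) * (star (z α) * z β * M α β)
      + B * ((star (z α) * M α β) * ∑ η, z η * N β η)
      + C * radialPart z N * (star (z α) * z β * M α β) := fun α β => by
    have : ∀ γ η, radialTensor A B C z α β γ η * M α β * N γ η =
      M α β * (radialTensor A B C z α β γ η * N γ η) := fun γ η => by ring
    simp only [this, ← Finset.mul_sum, sum_radialTensor_right]
    ring
  simp only [h, Finset.sum_add_distrib, ← Finset.mul_sum, sum_kron_mul']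
  rw [show ∑ α, ∑ β, star (z α) * z β * M α β = radialPart z M from rfl]
  simp only [← Finset.sum_mul]
  rw [Finset.sum_comm (f := fun α β => star (z α) * M α β * ∑ η, z η * N β η)]
  simp only [← Finset.sum_mul]
  ring

theorem radialPart_inv (p q : ℂ) (z : Fin n → ℂ) :
    radialPart z (fun α β => p * kron α β - q * (z α * star (z β))) =
      (p - q * nsq z) * nsq z := by
  have h : ∀ α β, star (z α) * z β * (p * kron α β - q * (z α * star (z β))) =
      p * star (z α) * (kron α β * z β) - q * (star (z α) * z α) * (star (z β) * z β) :=
    fun α β => by ring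
  simp only [radialPart, h, Finset.sum_sub_distrib, ← Finset.mul_sum, sum_kron_mul', ← ofReal_nsq,
    ← Finset.sum_mul]
  simp only [mul_assoc, ← Finset.mul_sum, ← ofReal_nsq]
  ring

/-- The Ricci contraction of the model tensor. -/
theorem ricci_radialTensor (A B C p q : ℂ) (z : Fin n → ℂ) (α β : Fin n) :
    ∑ γ, ∑ η, (p * kron γ η - q * (z γ * star (z η))) * radialTensor A B C z α β γ η =
      (n * A * p + (A + B * nsq z) * (p - q * nsq z)) * kron α β
      + (-A * q + B * (2 * (p - q * nsq z) + (n * p - q * nsq z)) + C * ((p - q * nsq z) * nsq z))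
        * (star (z α) * z β) := by
  have h1 : ∑ γ, (p * kron γ γ - q * (z γ * star (z γ))) = n * p - q * nsq z := by
    rw [Finset.sum_sub_distrib, ← Finset.mul_sum, ← Finset.mul_sum, sum_kron_self, ofReal_nsq]
    simp only [mul_comm (z _)]
    ring
  have h2 : ∑ γ, star (z γ) * (p * kron γ α - q * (z γ * star (z α)))
      = (p - q * nsq z) * star (z α) := by
    have : ∀ γ, star (z γ) * (p * kron γ α - q * (z γ * star (z α))) =
      p * (kron γ α * star (z γ)) - q * star (z α) * (star (z γ) * z γ) := fun γ => by ring
    simp only [this, Finset.sum_sub_distrib, ← Finset.mul_sum, sum_kron_mul, ← ofReal_nsq]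
    ring
  have h3 : ∑ η, z η * (p * kron β η - q * (z β * star (z η))) = (p - q * nsq z) * z β := by
    have : ∀ η, z η * (p * kron β η - q * (z β * star (z η))) =
      p * (kron β η * z η) - q * z β * (star (z η) * z η) := fun γ => by ring
    simp only [this, Finset.sum_sub_distrib, ← Finset.mul_sum, sum_kron_mul', ← ofReal_nsq]
    ring
  have := sum_radialTensor_right A B C z (fun α β => p * kron α β - q * (z α * star (z β))) α β
  rw [radialPart_inv, h1, h2, h3, kron_comm β α] at this
  simp only [mul_comm _ (radialTensor A B C z _ _ _ _)]
  rw [this]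
  ring

theorem scalar_radial (p q X Y : ℂ) (z : Fin n → ℂ) :
    ∑ α, ∑ β, (p * kron α β - q * (z α * star (z β))) * (X * kron α β + Y * (star (z α) * z β)) =
      n * (p * X) + (p * Y - q * (X + Y * nsq z)) * nsq z := by
  -- The last summand of the expansion is antisymmetric in α, β and dies against the Kronecker
  -- symbol; it corrects for replacing z_α conj z_β by its transpose.
  have h : ∀ α β, (p * kron α β - q * (z α * star (z β))) * (X * kron α β + Y * (star (z α) * z β)) =
      p * X * (kron α β * kron α β) + (p * Y - q * X) * (star (z α) * (kron α β * z β))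
        + (- q * Y * (star (z α) * z α) * (star (z β) * z β))
        + q * X * (kron α β * (star (z α) * z β - star (z β) * z α)) := fun α β => by ring
  simp only [h, Finset.sum_add_distrib, ← Finset.mul_sum, sum_kron_mul', ← ofReal_nsq, sum_kron_self,
    ← Finset.sum_mul, sub_self, Finset.sum_const_zero]
  ring

end

/-! ### The soliton metric -/

section

variable (n : ℕ) (lam : ℝ) (a : ℝ → ℝ) (s : ℝ)

/-- The slope factor `G = 1 - φ k(φ)`, where `φ = s a(s)`. -/
def solG : ℝ := 1 - s * a s * curvFun n lam (s * a s)

/-- The derivative of `a`. -/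
def solD₁ : ℝ := -(a s ^ 2 * curvFun n lam (s * a s))

/-- The second derivative of `a`. -/
def solD₂ : ℝ := a s ^ 3 * (2 * curvFun n lam (s * a s) ^ 2
  - curvFun₁ n lam (s * a s) * solG n lam a s)

/-- The third derivative of `a`. -/
def solD₃ : ℝ := a s ^ 4 * (-6 * curvFun n lam (s * a s) ^ 3
  + 8 * curvFun n lam (s * a s) * curvFun₁ n lam (s * a s) * solG n lam a s
  - curvFun₂ n lam (s * a s) * solG n lam a s ^ 2
  + s * a s * curvFun₁ n lam (s * a s) ^ 2 * solG n lam a s)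

/-- The isotropic coefficient of the curvature tensor. -/
def coefA : ℝ := a s ^ 2 * curvFun n lam (s * a s)

/-- The mixed coefficient of the curvature tensor. -/
def coefB : ℝ := a s ^ 3 * (curvFun₁ n lam (s * a s) * solG n lam a s - curvFun n lam (s * a s) ^ 2)

/-- The radial coefficient of the curvature tensor. -/
def coefC : ℝ := a s ^ 4 * (2 * curvFun n lam (s * a s) ^ 3
  - 4 * curvFun n lam (s * a s) * curvFun₁ n lam (s * a s) * solG n lam a s
  + curvFun₂ n lam (s * a s) * solG n lam a s ^ 2)

/-- A + Bs is the tensor on one radial and one transversal Euclidean unit direction. Their squared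
lengths in the metric are aG and a, so dividing by a²G leaves the mixed curvature. In
`coefA_add_add` both directions are radial and the divisor is (aG)². -/
theorem coefA_add : coefA n lam a s + coefB n lam a s * s =
    a s ^ 2 * solG n lam a s * mixedCurv n lam (s * a s) := by
  rw [coefA, coefB, solG, mixedCurv]; ring

theorem coefA_add_add :
    2 * coefA n lam a s + 4 * (coefB n lam a s * s) + coefC n lam a s * s ^ 2 =
    a s ^ 2 * solG n lam a s ^ 2 * radialCurv n lam (s * a s) := by
  rw [coefA, coefB, coefC, solG, radialCurv]; ring

theorem add_solD₁ : a s + s * solD₁ n lam a s = a s * solG n lam a s := by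
  rw [solD₁, solG]; ring

end

namespace IsRadialSoliton

variable {n : ℕ} {lam : ℝ} {Φ a : ℝ → ℝ}

theorem hasDerivAt_mul (h : IsRadialSoliton n lam Φ a) {s : ℝ} (hs : 0 ≤ s) :
    HasDerivAt (fun s => s * a s) (a s * solG n lam a s) s := by
  refine ((hasDerivAt_id' s).fun_mul (h.hasDerivAt s hs)).congr_deriv ?_
  rw [solG]; ring

theorem hasDerivAt_solG (h : IsRadialSoliton n lam Φ a) {s : ℝ} (hs : 0 ≤ s) :
    HasDerivAt (solG n lam a) (-(mixedCurv n lam (s * a s) * (a s * solG n lam a s))) s := by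
  have h1 := h.hasDerivAt_mul hs
  refine ((h1.fun_mul ((hasDerivAt_curvFun n lam (s * a s)).comp s h1)).const_sub 1).congr_deriv ?_
  simp only [Function.comp_apply, mixedCurv]; ring

theorem hasDerivAt_solD₁ (h : IsRadialSoliton n lam Φ a) {s : ℝ} (hs : 0 ≤ s) :
    HasDerivAt (solD₁ n lam a) (solD₂ n lam a s) s := by
  have h1 := h.hasDerivAt_mul hs
  have h2 := h.hasDerivAt s hs
  refine ((h2.fun_pow 2).fun_mul
    ((hasDerivAt_curvFun n lam (s * a s)).comp s h1)).fun_neg.congr_deriv ?_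
  simp only [Function.comp_apply, solD₂]; push_cast; ring

theorem hasDerivAt_solD₂ (h : IsRadialSoliton n lam Φ a) {s : ℝ} (hs : 0 ≤ s) :
    HasDerivAt (solD₂ n lam a) (solD₃ n lam a s) s := by
  have h1 := h.hasDerivAt_mul hs
  have h2 := h.hasDerivAt s hs
  refine ((h2.fun_pow 3).fun_mul
    (((((hasDerivAt_curvFun n lam (s * a s)).comp s h1).fun_pow 2).const_mul 2).fun_sub
      (((hasDerivAt_curvFun₁ n lam (s * a s)).comp s h1).fun_mul
        (h.hasDerivAt_solG hs)))).congr_deriv ?_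
  simp only [Function.comp_apply, solD₃, mixedCurv]; push_cast; ring

theorem solG_pos (hn : 1 ≤ n) (hlam : 1 < lam) (s : ℝ) : 0 < solG n lam a s :=
  one_sub_mul_curvFun_pos hn hlam _

theorem b_pos (h : IsRadialSoliton n lam Φ a) (hn : 1 ≤ n) (hlam : 1 < lam) {s : ℝ} (hs : 0 ≤ s) :
    0 < a s * solG n lam a s := mul_pos (h.pos s hs) (solG_pos hn hlam s)

theorem inv_eq (h : IsRadialSoliton n lam Φ a) (hn : 1 ≤ n) (hlam : 1 < lam) (z : Fin n → ℂ)
    (α β : Fin n) : inv (radialMetric n a (solD₁ n lam a)) z α β =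
      ((1 / a (nsq z) : ℝ) : ℂ) * kron α β
        - ((-curvFun n lam (nsq z * a (nsq z)) / solG n lam a (nsq z) : ℝ) : ℂ)
          * (z α * star (z β)) := by
  have h0 := h.pos _ (nsq_nonneg z)
  have hG := solG_pos (a := a) hn hlam (nsq z)
  have hb := add_solD₁ n lam a (nsq z)
  rw [inv_radialMetric h0.ne' (hb ▸ mul_ne_zero h0.ne' hG.ne')]
  have : solD₁ n lam a (nsq z) / (a (nsq z) * (a (nsq z) + nsq z * solD₁ n lam a (nsq z))) =
      -curvFun n lam (nsq z * a (nsq z)) / solG n lam a (nsq z) := by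
    rw [hb, solD₁]
    field_simp
  rw [← this]
  push_cast
  rfl

theorem curv_eq (h : IsRadialSoliton n lam Φ a) (hn : 1 ≤ n) (hlam : 1 < lam) (z : Fin n → ℂ)
    (α β γ η : Fin n) : curv (radialMetric n a (solD₁ n lam a)) z α β γ η =
      radialTensor (coefA n lam a (nsq z) : ℝ) (coefB n lam a (nsq z) : ℝ)
        (coefC n lam a (nsq z) : ℝ) z α β γ η := by
  have h0 := h.pos _ (nsq_nonneg z)
  have hG := solG_pos (a := a) hn hlam (nsq z)
  have hb := add_solD₁ n lam a (nsq z)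
  rw [curv_radialMetric (a₁ := solD₁ n lam a) h.hasDerivAt (fun s hs => h.hasDerivAt_solD₁ hs)
    (fun s hs => h.hasDerivAt_solD₂ hs) h0.ne' (hb ▸ mul_ne_zero h0.ne' hG.ne')]
  have eA : -solD₁ n lam a (nsq z) = coefA n lam a (nsq z) := by rw [solD₁, coefA]; ring
  have eB : -solD₂ n lam a (nsq z) + solD₁ n lam a (nsq z) ^ 2 / a (nsq z)
      = coefB n lam a (nsq z) := by
    rw [solD₁, coefB, solD₂]; field_simp; ring
  have eC : -solD₃ n lam a (nsq z) + (4 * solD₁ n lam a (nsq z) * solD₂ n lam a (nsq z)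
      + nsq z * solD₂ n lam a (nsq z) ^ 2 - 4 * solD₁ n lam a (nsq z) ^ 3 / a (nsq z))
        / (a (nsq z) + nsq z * solD₁ n lam a (nsq z)) = coefC n lam a (nsq z) := by
    -- The only relation among s, a, k and G; once it is recorded, everything else can be treated as
    -- a free variable.
    have hG' : nsq z * a (nsq z) * curvFun n lam (nsq z * a (nsq z)) = 1 - solG n lam a (nsq z) := by
      rw [solG]; ring
    rw [hb, coefC, solD₃, solD₁, solD₂]
    generalize curvFun n lam (nsq z * a (nsq z)) = k at *
    generalize curvFun₁ n lam (nsq z * a (nsq z)) = k₁ at *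
    generalize curvFun₂ n lam (nsq z * a (nsq z)) = k₂ at *
    generalize solG n lam a (nsq z) = G at *
    generalize a (nsq z) = c at *
    field_simp
    linear_combination (4 * k ^ 3 - 4 * k * k₁ * G) * hG'
  rw [← eA, ← eB, ← eC]
  push_cast
  rfl

end IsRadialSoliton

theorem sum_star_mul_dz_radialMetric {n : ℕ} {a a₁ a₂ : ℝ → ℝ} {z : Fin n → ℂ}
    (ha : ∀ s, 0 ≤ s → HasDerivAt a (a₁ s) s) (ha₁ : ∀ s, 0 ≤ s → HasDerivAt a₁ (a₂ s) s)
    (α β : Fin n) :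
    ∑ δ, star (z δ) * dz α (fun w => radialMetric n a a₁ w β δ) z =
      (2 * a₁ (nsq z) + nsq z * a₂ (nsq z)) * (star (z α) * star (z β)) := by
  simp only [(hasWirtinger_radialMetric ha ha₁ _ _ _).2.1]
  have : ∀ δ, star (z δ) * ((a₁ (nsq z) : ℂ) * (star (z α) * kron β δ + star (z β) * kron α δ)
      + a₂ (nsq z) * (star (z α) * star (z β) * z δ)) =
      a₁ (nsq z) * star (z α) * (kron β δ * star (z δ))
        + a₁ (nsq z) * star (z β) * (kron α δ * star (z δ))
        + a₂ (nsq z) * (star (z α) * star (z β)) * (star (z δ) * z δ) := fun δ => by ring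
  simp only [this, Finset.sum_add_distrib, ← Finset.mul_sum, sum_kron_mul', ← ofReal_nsq]
  ring

/-- The Hermitian product `∑ conj z_i v_i`. -/
def hdot {n : ℕ} (z v : Fin n → ℂ) : ℂ := ∑ i, star (z i) * v i

theorem norm_hdot_sq_le {n : ℕ} (z v : Fin n → ℂ) : ‖hdot z v‖ ^ 2 ≤ nsq z * nsq v := by
  have h1 : ‖hdot z v‖ ≤ ∑ i, ‖z i‖ * ‖v i‖ :=
    (norm_sum_le _ _).trans (Finset.sum_le_sum fun i _ => by simp)
  exact (pow_le_pow_left₀ (norm_nonneg _) h1 2).trans (Finset.sum_mul_sq_le_sq_mul_sq _ _ _)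

theorem sum_radialMetric {n : ℕ} {a a₁ : ℝ → ℝ} (z v : Fin n → ℂ) :
    ∑ α, ∑ β, radialMetric n a a₁ z α β * v α * star (v β) =
      ((a (nsq z) * nsq v + a₁ (nsq z) * ‖hdot z v‖ ^ 2 : ℝ) : ℂ) := by
  have e : ∀ α β, radialMetric n a a₁ z α β * v α * star (v β) =
      a (nsq z) * v α * (kron α β * star (v β))
        + a₁ (nsq z) * ((star (z α) * v α) * star (star (z β) * v β)) := fun α β => by
    rw [radialMetric_apply, star_mul', star_star]
    ring
  simp only [e, Finset.sum_add_distrib, ← Finset.mul_sum, sum_kron_mul', ← Finset.sum_mul,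
    ← star_sum]
  rw [← hdot, Complex.star_def, Complex.mul_conj']
  push_cast
  rw [ofReal_nsq v, Finset.mul_sum]
  congr 1
  exact Finset.sum_congr rfl fun α _ => by rw [Complex.star_def]; ring

/-! ### Ricci tensor, soliton equation, scalar curvature and the Kähler property. -/

namespace IsRadialSoliton

variable {n : ℕ} {lam : ℝ} {Φ a : ℝ → ℝ}

/-- The coefficients on the right are those of λ ∂∂̄(sa) minus those of g. The Kronecker coefficient
reduces to `mul_curvFun₁`; the rank one coefficient needs `mul_curvFun₂` as well. -/
theorem ricci_eq (h : IsRadialSoliton n lam Φ a) (hn : 1 ≤ n) (hlam : 1 < lam) (z : Fin n → ℂ)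
    (α β : Fin n) : ricci (radialMetric n a (solD₁ n lam a)) z α β =
      ((lam * (a (nsq z) + nsq z * solD₁ n lam a (nsq z)) - a (nsq z) : ℝ) : ℂ) * kron α β
      + ((lam * (2 * solD₁ n lam a (nsq z) + nsq z * solD₂ n lam a (nsq z))
        - solD₁ n lam a (nsq z) : ℝ) : ℂ) * (star (z α) * z β) := by
  rw [ricci]
  simp only [h.inv_eq hn hlam, h.curv_eq hn hlam]
  rw [ricci_radialTensor]
  have h0 := h.pos _ (nsq_nonneg z)
  have hG := solG_pos (a := a) hn hlam (nsq z)
  have o1 := mul_curvFun₁ n lam (nsq z * a (nsq z))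
  have o2 := mul_curvFun₂ n lam (nsq z * a (nsq z))
  have hG' : solG n lam a (nsq z) = 1 - nsq z * a (nsq z) * curvFun n lam (nsq z * a (nsq z)) := rfl
  rw [solD₁, solD₂, coefA, coefB, coefC]
  generalize curvFun n lam (nsq z * a (nsq z)) = k at *
  generalize curvFun₁ n lam (nsq z * a (nsq z)) = k₁ at *
  generalize curvFun₂ n lam (nsq z * a (nsq z)) = k₂ at *
  generalize solG n lam a (nsq z) = G at *
  generalize a (nsq z) = c at *
  generalize nsq z = S at *
  -- The radial eigenvalue of the inverse metric.
  have hp : 1 / c - (-k / G) * S = 1 / (c * G) := by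
    field_simp
    linear_combination hG'
  have e1 : n * (c ^ 2 * k) * (1 / c) + (c ^ 2 * k + c ^ 3 * (k₁ * G - k ^ 2) * S) *
      (1 / c - (-k / G) * S) = lam * (c + S * -(c ^ 2 * k)) - c := by
    rw [hp]
    field_simp
    linear_combination -k * hG' + G * o1
  have e2 : -(c ^ 2 * k) * (-k / G) + c ^ 3 * (k₁ * G - k ^ 2) * (2 * (1 / c - (-k / G) * S)
      + (n * (1 / c) - (-k / G) * S)) + c ^ 4 * (2 * k ^ 3 - 4 * k * k₁ * G + k₂ * G ^ 2)
        * ((1 / c - (-k / G) * S) * S) =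
      lam * (2 * -(c ^ 2 * k) + S * (c ^ 3 * (2 * k ^ 2 - k₁ * G))) - -(c ^ 2 * k) := by
    rw [hp]
    field_simp
    subst hG'
    linear_combination (1 - S * c * k) ^ 2 * o2 - (1 - S * c * k) * k * o1
  rw [← e1, ← e2]
  push_cast
  ring

theorem contDiff_comp_nsq (h : IsRadialSoliton n lam Φ a) :
    ContDiff ℝ ∞ fun z : Fin n → ℂ => a (nsq z) := by
  refine contDiff_of_hasFDerivAt_comp
    (H := fun p => (-(p.2 ^ 2 * curvFun n lam (nsq p.1 * p.2))) • nsqDeriv p.1) ?_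
    fun z => hasFDerivAt_radial (h.hasDerivAt _ (nsq_nonneg z))
  have h1 : ContDiff ℝ ∞ fun p : (Fin n → ℂ) × ℝ => nsq p.1 := contDiff_nsq.comp contDiff_fst
  exact ((contDiff_snd.pow 2).mul ((contDiff_curvFun n lam).comp (h1.mul contDiff_snd))).neg.smul
    (contDiff_nsqDeriv.comp contDiff_fst)

theorem contDiff_pot_comp_nsq (h : IsRadialSoliton n lam Φ a) :
    ContDiff ℝ ∞ fun z : Fin n → ℂ => Φ (nsq z) := by
  refine contDiff_of_hasFDerivAt_comp (H := fun p => a (nsq p.1) • nsqDeriv p.1) ?_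
    fun z => hasFDerivAt_radial (h.hasDerivAt_pot _ (nsq_nonneg z))
  exact (h.contDiff_comp_nsq.comp contDiff_fst).smul (contDiff_nsqDeriv.comp contDiff_fst)

theorem contDiff_solD₁_comp_nsq (h : IsRadialSoliton n lam Φ a) :
    ContDiff ℝ ∞ fun z : Fin n → ℂ => solD₁ n lam a (nsq z) :=
  ((h.contDiff_comp_nsq.pow 2).mul ((contDiff_curvFun n lam).comp
    (contDiff_nsq.mul h.contDiff_comp_nsq))).neg

theorem isExpandingGradientSoliton (h : IsRadialSoliton n lam Φ a) (hn : 1 ≤ n) (hlam : 1 < lam) :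
    IsExpandingGradientSoliton (radialMetric n a (solD₁ n lam a)) 1 := by
  have ha : ∀ s, 0 ≤ s → HasDerivAt a (solD₁ n lam a s) s := h.hasDerivAt
  have ha₁ : ∀ s, 0 ≤ s → HasDerivAt (solD₁ n lam a) (solD₂ n lam a s) s :=
    fun s hs => h.hasDerivAt_solD₁ hs
  have hf : ∀ s, 0 ≤ s → HasDerivAt (fun s => lam * (s * a s))
      ((fun s => lam * (a s + s * solD₁ n lam a s)) s) s := fun s hs =>
    (((hasDerivAt_id' s).fun_mul (ha s hs)).const_mul lam).congr_deriv (by ring)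
  have hf' : ∀ s, 0 ≤ s → HasDerivAt (fun s => lam * (a s + s * solD₁ n lam a s))
      ((fun s => lam * (2 * solD₁ n lam a s + s * solD₂ n lam a s)) s) s := fun s hs =>
    (((ha s hs).fun_add ((hasDerivAt_id' s).fun_mul (ha₁ s hs))).const_mul lam).congr_deriv
      (by ring)
  -- The soliton potential is λ times the moment coordinate φ = s a.
  refine ⟨one_pos, fun z => lam * (nsq z * a (nsq z)),
    contDiff_const.mul (contDiff_nsq.mul h.contDiff_comp_nsq), fun z α β => ?_⟩
  have hchr : ∑ γ, christoffel (radialMetric n a (solD₁ n lam a)) z γ α β *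
      dz γ (fun w => ((lam * (nsq w * a (nsq w)) : ℝ) : ℂ)) z =
      ((lam * (2 * solD₁ n lam a (nsq z) + nsq z * solD₂ n lam a (nsq z)) : ℝ) : ℂ)
        * (star (z α) * star (z β)) := by
    have hdf : ∀ γ, dz γ (fun w : Fin n → ℂ => ((lam * (nsq w * a (nsq w)) : ℝ) : ℂ)) z =
        ((lam * (a (nsq z) + nsq z * solD₁ n lam a (nsq z)) : ℝ) : ℂ) * star (z γ) := fun γ =>
      (hasWirtinger_radial (α := γ) (hf _ (nsq_nonneg z))).2.1
    have h0 := h.pos _ (nsq_nonneg z)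
    have hG := solG_pos (a := a) hn hlam (nsq z)
    have hs := sum_radial_inv (1 / a (nsq z) : ℝ)
      (-curvFun n lam (nsq z * a (nsq z)) / solG n lam a (nsq z) : ℝ) z
      (fun γ => ((lam * (a (nsq z) + nsq z * solD₁ n lam a (nsq z)) : ℝ) : ℂ) * star (z γ))
      (fun δ => dz α (fun w => radialMetric n a (solD₁ n lam a) w β δ) z)
    simp only [christoffel, hdf, h.inv_eq hn hlam, Finset.sum_mul]
    refine Eq.trans (Finset.sum_congr rfl fun γ _ => Finset.sum_congr rfl fun δ _ => ?_)
      (hs.trans ?_)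
    · ring
    · simp only [mul_assoc, ← Finset.mul_sum, sum_star_mul_dz_radialMetric ha ha₁]
      have e : ∀ γ, z γ * (((lam * (a (nsq z) + nsq z * solD₁ n lam a (nsq z)) : ℝ) : ℂ) * star (z γ))
        = ((lam * (a (nsq z) + nsq z * solD₁ n lam a (nsq z)) : ℝ) : ℂ) * (star (z γ) * z γ) :=
        fun γ => by ring
      simp only [e, ← Finset.mul_sum, ← ofReal_nsq]
      -- The gradient of f is λ times the Euler field. This field is holomorphic, which is why the
      -- (2,0)-Hessian vanishes.
      have e2 : (lam * (a (nsq z) + nsq z * solD₁ n lam a (nsq z))) *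
          (1 / a (nsq z) - -curvFun n lam (nsq z * a (nsq z)) / solG n lam a (nsq z) * nsq z)
          = lam := by
        rw [add_solD₁]
        field_simp
        rw [solG]
        ring_nf
      have e3 := congrArg ((↑) : ℝ → ℂ) e2
      push_cast at e3 ⊢
      linear_combination (2 * (solD₁ n lam a (nsq z) : ℂ) + nsq z * solD₂ n lam a (nsq z)) *
        (star (z α) * star (z β)) * e3
  refine ⟨?_, ?_, ?_⟩
  · rw [h.ricci_eq hn hlam, dz_dzbar_radial hf hf', radialMetric_apply, radialMetric_apply]
    push_cast
    ring
  · rw [hchr, dz_dz_radial hf hf']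
    exact sub_self _
  · rw [dzbar_dzbar_radial hf hf']
    have hdf : ∀ γ, dzbar γ (fun w : Fin n → ℂ => ((lam * (nsq w * a (nsq w)) : ℝ) : ℂ)) z =
        star (dz γ (fun w : Fin n → ℂ => ((lam * (nsq w * a (nsq w)) : ℝ) : ℂ)) z) := fun γ => by
      rw [(hasWirtinger_radial (α := γ) (hf _ (nsq_nonneg z))).2.1,
        (hasWirtinger_radial (α := γ) (hf _ (nsq_nonneg z))).2.2]
      simp
    simp only [hdf, ← star_mul']
    rw [← star_sum, hchr]
    simp

/-- Trace in a unit frame: the n-1 transversal directions contribute (n-1)² + (n-1) = n(n-1) copies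
of k, the mixed pairs 2(n-1) copies of the mixed curvature, the radial direction one term. -/
theorem scalarCurv_eq (h : IsRadialSoliton n lam Φ a) (hn : 1 ≤ n) (hlam : 1 < lam)
    (z : Fin n → ℂ) : scalarCurv (radialMetric n a (solD₁ n lam a)) z =
      ((n * (n - 1) * curvFun n lam (nsq z * a (nsq z))
        + 2 * (n - 1) * mixedCurv n lam (nsq z * a (nsq z))
        + radialCurv n lam (nsq z * a (nsq z)) : ℝ) : ℂ) := by
  rw [scalarCurv]
  simp only [h.inv_eq hn hlam, h.ricci_eq hn hlam]
  rw [scalar_radial]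
  have h0 := h.pos _ (nsq_nonneg z)
  have hG := solG_pos (a := a) hn hlam (nsq z)
  have o1 := mul_curvFun₁ n lam (nsq z * a (nsq z))
  have o2 := mul_curvFun₂ n lam (nsq z * a (nsq z))
  have hG' : solG n lam a (nsq z) = 1 - nsq z * a (nsq z) * curvFun n lam (nsq z * a (nsq z)) := rfl
  rw [mixedCurv, radialCurv, solD₁, solD₂]
  generalize curvFun n lam (nsq z * a (nsq z)) = k at *
  generalize curvFun₁ n lam (nsq z * a (nsq z)) = k₁ at *
  generalize curvFun₂ n lam (nsq z * a (nsq z)) = k₂ at *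
  generalize solG n lam a (nsq z) = G at *
  generalize a (nsq z) = c at *
  generalize nsq z = S at *
  have hp : 1 / c - (-k / G) * S = 1 / (c * G) := by
    field_simp
    linear_combination hG'
  have hX : lam * (c + S * -(c ^ 2 * k)) - c = c * (lam * G - 1) := by rw [hG']; ring
  have hXY : lam * (c + S * -(c ^ 2 * k)) - c +
      (lam * (2 * -(c ^ 2 * k) + S * (c ^ 3 * (2 * k ^ 2 - k₁ * G))) - -(c ^ 2 * k)) * S
      = c * G * (lam - 1 - lam * (S * c) * (2 * k + S * c * k₁)) := by rw [hG']; ring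
  have e : n * (1 / c * (lam * (c + S * -(c ^ 2 * k)) - c)) + (1 / c *
      (lam * (2 * -(c ^ 2 * k) + S * (c ^ 3 * (2 * k ^ 2 - k₁ * G))) - -(c ^ 2 * k))
      - (-k / G) * (lam * (c + S * -(c ^ 2 * k)) - c +
      (lam * (2 * -(c ^ 2 * k) + S * (c ^ 3 * (2 * k ^ 2 - k₁ * G))) - -(c ^ 2 * k)) * S)) * S
      = n * (n - 1) * k + 2 * (n - 1) * (k + S * c * k₁)
        + (2 * k + 4 * (S * c) * k₁ + (S * c) ^ 2 * k₂) := by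
    -- Separates the transversal Ricci eigenvalue, of multiplicity n-1, from the radial one.
    trans (n - 1) * (1 / c * (lam * (c + S * -(c ^ 2 * k)) - c)) + (1 / c - (-k / G) * S) *
      (lam * (c + S * -(c ^ 2 * k)) - c +
      (lam * (2 * -(c ^ 2 * k) + S * (c ^ 3 * (2 * k ^ 2 - k₁ * G))) - -(c ^ 2 * k)) * S)
    · ring
    · rw [hp, hXY, hX]
      field_simp
      rw [hG']
      linear_combination (-n : ℝ) * o1 - S * c * o2
  rw [← e]
  push_cast
  ring

/-- Since a' ≤ 0, Cauchy–Schwarz makes the radial eigenvalue aG the smallest one. -/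
theorem quad_lower (h : IsRadialSoliton n lam Φ a) (hlam : 1 < lam)
    (z v : Fin n → ℂ) : a (nsq z) * solG n lam a (nsq z) * nsq v ≤
      a (nsq z) * nsq v + solD₁ n lam a (nsq z) * ‖hdot z v‖ ^ 2 := by
  have h1 := norm_hdot_sq_le z v
  have h2 : solD₁ n lam a (nsq z) ≤ 0 := by
    have := mul_pos (pow_pos (h.pos _ (nsq_nonneg z)) 2)
      (curvFun_pos n hlam (nsq z * a (nsq z)))
    rw [solD₁]
    linarith
  rw [← add_solD₁]
  nlinarith

theorem isKahler (h : IsRadialSoliton n lam Φ a) (hn : 1 ≤ n) (hlam : 1 < lam) :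
    IsKahler (radialMetric n a (solD₁ n lam a)) where
  smooth α β := by
    have h1 : ContDiff ℝ ∞ fun z : Fin n → ℂ => z β := contDiff_apply ℝ ℂ β
    have h2 : ContDiff ℝ ∞ fun z : Fin n → ℂ => star (z α) :=
      (Complex.conjCLE : ℂ →L[ℝ] ℂ).contDiff.comp (contDiff_apply ℝ ℂ α)
    exact ((Complex.ofRealCLM.contDiff.comp h.contDiff_comp_nsq).mul contDiff_const).add
      ((Complex.ofRealCLM.contDiff.comp h.contDiff_solD₁_comp_nsq).mul (h2.mul h1))
  posDef z := by
    refine Matrix.PosDef.of_dotProduct_mulVec_pos ?_ fun x hx => ?_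
    · ext α β
      simp only [Matrix.conjTranspose_apply, radialMetric_apply, star_add, star_mul',
        star_kron, Complex.star_def, Complex.conj_ofReal, Complex.conj_conj]
      rw [kron_comm, mul_comm (z β)]
    · have e : star x ⬝ᵥ (radialMetric n a (solD₁ n lam a) z).mulVec x =
          ∑ α, ∑ β, radialMetric n a (solD₁ n lam a) z α β * star (x α) * star (star (x β)) := by
        simp only [dotProduct, Matrix.mulVec, Finset.mul_sum, star_star, Pi.star_apply]
        exact Finset.sum_congr rfl fun α _ => Finset.sum_congr rfl fun β _ => by ring
      rw [e, sum_radialMetric z fun i => star (x i)]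
      have hx' : (fun i => star (x i)) ≠ 0 := fun h0 => hx <| funext fun i => by
        simpa using congrFun h0 i
      exact_mod_cast (mul_pos (h.b_pos hn hlam (nsq_nonneg z)) (nsq_pos hx')).trans_le
        (h.quad_lower hlam z fun i => star (x i))
  closed α β γ z := by
    have ha : ∀ s, 0 ≤ s → HasDerivAt a (solD₁ n lam a s) s := h.hasDerivAt
    have ha₁ : ∀ s, 0 ≤ s → HasDerivAt (solD₁ n lam a) (solD₂ n lam a s) s :=
      fun s hs => h.hasDerivAt_solD₁ hs
    rw [(hasWirtinger_radialMetric ha ha₁ _ _ _).2.1, (hasWirtinger_radialMetric ha ha₁ _ _ _).2.1]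
    ring

end IsRadialSoliton

/-! ### Positivity of the curvature operator -/

section

variable {n : ℕ}

theorem star_hdot (z v : Fin n → ℂ) : star (hdot z v) = hdot v z := by
  simp only [hdot, star_sum, star_mul', star_star]
  exact Finset.sum_congr rfl fun i _ => mul_comm _ _

theorem star_mul_self_eq (c : ℂ) : star c * c = ((‖c‖ ^ 2 : ℝ) : ℂ) := by
  rw [Complex.star_def, Complex.conj_mul']
  push_cast
  rfl

/-- Pythagoras for the orthogonal projection along `y`. -/
theorem nsq_sub_proj {y : Fin n → ℂ} (hy : nsq y ≠ 0) (v : Fin n → ℂ) :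
    nsq (fun i => v i - hdot y v / nsq y * y i) = nsq v - ‖hdot y v‖ ^ 2 / nsq y := by
  have hy' : (nsq y : ℂ) ≠ 0 := by exact_mod_cast hy
  have e : ∀ i, star (v i - hdot y v / nsq y * y i) * (v i - hdot y v / nsq y * y i) =
      star (v i) * v i - hdot y v / nsq y * (star (v i) * y i)
        - star (hdot y v) / nsq y * (star (y i) * v i)
        + star (hdot y v) * hdot y v / (nsq y) ^ 2 * (star (y i) * y i) := fun i => by
    simp only [star_sub, star_mul', star_div₀]
    rw [show star (nsq y : ℂ) = nsq y from Complex.conj_ofReal _]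
    ring
  have h : ((nsq (fun i => v i - hdot y v / nsq y * y i) : ℝ) : ℂ) =
      ((nsq v - ‖hdot y v‖ ^ 2 / nsq y : ℝ) : ℂ) := by
    rw [ofReal_nsq]
    simp only [e, Finset.sum_add_distrib, Finset.sum_sub_distrib, ← Finset.mul_sum, ← ofReal_nsq]
    rw [← hdot, ← hdot, ← star_hdot y v]
    rw [Complex.ofReal_sub, Complex.ofReal_div, ← star_mul_self_eq]
    field_simp
    ring
  exact_mod_cast h

theorem radialPart_eq_hdot (z : Fin n → ℂ) (ξ : Fin n → Fin n → ℂ) :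
    radialPart z ξ = hdot z fun α => ∑ β, z β * ξ α β := by
  simp only [radialPart, hdot, Finset.mul_sum, mul_assoc]

theorem radialPart_eq_hdot' (z : Fin n → ℂ) (ξ : Fin n → Fin n → ℂ) :
    radialPart z ξ = hdot (fun β => star (z β)) fun β => ∑ α, star (z α) * ξ α β := by
  simp only [radialPart, hdot, Finset.mul_sum, star_star]
  rw [Finset.sum_comm]
  exact Finset.sum_congr rfl fun i _ => Finset.sum_congr rfl fun j _ => by ring

theorem nsq_star (z : Fin n → ℂ) : nsq (fun i => star (z i)) = nsq z := by simp [nsq]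

/-- The quadratic form of the model tensor. -/
theorem quad_radialTensor (A B C : ℝ) (z : Fin n → ℂ) (ξ : Fin n → Fin n → ℂ) :
    ∑ α, ∑ β, ∑ γ, ∑ η, radialTensor A B C z α β γ η * ξ α β * star (ξ η γ) =
      ((A * (‖∑ α, ξ α α‖ ^ 2 + ∑ α, nsq (ξ α))
        + B * (2 * ((∑ α, ξ α α) * star (radialPart z ξ)).re
          + nsq (fun α => ∑ β, z β * ξ α β) + nsq (fun β => ∑ α, star (z α) * ξ α β))
        + C * ‖radialPart z ξ‖ ^ 2 : ℝ) : ℂ) := by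
  rw [sum_radialTensor A B C z ξ fun γ η => star (ξ η γ)]
  have h1 : radialPart z (fun γ η => star (ξ η γ)) = star (radialPart z ξ) := by
    simp only [radialPart, star_sum, star_mul', star_star]
    rw [Finset.sum_comm]
    exact Finset.sum_congr rfl fun i _ => Finset.sum_congr rfl fun j _ => by ring
  have h2 : ∑ γ, star (ξ γ γ) = star (∑ γ, ξ γ γ) := by rw [star_sum]
  have h3 : ∑ α, ∑ β, ξ α β * star (ξ α β) = ((∑ α, nsq (ξ α) : ℝ) : ℂ) := by
    push_cast
    refine Finset.sum_congr rfl fun α _ => ?_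
    rw [ofReal_nsq]
    exact Finset.sum_congr rfl fun j _ => mul_comm _ _
  have h4 : ∑ α, (∑ β, z β * ξ α β) * (∑ γ, star (z γ) * star (ξ α γ)) =
      (nsq (fun α => ∑ β, z β * ξ α β) : ℂ) := by
    rw [ofReal_nsq]
    refine Finset.sum_congr rfl fun α _ => ?_
    rw [star_sum, mul_comm]
    simp only [star_mul']
  have h5 : ∑ β, (∑ α, star (z α) * ξ α β) * (∑ η, z η * star (ξ η β)) =
      (nsq (fun β => ∑ α, star (z α) * ξ α β) : ℂ) := by
    rw [ofReal_nsq]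
    refine Finset.sum_congr rfl fun α _ => ?_
    rw [star_sum, mul_comm]
    simp only [star_mul', star_star]
  have h6 : (∑ α, ξ α α) * star (radialPart z ξ) + radialPart z ξ * star (∑ α, ξ α α) =
      ((2 * ((∑ α, ξ α α) * star (radialPart z ξ)).re : ℝ) : ℂ) := by
    have := Complex.add_conj ((∑ α, ξ α α) * star (radialPart z ξ))
    rw [map_mul, ← Complex.star_def, star_star, mul_comm (star _) (radialPart z ξ)] at this
    exact this
  have h7 := star_mul_self_eq (∑ γ, ξ γ γ)
  have h8 := star_mul_self_eq (radialPart z ξ)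
  rw [h1, h2, h3, h4, h5]
  push_cast at h6 h7 h8 ⊢
  linear_combination (B : ℂ) * h6 + (A : ℂ) * h7 + (C : ℂ) * h8

/-- T is the norm of the transversal trace, X that of the radial entry, H the squared norm of the
transversal block. As H ≥ T²/(n-1), the form dominates nAT²/(n-1) - 2|E|TX + DX², whose discriminant
condition is `hDA`. If n = 1 or H = 0 then T = 0, and these cases are treated apart. -/
theorem quadratic_pos {n A D E H T X : ℝ} {r : ℝ} (hn : 1 ≤ n) (hA : 0 < A) (hD : 0 < D)
    (hDA : (n - 1) * E ^ 2 < n * (D * A)) (hH : 0 ≤ H) (hT : T ^ 2 ≤ (n - 1) * H)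
    (hr : |r| ≤ T * X) (hpos : 0 < H + X ^ 2) :
    0 < A * H + A * T ^ 2 + 2 * E * r + D * X ^ 2 := by
  have h1 : -(|E| * (T * X)) ≤ E * r := by
    have : |E * r| ≤ |E| * (T * X) := by rw [abs_mul]; gcongr
    linarith [neg_abs_le (E * r)]
  have hE : |E| ^ 2 = E ^ 2 := sq_abs E
  -- Completing the square after multiplication by D.
  suffices h : 0 < (D * X - |E| * T) ^ 2 + (D * A * (H + T ^ 2) - E ^ 2 * T ^ 2) by
    have : 0 < D * (A * H + A * T ^ 2 + 2 * E * r + D * X ^ 2) := by nlinarith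
    exact pos_of_mul_pos_right this hD.le
  have hDA' : 0 < D * A := mul_pos hD hA
  rcases hH.eq_or_lt with rfl | hH
  · have hT0 : T = 0 := by nlinarith [sq_nonneg T]
    subst hT0
    have : 0 < D ^ 2 * X ^ 2 := by
      have : 0 < X ^ 2 := by linarith
      positivity
    nlinarith
  · suffices 0 < D * A * (H + T ^ 2) - E ^ 2 * T ^ 2 by positivity
    rcases hn.eq_or_lt with rfl | hn
    · have hT0 : T = 0 := by nlinarith [sq_nonneg T]
      subst hT0
      have := mul_pos hDA' hH
      linarith
    · have hn' : 0 < n - 1 := by linarith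
      by_cases hT0 : T = 0
      · subst hT0
        have := mul_pos hDA' hH
        linarith
      · have hT2 : 0 < T ^ 2 := by positivity
        have h3 : 0 < (n - 1) * (D * A * (H + T ^ 2) - E ^ 2 * T ^ 2) := by
          nlinarith [mul_le_mul_of_nonneg_left hT hDA'.le, mul_lt_mul_of_pos_right hDA hT2]
        exact pos_of_mul_pos_right h3 hn'.le

/-- The trace of a matrix annihilated by `z` on both sides. -/
theorem norm_trace_sq_le {z : Fin n → ℂ} (hz : nsq z ≠ 0) (η : Fin n → Fin n → ℂ)
    (h : radialPart z η = 0) : ‖∑ α, η α α‖ ^ 2 ≤ (n - 1) * ∑ α, nsq (η α) := by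
  have hz' : (nsq z : ℂ) ≠ 0 := by exact_mod_cast hz
  -- Because the radial part of η vanishes, the trace is the pairing with the projector transversal
  -- to z. Its squared Hilbert–Schmidt norm is n-1, so Cauchy–Schwarz gives n-1 in place of n.
  have e1 : ∑ α, η α α = ∑ p : Fin n × Fin n,
      (kron p.1 p.2 - star (z p.1) * z p.2 / nsq z) * η p.1 p.2 := by
    rw [Fintype.sum_prod_type]
    have : ∀ α β, (kron α β - star (z α) * z β / nsq z) * η α β =
      kron α β * η α β - 1 / (nsq z : ℂ) * (star (z α) * z β * η α β) := fun α β => by ring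
    simp only [this, Finset.sum_sub_distrib, sum_kron_mul', ← Finset.mul_sum]
    rw [← radialPart, h]
    simp
  have e2 : ∑ p : Fin n × Fin n, ‖kron p.1 p.2 - star (z p.1) * z p.2 / nsq z‖ ^ 2 = n - 1 := by
    have hc : ((∑ p : Fin n × Fin n, ‖kron p.1 p.2 - star (z p.1) * z p.2 / nsq z‖ ^ 2 : ℝ) : ℂ)
        = ((n - 1 : ℝ) : ℂ) := by
      rw [Complex.ofReal_sum, Fintype.sum_prod_type]
      have : ∀ α β, ((‖kron α β - star (z α) * z β / nsq z‖ ^ 2 : ℝ) : ℂ) =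
          kron α β * kron α β - 1 / (nsq z : ℂ) * (z α * (kron α β * star (z β)))
          - 1 / (nsq z : ℂ) * (star (z α) * (kron α β * z β))
          + 1 / (nsq z : ℂ) ^ 2 * ((star (z α) * z α) * (star (z β) * z β)) := fun α β => by
        rw [← star_mul_self_eq]
        simp only [star_sub, star_div₀, star_mul', star_kron, star_star]
        rw [show star (nsq z : ℂ) = nsq z from Complex.conj_ofReal _]
        ring
      simp only [this, Finset.sum_add_distrib, Finset.sum_sub_distrib, sum_kron_mul',
        ← Finset.mul_sum, sum_kron_self, ← ofReal_nsq, ← Finset.sum_mul]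
      rw [show ∑ i, z i * star (z i) = (nsq z : ℂ) by
        rw [ofReal_nsq]; exact Finset.sum_congr rfl fun i _ => mul_comm _ _]
      push_cast
      field_simp
      ring
    exact_mod_cast hc
  have e3 : ∑ α, nsq (η α) = ∑ p : Fin n × Fin n, ‖η p.1 p.2‖ ^ 2 := by
    rw [Fintype.sum_prod_type]; rfl
  rw [e1, e3, ← e2]
  refine (pow_le_pow_left₀ (norm_nonneg _) (norm_sum_le _ _) 2).trans ?_
  simp only [norm_mul]
  exact Finset.sum_mul_sq_le_sq_mul_sq _ _ _

/-- The block of `ξ` transversal to `z`. -/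
def transBlock (z : Fin n → ℂ) (ξ : Fin n → Fin n → ℂ) (α β : Fin n) : ℂ :=
  ξ α β - (∑ γ, z γ * ξ α γ) / nsq z * star (z β)
    - ((∑ γ, star (z γ) * ξ γ β) - radialPart z ξ / nsq z * star (z β)) / nsq z * z α

theorem hdot_row_reduced {z : Fin n → ℂ} (ξ : Fin n → Fin n → ℂ) (β : Fin n) :
    hdot z (fun α => ξ α β - (∑ γ, z γ * ξ α γ) / nsq z * star (z β)) =
      (∑ γ, star (z γ) * ξ γ β) - radialPart z ξ / nsq z * star (z β) := by
  have : ∀ α, star (z α) * (ξ α β - (∑ γ, z γ * ξ α γ) / nsq z * star (z β)) =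
      star (z α) * ξ α β - 1 / nsq z * star (z β) * (star (z α) * ∑ γ, z γ * ξ α γ) :=
    fun α => by ring
  simp only [hdot, this, Finset.sum_sub_distrib, ← Finset.mul_sum]
  rw [radialPart_eq_hdot]
  simp only [hdot]
  ring

theorem nsq_row_sub {z : Fin n → ℂ} (hz : nsq z ≠ 0) (ξ : Fin n → Fin n → ℂ) :
    nsq (fun α => ∑ β, z β * ξ α β) - ‖radialPart z ξ‖ ^ 2 / nsq z =
      nsq (fun α => (∑ β, z β * ξ α β) - radialPart z ξ / nsq z * z α) := by
  rw [radialPart_eq_hdot, nsq_sub_proj hz]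

theorem nsq_col_sub {z : Fin n → ℂ} (hz : nsq z ≠ 0) (ξ : Fin n → Fin n → ℂ) :
    nsq (fun β => ∑ α, star (z α) * ξ α β) - ‖radialPart z ξ‖ ^ 2 / nsq z =
      nsq (fun β => (∑ α, star (z α) * ξ α β) - radialPart z ξ / nsq z * star (z β)) := by
  have := nsq_sub_proj (y := fun β => star (z β)) (by rwa [nsq_star])
    (fun β => ∑ α, star (z α) * ξ α β)
  rw [← radialPart_eq_hdot', nsq_star] at this
  exact this.symm

/-- Pythagoras twice: the projection is removed from each row, then from each column of the reduced
matrix. -/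
theorem sum_nsq_transBlock {z : Fin n → ℂ} (hz : nsq z ≠ 0) (ξ : Fin n → Fin n → ℂ) :
    ∑ α, nsq (transBlock z ξ α) = ∑ α, nsq (ξ α) - nsq (fun α => ∑ β, z β * ξ α β) / nsq z
      - (nsq (fun β => ∑ α, star (z α) * ξ α β) - ‖radialPart z ξ‖ ^ 2 / nsq z) / nsq z := by
  have hcol : ∀ ζ : Fin n → Fin n → ℂ, ∑ α, nsq (ζ α) = ∑ β, nsq (fun α => ζ α β) :=
    fun ζ => Finset.sum_comm
  have h1 : ∀ α, nsq (fun β => ξ α β - (∑ γ, z γ * ξ α γ) / nsq z * star (z β)) =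
      nsq (ξ α) - ‖∑ γ, z γ * ξ α γ‖ ^ 2 / nsq z := fun α => by
    have := nsq_sub_proj (y := fun β => star (z β)) (by rwa [nsq_star]) (ξ α)
    rw [nsq_star, show hdot (fun β => star (z β)) (ξ α) = ∑ γ, z γ * ξ α γ by
      simp only [hdot, star_star]] at this
    exact this
  have h2 : ∀ β, nsq (fun α => transBlock z ξ α β) =
      nsq (fun α => ξ α β - (∑ γ, z γ * ξ α γ) / nsq z * star (z β))
        - ‖(∑ γ, star (z γ) * ξ γ β) - radialPart z ξ / nsq z * star (z β)‖ ^ 2 / nsq z :=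
    fun β => by
      have := nsq_sub_proj hz (fun α => ξ α β - (∑ γ, z γ * ξ α γ) / nsq z * star (z β))
      rw [hdot_row_reduced] at this
      exact this
  rw [nsq_col_sub hz, hcol]
  simp only [h2, Finset.sum_sub_distrib, ← Finset.sum_div]
  rw [← hcol fun α β => ξ α β - (∑ γ, z γ * ξ α γ) / nsq z * star (z β)]
  simp only [h1, Finset.sum_sub_distrib, ← Finset.sum_div]
  rfl

theorem trace_transBlock {z : Fin n → ℂ} (hz : nsq z ≠ 0) (ξ : Fin n → Fin n → ℂ) :
    ∑ α, transBlock z ξ α α = (∑ α, ξ α α) - radialPart z ξ / nsq z := by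
  have hz' : (nsq z : ℂ) ≠ 0 := by exact_mod_cast hz
  have h1 : ∀ α, transBlock z ξ α α = ξ α α - 1 / nsq z * (star (z α) * ∑ γ, z γ * ξ α γ)
      - 1 / nsq z * (star (star (z α)) * ∑ γ, star (z γ) * ξ γ α)
      + radialPart z ξ / nsq z ^ 2 * (star (z α) * z α) := fun α => by
    rw [transBlock, star_star]; ring
  simp only [h1, Finset.sum_sub_distrib, Finset.sum_add_distrib, ← Finset.mul_sum]
  rw [← ofReal_nsq, ← hdot, ← radialPart_eq_hdot]
  rw [show ∑ α, star (star (z α)) * ∑ γ, star (z γ) * ξ γ α = radialPart z ξ by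
    rw [radialPart_eq_hdot', hdot]]
  field_simp
  ring

theorem radialPart_transBlock {z : Fin n → ℂ} (hz : nsq z ≠ 0) (ξ : Fin n → Fin n → ℂ) :
    radialPart z (transBlock z ξ) = 0 := by
  have hz' : (nsq z : ℂ) ≠ 0 := by exact_mod_cast hz
  rw [radialPart, Finset.sum_comm]
  refine Finset.sum_eq_zero fun β _ => ?_
  have h1 : ∀ α, star (z α) * z β * transBlock z ξ α β =
      z β * (star (z α) * (ξ α β - (∑ γ, z γ * ξ α γ) / nsq z * star (z β)))
      - z β * ((∑ γ, star (z γ) * ξ γ β) - radialPart z ξ / nsq z * star (z β)) / nsq z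
        * (star (z α) * z α) := fun α => by rw [transBlock]; ring
  simp only [h1, Finset.sum_sub_distrib, ← Finset.mul_sum]
  rw [← hdot, hdot_row_reduced, ← ofReal_nsq]
  field_simp
  ring

/-- The quadratic form is block diagonal: the coupled pair (transversal block, radial entry) is
covered by `quadratic_pos`, and the mixed row and column enter as A + BS times their squared norms.
If the coupled pair vanishes, the mixed part does not. -/
theorem quadratic_pos_of_blocks {n A B C S H P M : ℝ} {τ x : ℂ} (hn : 1 ≤ n) (hA : 0 < A)
    (hS : 0 < S) (hE : 0 < A + B * S) (hD : 0 < 2 * A + 4 * (B * S) + C * S ^ 2)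
    (hDA : (n - 1) * (A + B * S) ^ 2 < n * ((2 * A + 4 * (B * S) + C * S ^ 2) * A))
    (hH : 0 ≤ H) (hP : 0 ≤ P) (hM : 0 ≤ M) (hT : ‖τ‖ ^ 2 ≤ (n - 1) * H)
    (hpos : 0 < H + P / S + M / S + ‖x‖ ^ 2) :
    0 < A * (‖τ‖ ^ 2 + 2 * (τ * star x).re + ‖x‖ ^ 2 + (H + P / S + M / S + ‖x‖ ^ 2)) +
      B * (2 * (S * ((τ * star x).re + ‖x‖ ^ 2)) + (P + ‖x‖ ^ 2 * S) + (M + ‖x‖ ^ 2 * S))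
      + C * (‖x‖ ^ 2 * S ^ 2) := by
  have hr : |(τ * star x).re| ≤ ‖τ‖ * ‖x‖ := by
    refine (Complex.abs_re_le_norm _).trans ?_
    rw [norm_mul, norm_star]
  have hid : A * (‖τ‖ ^ 2 + 2 * (τ * star x).re + ‖x‖ ^ 2 + (H + P / S + M / S + ‖x‖ ^ 2)) +
      B * (2 * (S * ((τ * star x).re + ‖x‖ ^ 2)) + (P + ‖x‖ ^ 2 * S) + (M + ‖x‖ ^ 2 * S))
      + C * (‖x‖ ^ 2 * S ^ 2) =
      (A * H + A * ‖τ‖ ^ 2 + 2 * (A + B * S) * (τ * star x).re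
        + (2 * A + 4 * (B * S) + C * S ^ 2) * ‖x‖ ^ 2) + (A + B * S) * (P / S + M / S) := by
    field_simp
    ring
  rw [hid]
  have hPM : 0 ≤ P / S + M / S := by positivity
  by_cases h1 : 0 < H + ‖x‖ ^ 2
  · have := quadratic_pos hn hA hD hDA hH hT hr h1
    have := mul_nonneg hE.le hPM
    linarith
  · have hx2 : 0 ≤ ‖x‖ ^ 2 := by positivity
    have h2 := mul_pos hE (show 0 < P / S + M / S by linarith)
    have hH' : H = 0 := by linarith
    have hx' : ‖x‖ = 0 := by
      have : ‖x‖ ^ 2 = 0 := by linarith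
      exact pow_eq_zero_iff two_ne_zero |>.1 this
    have hτ' : ‖τ‖ ^ 2 = 0 := le_antisymm (by rw [hH', mul_zero] at hT; exact hT) (by positivity)
    have hr' : (τ * star x).re = 0 := by
      rw [hx', mul_zero] at hr
      exact abs_nonpos_iff.1 hr
    rw [hH', hx', hτ', hr']
    linarith

theorem radialTensor_pos (hn : 1 ≤ n) {A B C : ℝ} {z : Fin n → ℂ} (hA : 0 < A)
    (hE : 0 < A + B * nsq z) (hD : 0 < 2 * A + 4 * (B * nsq z) + C * nsq z ^ 2)
    (hDA : (n - 1) * (A + B * nsq z) ^ 2 <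
      n * ((2 * A + 4 * (B * nsq z) + C * nsq z ^ 2) * A))
    {ξ : Fin n → Fin n → ℂ} (hξ : ξ ≠ 0) :
    0 < ∑ α, ∑ β, ∑ γ, ∑ η, radialTensor A B C z α β γ η * ξ α β * star (ξ η γ) := by
  rw [quad_radialTensor]
  refine Complex.zero_lt_real.2 ?_
  have hhs : 0 < ∑ α, nsq (ξ α) := by
    obtain ⟨α, hα⟩ := Function.ne_iff.1 hξ
    exact Finset.sum_pos' (fun _ _ => nsq_nonneg _) ⟨α, Finset.mem_univ _, nsq_pos hα⟩
  by_cases hz : z = 0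
  · have e1 : radialPart z ξ = 0 := by simp [radialPart, hz]
    have e2 : nsq (fun α => ∑ β, z β * ξ α β) = 0 := by simp [nsq, hz]
    have e3 : nsq (fun β => ∑ α, star (z α) * ξ α β) = 0 := by simp [nsq, hz]
    have e4 : 0 ≤ ‖∑ α, ξ α α‖ ^ 2 := by positivity
    rw [e1, e2, e3]
    have := mul_pos hA (show 0 < ‖∑ α, ξ α α‖ ^ 2 + ∑ α, nsq (ξ α) by linarith)
    simpa using this
  have hS := nsq_pos hz
  have hS' : (nsq z : ℂ) ≠ 0 := by exact_mod_cast hS.ne'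
  have hT := norm_trace_sq_le hS.ne' _ (radialPart_transBlock hS.ne' ξ)
  rw [trace_transBlock hS.ne'] at hT
  have hH0 : 0 ≤ ∑ α, nsq (transBlock z ξ α) := Finset.sum_nonneg fun _ _ => nsq_nonneg _
  have hsum := sum_nsq_transBlock hS.ne' ξ
  have hP0 : 0 ≤ nsq (fun α => ∑ β, z β * ξ α β) - ‖radialPart z ξ‖ ^ 2 / nsq z := by
    rw [nsq_row_sub hS.ne']; exact nsq_nonneg _
  have hM0 : 0 ≤ nsq (fun β => ∑ α, star (z α) * ξ α β) - ‖radialPart z ξ‖ ^ 2 / nsq z := by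
    rw [nsq_col_sub hS.ne']; exact nsq_nonneg _
  generalize ∑ α, nsq (transBlock z ξ α) = H at *
  generalize nsq (fun α => ∑ β, z β * ξ α β) = p at *
  generalize nsq (fun β => ∑ α, star (z α) * ξ α β) = m at *
  generalize radialPart z ξ = w at *
  generalize ∑ α, nsq (ξ α) = N at *
  generalize ∑ α, ξ α α = t at *
  generalize nsq z = S at *
  -- x is the entry of ξ in the unit radial direction; below, τ is the trace of the transversal
  -- block, and P, M are the mixed parts of row and column.
  obtain ⟨x, rfl⟩ : ∃ x, w = x * S := ⟨w / S, by field_simp⟩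
  obtain ⟨τ, rfl⟩ : ∃ τ, t = τ + x := ⟨t - x, by ring⟩
  rw [mul_div_cancel_right₀ _ hS', add_sub_cancel_right] at hT
  have hnw : ‖x * S‖ ^ 2 = ‖x‖ ^ 2 * S ^ 2 := by
    rw [norm_mul, mul_pow, Complex.norm_real, Real.norm_eq_abs, sq_abs]
  have hdiv : ‖x‖ ^ 2 * S ^ 2 / S = ‖x‖ ^ 2 * S := by field_simp
  rw [hnw]
  rw [hnw, hdiv] at hP0 hM0 hsum
  obtain ⟨P, rfl⟩ : ∃ P, p = P + ‖x‖ ^ 2 * S := ⟨p - ‖x‖ ^ 2 * S, by ring⟩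
  obtain ⟨M, rfl⟩ : ∃ M, m = M + ‖x‖ ^ 2 * S := ⟨m - ‖x‖ ^ 2 * S, by ring⟩
  rw [add_sub_cancel_right] at hP0 hM0
  have hN : N = H + P / S + M / S + ‖x‖ ^ 2 := by
    rw [hsum]
    field_simp
    ring
  have hnt : ‖τ + x‖ ^ 2 = ‖τ‖ ^ 2 + 2 * (τ * star x).re + ‖x‖ ^ 2 := by
    rw [← Complex.normSq_eq_norm_sq, ← Complex.normSq_eq_norm_sq, ← Complex.normSq_eq_norm_sq,
      Complex.normSq_add, Complex.star_def]
    ring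
  have htw : ((τ + x) * star (x * S)).re = S * ((τ * star x).re + ‖x‖ ^ 2) := by
    rw [← Complex.normSq_eq_norm_sq, Complex.normSq_apply]
    simp
    ring
  rw [hnt, htw, hN]
  exact quadratic_pos_of_blocks (by exact_mod_cast hn) hA hS hE hD hDA hH0 hP0 hM0 hT (hN ▸ hhs)

end

namespace IsRadialSoliton

variable {n : ℕ} {lam : ℝ} {Φ a : ℝ → ℝ}

theorem hasPositiveCurvatureOperatorOn11 (h : IsRadialSoliton n lam Φ a) (hn : 1 ≤ n)
    (hlam : 1 < lam) : HasPositiveCurvatureOperatorOn11 (radialMetric n a (solD₁ n lam a)) := by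
  intro z ξ hξ
  rw [curvForm]
  simp only [h.curv_eq hn hlam]
  have h0 := h.pos _ (nsq_nonneg z)
  have hG := solG_pos (a := a) hn hlam (nsq z)
  set y := nsq z * a (nsq z) with hy
  have hk := curvFun_pos n hlam y
  have hm := mixedCurv_pos hn hlam y
  have hr := radialCurv_pos hn hlam y
  have hA : 0 < coefA n lam a (nsq z) := mul_pos (pow_pos h0 2) hk
  refine radialTensor_pos hn hA ?_ ?_ ?_ (ξ := ξ) hξ
  · rw [coefA_add]
    positivity
  · rw [coefA_add_add]
    positivity
  · rw [coefA_add, coefA_add_add, coefA]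
    -- Passing from a unit frame to the coordinate coefficients multiplies both sides by a⁴G².
    have := mul_lt_mul_of_pos_left (mixedCurv_sq_lt hn hlam y)
      (show 0 < (a (nsq z) ^ 2) ^ 2 * solG n lam a (nsq z) ^ 2 by positivity)
    rw [← hy]
    linarith

theorem hasNonnegCurvatureOperator (h : IsRadialSoliton n lam Φ a) (hn : 1 ≤ n)
    (hlam : 1 < lam) : HasNonnegCurvatureOperator (radialMetric n a (solD₁ n lam a)) := by
  intro z m X Y
  -- The (1,1)-part of the bivector, which is all the curvature sees. It may vanish for a nonzero
  -- bivector, so only nonnegativity survives.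
  set ξ : Matrix (Fin n) (Fin n) ℂ := Matrix.of fun α β =>
    ∑ i, (X i α * star (Y i β) - Y i α * star (X i β)) with hξ
  have e : ∑ i, ∑ j, Rm (radialMetric n a (solD₁ n lam a)) z (X i) (Y i) (Y j) (X j) =
      curvForm (radialMetric n a (solD₁ n lam a)) z ξ := by
    simp only [Rm, curvForm, hξ, Matrix.of_apply, star_sum, Finset.mul_sum, Finset.sum_mul]
    simp only [Finset.sum_comm (s := (Finset.univ : Finset (Fin m))) (t := (Finset.univ : Finset (Fin n)))]
    refine Finset.sum_congr rfl fun α _ => Finset.sum_congr rfl fun β _ =>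
      Finset.sum_congr rfl fun γ _ => Finset.sum_congr rfl fun η _ => ?_
    rw [Finset.sum_comm]
    refine Finset.sum_congr rfl fun i _ => Finset.sum_congr rfl fun j _ => ?_
    simp only [star_sub, star_mul', star_star]
    ring
  rw [e]
  by_cases h0 : ξ = 0
  · simp [curvForm, h0]
  · exact (h.hasPositiveCurvatureOperatorOn11 hn hlam z ξ h0).le

end IsRadialSoliton

/-! ### Curvature bounds -/

section

variable {n : ℕ}

theorem norm_hdot_le (z v : Fin n → ℂ) : ‖hdot z v‖ ≤ √(nsq z) * √(nsq v) := by
  rw [← Real.sqrt_mul (nsq_nonneg z)]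
  exact Real.le_sqrt_of_sq_le (norm_hdot_sq_le z v)

theorem sum_radialTensor_decomposable (A B C : ℂ) (z X Y Z W : Fin n → ℂ) :
    ∑ α, ∑ β, ∑ γ, ∑ η, radialTensor A B C z α β γ η * (X α * star (Y β)) * (Z γ * star (W η)) =
      A * (hdot Y X * hdot W Z + hdot W X * hdot Y Z)
        + B * (hdot Y X * (hdot z Z * hdot W z) + hdot Y z * (hdot z Z * hdot W X)
          + hdot z X * hdot Y z * hdot W Z + hdot z X * hdot W z * hdot Y Z)
        + C * (hdot z X * hdot Y z * (hdot z Z * hdot W z)) := by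
  rw [sum_radialTensor A B C z (fun α β => X α * star (Y β)) fun γ η => Z γ * star (W η)]
  have h1 : ∀ X Y : Fin n → ℂ, ∑ α, X α * star (Y α) = hdot Y X := fun X Y =>
    Finset.sum_congr rfl fun i _ => mul_comm _ _
  have h2 : ∀ X Y : Fin n → ℂ, radialPart z (fun α β => X α * star (Y β)) = hdot z X * hdot Y z :=
    fun X Y => by
      rw [radialPart, hdot, hdot, Finset.sum_mul_sum]
      exact Finset.sum_congr rfl fun i _ => Finset.sum_congr rfl fun j _ => by ring
  have h3 : ∀ α, ∑ β, z β * (X α * star (Y β)) = X α * hdot Y z := fun α => by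
    rw [hdot, Finset.mul_sum]
    exact Finset.sum_congr rfl fun i _ => by ring
  have h4 : ∀ α, ∑ γ, star (z γ) * (Z γ * star (W α)) = star (W α) * hdot z Z := fun α => by
    rw [hdot, Finset.mul_sum]
    exact Finset.sum_congr rfl fun i _ => by ring
  have h5 : ∀ β, ∑ α, star (z α) * (X α * star (Y β)) = star (Y β) * hdot z X := fun α => by
    rw [hdot, Finset.mul_sum]
    exact Finset.sum_congr rfl fun i _ => by ring
  have h6 : ∀ β, ∑ η, z η * (Z β * star (W η)) = Z β * hdot W z := fun α => by
    rw [hdot, Finset.mul_sum]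
    exact Finset.sum_congr rfl fun i _ => by ring
  have h7 : ∑ α, ∑ β, X α * star (Y β) * (Z β * star (W α)) = hdot W X * hdot Y Z := by
    rw [hdot, hdot, Finset.sum_mul_sum]
    exact Finset.sum_congr rfl fun i _ => Finset.sum_congr rfl fun j _ => by ring
  have h8 : ∑ α, X α * hdot Y z * (star (W α) * hdot z Z) = hdot Y z * (hdot z Z * hdot W X) := by
    rw [show hdot W X = ∑ i, star (W i) * X i from rfl, Finset.mul_sum, Finset.mul_sum]
    exact Finset.sum_congr rfl fun i _ => by ring
  have h9 : ∑ β, star (Y β) * hdot z X * (Z β * hdot W z) = hdot z X * hdot W z * hdot Y Z := by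
    rw [show hdot Y Z = ∑ i, star (Y i) * Z i from rfl, Finset.mul_sum]
    exact Finset.sum_congr rfl fun i _ => by ring
  simp only [h1, h2, h3, h4, h5, h6, h7, h8, h9]

theorem norm_sum_radialTensor_le (A B C : ℝ) (z X Y Z W : Fin n → ℂ) :
    ‖∑ α, ∑ β, ∑ γ, ∑ η, radialTensor A B C z α β γ η * (X α * star (Y β)) * (Z γ * star (W η))‖ ≤
      (2 * |A| + 4 * (|B| * nsq z) + |C| * nsq z ^ 2) *
        (√(nsq X) * √(nsq Y) * √(nsq Z) * √(nsq W)) := by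
  rw [sum_radialTensor_decomposable]
  set N : (Fin n → ℂ) → ℝ := fun v => √(nsq v) with hN
  have hz : nsq z = N z ^ 2 := (Real.sq_sqrt (nsq_nonneg z)).symm
  have h0 : ∀ v, 0 ≤ N v := fun v => Real.sqrt_nonneg _
  have h : ∀ v w, ‖hdot v w‖ ≤ N v * N w := fun v w => norm_hdot_le v w
  have t1 : ∀ (c d e f g i j k : Fin n → ℂ), ‖hdot c d * hdot e f * (hdot g i * hdot j k)‖ ≤
      N c * N d * (N e * N f) * (N g * N i * (N j * N k)) := fun c d e f g i j k => by
    simp only [norm_mul]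
    have := h0 c; have := h0 d; have := h0 e; have := h0 f; have := h0 g; have := h0 i
    gcongr <;> apply h
  have t2 : ∀ (c d e f g i : Fin n → ℂ), ‖hdot c d * (hdot e f * hdot g i)‖ ≤
      N c * N d * (N e * N f * (N g * N i)) := fun c d e f g i => by
    simp only [norm_mul]
    have := h0 c; have := h0 d; have := h0 e; have := h0 f
    gcongr <;> apply h
  have t3 : ∀ (c d e f : Fin n → ℂ), ‖hdot c d * hdot e f‖ ≤
      N c * N d * (N e * N f) := fun c d e f => by
    simp only [norm_mul]
    have := h0 c; have := h0 d
    gcongr <;> apply h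
  rw [mul_assoc (hdot z X) (hdot Y z) (hdot W Z), mul_assoc (hdot z X) (hdot W z) (hdot Y Z)]
  refine (norm_add₃_le).trans ?_
  rw [norm_mul, norm_mul, norm_mul, Complex.norm_real, Complex.norm_real, Complex.norm_real,
    Real.norm_eq_abs, Real.norm_eq_abs, Real.norm_eq_abs, hz]
  have b1 : ‖hdot Y X * hdot W Z + hdot W X * hdot Y Z‖ ≤ 2 * (N X * N Y * N Z * N W) := by
    refine (norm_add_le _ _).trans ?_
    have e1 := t3 Y X W Z
    have e2 := t3 W X Y Z
    linarith
  have b2 : ‖hdot Y X * (hdot z Z * hdot W z) + hdot Y z * (hdot z Z * hdot W X)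
      + hdot z X * (hdot Y z * hdot W Z) + hdot z X * (hdot W z * hdot Y Z)‖ ≤
      4 * N z ^ 2 * (N X * N Y * N Z * N W) := by
    refine (norm_add_le _ _).trans ?_
    have e1 := t2 Y X z Z W z
    have e2 := t2 Y z z Z W X
    have e3 := t2 z X Y z W Z
    have e4 := t2 z X W z Y Z
    have e5 := norm_add₃_le (a := hdot Y X * (hdot z Z * hdot W z))
      (b := hdot Y z * (hdot z Z * hdot W X)) (c := hdot z X * (hdot Y z * hdot W Z))
    linarith
  have b3 : ‖hdot z X * hdot Y z * (hdot z Z * hdot W z)‖ ≤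
      (N z ^ 2) ^ 2 * (N X * N Y * N Z * N W) := by
    have := t1 z X Y z z Z W z
    linarith
  calc _ ≤ |A| * (2 * (N X * N Y * N Z * N W)) + |B| * (4 * N z ^ 2 * (N X * N Y * N Z * N W))
        + |C| * ((N z ^ 2) ^ 2 * (N X * N Y * N Z * N W)) := by gcongr
    _ = _ := by ring

end

namespace IsRadialSoliton

variable {n : ℕ} {lam : ℝ} {Φ a : ℝ → ℝ}

theorem vecNorm_sq (h : IsRadialSoliton n lam Φ a) (hn : 1 ≤ n) (hlam : 1 < lam)
    (z v : Fin n → ℂ) : vecNorm (radialMetric n a (solD₁ n lam a)) z v ^ 2 =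
      a (nsq z) * nsq v + solD₁ n lam a (nsq z) * ‖hdot z v‖ ^ 2 := by
  rw [vecNorm, sum_radialMetric, Complex.ofReal_re, Real.sq_sqrt]
  exact (mul_nonneg (h.b_pos hn hlam (nsq_nonneg z)).le (nsq_nonneg v)).trans
    (h.quad_lower hlam z v)

theorem moment_nonneg (h : IsRadialSoliton n lam Φ a) {s : ℝ} (hs : 0 ≤ s) : 0 ≤ s * a s :=
  mul_nonneg hs (h.pos s hs).le

theorem solG_le_one (h : IsRadialSoliton n lam Φ a) (hlam : 1 < lam) {s : ℝ} (hs : 0 ≤ s) :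
    solG n lam a s ≤ 1 := by
  have := mul_nonneg (h.moment_nonneg hs) (curvFun_pos n hlam (s * a s)).le
  rw [solG]
  linarith

theorem one_lt_mul_solG (hn : 1 ≤ n) (hlam : 1 < lam) (s : ℝ) : 1 < lam * solG n lam a s :=
  one_lt_mul_one_sub hn hlam _

/-- From λG > 1: up to the factor λ, the metric is the Euclidean one times a. -/
theorem le_vecNorm_sq (h : IsRadialSoliton n lam Φ a) (hn : 1 ≤ n) (hlam : 1 < lam)
    (z v : Fin n → ℂ) : a (nsq z) * nsq v ≤
      lam * vecNorm (radialMetric n a (solD₁ n lam a)) z v ^ 2 := by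
  have h1 := h.quad_lower hlam z v
  rw [← h.vecNorm_sq hn hlam] at h1
  have h2 := one_lt_mul_solG (a := a) hn hlam (nsq z)
  have h3 := mul_nonneg (h.pos _ (nsq_nonneg z)).le (nsq_nonneg v)
  nlinarith

theorem vecNorm_sq_le (h : IsRadialSoliton n lam Φ a) (hn : 1 ≤ n) (hlam : 1 < lam)
    (z v : Fin n → ℂ) : vecNorm (radialMetric n a (solD₁ n lam a)) z v ^ 2 ≤
      a (nsq z) * nsq v := by
  rw [h.vecNorm_sq hn hlam, solD₁]
  have := mul_nonneg (mul_nonneg (pow_nonneg (h.pos _ (nsq_nonneg z)).le 2)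
    (curvFun_pos n hlam (nsq z * a (nsq z))).le) (sq_nonneg ‖hdot z v‖)
  linarith

theorem vecNorm_nonneg {n : ℕ} (g : MetricField n) (z v : Fin n → ℂ) : 0 ≤ vecNorm g z v :=
  Real.sqrt_nonneg _

/-- With E = A + Bs and D = 2A + 4Bs + Cs², the triangle inequality recovers B and C from the
positive quantities A, E, D and bounds the left side by 12A + 8E + D. The constant 40 is 2(12 + 8).
-/
theorem coef_bound (h : IsRadialSoliton n lam Φ a) (hn : 1 ≤ n) (hlam : 1 < lam) {s : ℝ}
    (hs : 0 ≤ s) : 2 * |coefA n lam a s| + 4 * (|coefB n lam a s| * s) + |coefC n lam a s| * s ^ 2 ≤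
      a s ^ 2 * ((lam - 1) * (40 + 2 * n ^ 2) / (1 + s * a s)) := by
  have h0 := h.pos s hs
  have hy := h.moment_nonneg hs
  have hG := solG_pos (a := a) hn hlam s
  have hG1 := h.solG_le_one hlam hs
  have e1 := coefA_add n lam a s
  have e2 := coefA_add_add n lam a s
  have k0 := curvFun_pos n hlam (s * a s)
  have m0 := mixedCurv_pos hn hlam (s * a s)
  have r0 := radialCurv_pos hn hlam (s * a s)
  have k1 := curvFun_le (n := n) hlam hy
  have m1 := mixedCurv_le (n := n) hlam hy
  have r1 := radialCurv_le hn hlam hy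
  have hA : coefA n lam a s = a s ^ 2 * curvFun n lam (s * a s) := rfl
  set A := coefA n lam a s
  set B := coefB n lam a s
  set C := coefC n lam a s
  set k := curvFun n lam (s * a s)
  set m := mixedCurv n lam (s * a s)
  set r := radialCurv n lam (s * a s)
  set G := solG n lam a s
  have hA0 : 0 ≤ A := by rw [hA]; positivity
  have hE0 : 0 ≤ a s ^ 2 * G * m := by positivity
  have hD0 : 0 ≤ a s ^ 2 * G ^ 2 * r := by positivity
  have hB : |B| * s ≤ A + a s ^ 2 * G * m := by
    rw [show |B| * s = |B * s| by rw [abs_mul, abs_of_nonneg hs], abs_le]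
    constructor <;> linarith
  have hC : |C| * s ^ 2 ≤ 2 * A + 4 * (A + a s ^ 2 * G * m) + a s ^ 2 * G ^ 2 * r := by
    have hs2 : (0 : ℝ) ≤ s ^ 2 := by positivity
    rw [show |C| * s ^ 2 = |C * s ^ 2| by rw [abs_mul, abs_of_nonneg hs2], abs_le]
    rw [show |B| * s = |B * s| by rw [abs_mul, abs_of_nonneg hs], abs_le] at hB
    constructor <;> linarith [hB.1, hB.2]
  have hm : G * m ≤ m := by nlinarith
  have hr : G ^ 2 * r ≤ r := by
    have : G ^ 2 ≤ 1 := pow_le_one₀ hG.le hG1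
    nlinarith
  calc 2 * |A| + 4 * (|B| * s) + |C| * s ^ 2 ≤ a s ^ 2 * (12 * k + 8 * (G * m) + G ^ 2 * r) := by
        rw [abs_of_nonneg hA0]
        linarith
    _ ≤ a s ^ 2 * (12 * (2 * (lam - 1) / (1 + s * a s)) + 8 * (2 * (lam - 1) / (1 + s * a s))
          + 2 * (lam - 1) * n ^ 2 / (1 + s * a s)) := by
        gcongr <;> linarith
    _ = _ := by ring

/-- All curvatures are `O(1 / (1 + φ))`. -/
theorem curvature_bound (h : IsRadialSoliton n lam Φ a) (hn : 1 ≤ n) (hlam : 1 < lam) :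
    ∃ K : ℝ, 0 ≤ K ∧ ∀ z, (∀ X Y Z W, ‖Rm (radialMetric n a (solD₁ n lam a)) z X Y Z W‖ ≤
      K / (1 + nsq z * a (nsq z)) * (vecNorm (radialMetric n a (solD₁ n lam a)) z X
        * vecNorm (radialMetric n a (solD₁ n lam a)) z Y
        * vecNorm (radialMetric n a (solD₁ n lam a)) z Z
        * vecNorm (radialMetric n a (solD₁ n lam a)) z W)) ∧
      ‖scalarCurv (radialMetric n a (solD₁ n lam a)) z‖ ≤ K / (1 + nsq z * a (nsq z)) := by
  have hl : 0 < lam - 1 := sub_pos.2 hlam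
  have hl0 : 0 < lam := by linarith
  have hn' : (1 : ℝ) ≤ n := by exact_mod_cast hn
  -- The first summand serves Rm: four terms from antisymmetrising both pairs, and λ² from comparing
  -- four vectors with Euclidean ones. The second serves the scalar curvature.
  refine ⟨4 * lam ^ 2 * ((lam - 1) * (40 + 2 * n ^ 2)) + (lam - 1) * (2 * (n * (n - 1))
    + 4 * (n - 1) + 2 * n ^ 2), ?_, fun z => ⟨fun X Y Z W => ?_, ?_⟩⟩
  · have : 0 ≤ (n : ℝ) - 1 := by linarith
    positivity
  · have h0 := h.pos _ (nsq_nonneg z)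
    have hy := h.moment_nonneg (nsq_nonneg z)
    have hc := h.coef_bound hn hlam (nsq_nonneg z)
    set g := radialMetric n a (solD₁ n lam a)
    set N : (Fin n → ℂ) → ℝ := fun v => √(nsq v) with hN
    have hv : ∀ v, N v ≤ √(lam / a (nsq z)) * vecNorm g z v := fun v => by
      rw [hN]
      refine Real.sqrt_le_iff.2 ⟨by have := vecNorm_nonneg g z v; positivity, ?_⟩
      rw [mul_pow, Real.sq_sqrt (by positivity), div_mul_eq_mul_div, le_div_iff₀ h0]
      linarith [h.le_vecNorm_sq hn hlam z v]
    have hT : ∀ X Y Z W : Fin n → ℂ, ‖∑ α, ∑ β, ∑ γ, ∑ η, radialTensor (coefA n lam a (nsq z) : ℝ)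
        (coefB n lam a (nsq z) : ℝ) (coefC n lam a (nsq z) : ℝ) z α β γ η * (X α * star (Y β))
          * (Z γ * star (W η))‖ ≤ lam ^ 2 * ((lam - 1) * (40 + 2 * n ^ 2)) / (1 + nsq z * a (nsq z))
          * (vecNorm g z X * vecNorm g z Y * vecNorm g z Z * vecNorm g z W) := by
      intro X Y Z W
      refine (norm_sum_radialTensor_le _ _ _ z X Y Z W).trans ?_
      have hX := vecNorm_nonneg g z X
      have hY := vecNorm_nonneg g z Y
      have hZ := vecNorm_nonneg g z Z
      have hW := vecNorm_nonneg g z W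
      calc _ ≤ a (nsq z) ^ 2 * ((lam - 1) * (40 + 2 * n ^ 2) / (1 + nsq z * a (nsq z))) *
            ((√(lam / a (nsq z)) * vecNorm g z X) * (√(lam / a (nsq z)) * vecNorm g z Y)
              * (√(lam / a (nsq z)) * vecNorm g z Z) * (√(lam / a (nsq z)) * vecNorm g z W)) := by
            gcongr
            · exact hv X
            · exact hv Y
            · exact hv Z
            · exact hv W
        _ = a (nsq z) ^ 2 * ((lam - 1) * (40 + 2 * n ^ 2) / (1 + nsq z * a (nsq z))) *
            ((√(lam / a (nsq z)) ^ 2) ^ 2 * (vecNorm g z X * vecNorm g z Y * vecNorm g z Z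
              * vecNorm g z W)) := by ring
        _ = _ := by
            rw [Real.sq_sqrt (by positivity)]
            field_simp
    have e : Rm g z X Y Z W =
        (∑ α, ∑ β, ∑ γ, ∑ η, radialTensor (coefA n lam a (nsq z) : ℝ)
        (coefB n lam a (nsq z) : ℝ) (coefC n lam a (nsq z) : ℝ) z α β γ η * (X α * star (Y β))
          * (Z γ * star (W η)))
        - (∑ α, ∑ β, ∑ γ, ∑ η, radialTensor (coefA n lam a (nsq z) : ℝ)
        (coefB n lam a (nsq z) : ℝ) (coefC n lam a (nsq z) : ℝ) z α β γ η * (X α * star (Y β))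
          * (W γ * star (Z η)))
        - (∑ α, ∑ β, ∑ γ, ∑ η, radialTensor (coefA n lam a (nsq z) : ℝ)
        (coefB n lam a (nsq z) : ℝ) (coefC n lam a (nsq z) : ℝ) z α β γ η * (Y α * star (X β))
          * (Z γ * star (W η)))
        + (∑ α, ∑ β, ∑ γ, ∑ η, radialTensor (coefA n lam a (nsq z) : ℝ)
        (coefB n lam a (nsq z) : ℝ) (coefC n lam a (nsq z) : ℝ) z α β γ η * (Y α * star (X β))
          * (W γ * star (Z η))) := by
      simp only [Rm, g, h.curv_eq hn hlam, ← Finset.sum_sub_distrib, ← Finset.sum_add_distrib]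
      refine Finset.sum_congr rfl fun α _ => Finset.sum_congr rfl fun β _ =>
        Finset.sum_congr rfl fun γ _ => Finset.sum_congr rfl fun η _ => ?_
      ring
    have t1 := hT X Y Z W
    have t2 := hT X Y W Z
    have t3 := hT Y X Z W
    have t4 := hT Y X W Z
    have hn0 : 0 ≤ (n : ℝ) - 1 := by linarith
    have hX := vecNorm_nonneg g z X
    have hY := vecNorm_nonneg g z Y
    have hZ := vecNorm_nonneg g z Z
    have hW := vecNorm_nonneg g z W
    have hrest : 0 ≤ (lam - 1) * (2 * (n * (n - 1)) + 4 * (n - 1) + 2 * n ^ 2)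
        / (1 + nsq z * a (nsq z)) * (vecNorm g z X * vecNorm g z Y * vecNorm g z Z
          * vecNorm g z W) := by positivity
    rw [e]
    refine (norm_add_le _ _).trans ?_
    refine (add_le_add_left ((norm_sub_le _ _).trans (add_le_add_left (norm_sub_le _ _) _)) _).trans ?_
    rw [add_div, add_mul]
    have e4 : 4 * lam ^ 2 * ((lam - 1) * (40 + 2 * n ^ 2)) / (1 + nsq z * a (nsq z)) =
      4 * (lam ^ 2 * ((lam - 1) * (40 + 2 * n ^ 2)) / (1 + nsq z * a (nsq z))) := by ring
    rw [e4]
    linarith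
  · have hy := h.moment_nonneg (nsq_nonneg z)
    have k0 := curvFun_pos n hlam (nsq z * a (nsq z))
    have m0 := mixedCurv_pos hn hlam (nsq z * a (nsq z))
    have r0 := radialCurv_pos hn hlam (nsq z * a (nsq z))
    have k1 := curvFun_le (n := n) hlam hy
    have m1 := mixedCurv_le (n := n) hlam hy
    have r1 := radialCurv_le hn hlam hy
    have hn0 : 0 ≤ (n : ℝ) - 1 := by linarith
    rw [h.scalarCurv_eq hn hlam, Complex.norm_real, Real.norm_of_nonneg (by positivity)]
    have hrest : 0 ≤ 4 * lam ^ 2 * ((lam - 1) * (40 + 2 * n ^ 2)) / (1 + nsq z * a (nsq z)) := by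
      positivity
    calc _ ≤ n * (n - 1) * (2 * (lam - 1) / (1 + nsq z * a (nsq z)))
          + 2 * (n - 1) * (2 * (lam - 1) / (1 + nsq z * a (nsq z)))
          + 2 * (lam - 1) * n ^ 2 / (1 + nsq z * a (nsq z)) := by gcongr
      _ = (lam - 1) * (2 * (n * (n - 1)) + 4 * (n - 1) + 2 * n ^ 2)
        / (1 + nsq z * a (nsq z)) := by ring
      _ ≤ _ := by rw [add_div]; linarith

theorem hasBoundedCurvature (h : IsRadialSoliton n lam Φ a) (hn : 1 ≤ n) (hlam : 1 < lam) :
    HasBoundedCurvature (radialMetric n a (solD₁ n lam a)) := by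
  obtain ⟨K, hK, hb⟩ := h.curvature_bound hn hlam
  refine ⟨K, fun z X Y Z W => ((hb z).1 X Y Z W).trans ?_⟩
  have hX := vecNorm_nonneg (radialMetric n a (solD₁ n lam a)) z X
  have hY := vecNorm_nonneg (radialMetric n a (solD₁ n lam a)) z Y
  have hZ := vecNorm_nonneg (radialMetric n a (solD₁ n lam a)) z Z
  have hW := vecNorm_nonneg (radialMetric n a (solD₁ n lam a)) z W
  gcongr
  exact div_le_self hK (by linarith [h.moment_nonneg (nsq_nonneg z)])

end IsRadialSoliton

/-! ### The Riemannian distance -/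

section

variable {n : ℕ} (g : MetricField n)

theorem vecNorm_smul (z v : Fin n → ℂ) (c : ℝ) : vecNorm g z (c • v) = |c| * vecNorm g z v := by
  have : ∑ α, ∑ β, g z α β * (c • v) α * star ((c • v) β) =
      ((c ^ 2 : ℝ) : ℂ) * ∑ α, ∑ β, g z α β * v α * star (v β) := by
    simp only [Finset.mul_sum]
    refine Finset.sum_congr rfl fun α _ => Finset.sum_congr rfl fun β _ => ?_
    simp only [Pi.smul_apply, Complex.real_smul, star_mul']
    rw [show star (c : ℂ) = c from Complex.conj_ofReal _]
    push_cast
    ring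
  rw [vecNorm, vecNorm, this, Complex.re_ofReal_mul, Real.sqrt_mul (sq_nonneg c), Real.sqrt_sq_eq_abs]

theorem nsq_smul (t : ℝ) (z : Fin n → ℂ) : nsq (t • z) = t ^ 2 * nsq z := by
  simp [nsq, Finset.mul_sum, mul_pow]

/-- The extended norms on the tangent spaces given by the metric. -/
abbrev tangentENorm (z : Fin n → ℂ) : ENorm (TangentSpace 𝓘(ℝ, Fin n → ℂ) z) :=
  ⟨fun v => ENNReal.ofReal (vecNorm g z v)⟩

theorem tangentENormSMulClass (z : Fin n → ℂ) :
    letI := tangentENorm g z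
    ENormSMulClass ℝ (TangentSpace 𝓘(ℝ, Fin n → ℂ) z) :=
  letI := tangentENorm g z
  ⟨fun r v => by
    refine (congrArg ENNReal.ofReal (vecNorm_smul g z v r)).trans ?_
    rw [ENNReal.ofReal_mul (abs_nonneg r), ← Real.enorm_eq_ofReal_abs]
    rfl⟩

theorem gdist_comm (x y : Fin n → ℂ) : gdist g x y = gdist g y x :=
  let _ := tangentENorm g
  have := tangentENormSMulClass g
  Manifold.riemannianEDist_comm

theorem gdist_triangle (x y z : Fin n → ℂ) : gdist g x z ≤ gdist g x y + gdist g y z :=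
  let _ := tangentENorm g
  have := tangentENormSMulClass g
  Manifold.riemannianEDist_triangle

theorem gdist_le_lintegral {γ γ' : ℝ → Fin n → ℂ} (hγ : ContDiff ℝ 1 γ)
    (hγ' : ∀ t, HasDerivAt γ (γ' t) t) :
    gdist g (γ 0) (γ 1) ≤ ∫⁻ t in Set.Icc (0 : ℝ) 1, ENNReal.ofReal (vecNorm g (γ t) (γ' t)) := by
  let _ := tangentENorm g
  have := tangentENormSMulClass g
  have h := Manifold.riemannianEDist_le_pathELength (I := 𝓘(ℝ, Fin n → ℂ)) (γ := γ) (a := 0) (b := 1)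
    hγ.contMDiff.contMDiffOn rfl rfl zero_le_one
  rw [Manifold.pathELength_eq_lintegral_mfderiv_Icc] at h
  refine h.trans (le_of_eq ?_)
  refine lintegral_congr fun t => ?_
  have : mfderiv 𝓘(ℝ, ℝ) 𝓘(ℝ, Fin n → ℂ) γ t (1 : ℝ) = γ' t := by
    rw [mfderiv_eq_fderiv]
    exact (hγ' t).deriv
  change ENNReal.ofReal (vecNorm g (γ t) (mfderiv 𝓘(ℝ, ℝ) 𝓘(ℝ, Fin n → ℂ) γ t (1 : ℝ))) = _
  rw [this]

/-- An upper bound for the distance by the growth of a function along a path. -/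
theorem gdist_le_of_deriv_le {γ γ' : ℝ → Fin n → ℂ} (hγ : ContDiff ℝ 1 γ)
    (hγ' : ∀ t, HasDerivAt γ (γ' t) t) {q q' : ℝ → ℝ}
    (hq : ∀ t ∈ Set.Icc (0 : ℝ) 1, HasDerivAt q (q' t) t) (hq' : ContinuousOn q' (Set.Icc 0 1))
    (hle : ∀ t ∈ Set.Icc (0 : ℝ) 1, vecNorm g (γ t) (γ' t) ≤ q' t) :
    gdist g (γ 0) (γ 1) ≤ ENNReal.ofReal (q 1 - q 0) := by
  refine (gdist_le_lintegral g hγ hγ').trans ?_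
  have hi : IntegrableOn q' (Set.Icc 0 1) := hq'.integrableOn_Icc
  calc ∫⁻ t in Set.Icc (0 : ℝ) 1, ENNReal.ofReal (vecNorm g (γ t) (γ' t))
      ≤ ∫⁻ t in Set.Icc (0 : ℝ) 1, ENNReal.ofReal (q' t) :=
        setLIntegral_mono' measurableSet_Icc fun t ht => ENNReal.ofReal_le_ofReal (hle t ht)
    _ = ENNReal.ofReal (∫ t in Set.Icc (0 : ℝ) 1, q' t) := by
        rw [ofReal_integral_eq_lintegral_ofReal hi]
        exact (ae_restrict_iff' measurableSet_Icc).2 (Eventually.of_forall fun t ht =>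
          (Real.sqrt_nonneg _).trans (hle t ht))
    _ = ENNReal.ofReal (q 1 - q 0) := by
        rw [integral_Icc_eq_integral_Ioc, ← intervalIntegral.integral_of_le zero_le_one,
          intervalIntegral.integral_eq_sub_of_hasDerivAt]
        · rwa [Set.uIcc_of_le zero_le_one]
        · rw [intervalIntegrable_iff_integrableOn_Icc_of_le zero_le_one]
          exact hi

theorem gdist_le_of_segment {x y : Fin n → ℂ} {c : ℝ}
    (hle : ∀ t ∈ Set.Icc (0 : ℝ) 1, vecNorm g (x + t • (y - x)) (y - x) ≤ c) :
    gdist g x y ≤ ENNReal.ofReal c := by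
  have hγ' : ∀ t : ℝ, HasDerivAt (fun t : ℝ => x + t • (y - x)) (y - x) t := fun t => by
    simpa using ((hasDerivAt_id' t).smul_const (y - x)).const_add x
  have := gdist_le_of_deriv_le g (γ := fun t : ℝ => x + t • (y - x)) (γ' := fun _ => y - x)
    (contDiff_const.add (contDiff_id.smul contDiff_const)) hγ'
    (q := fun t => t * c) (q' := fun _ => c)
    (fun t _ => by simpa using (hasDerivAt_id' t).mul_const c) continuousOn_const hle
  simpa using this

/-- A lower bound for the distance by a function with gradient of length at most one. -/
theorem ofReal_sub_le_gdist {H : (Fin n → ℂ) → ℝ} (hH : ContDiff ℝ 1 H)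
    (hle : ∀ z v, |fderiv ℝ H z v| ≤ vecNorm g z v) (x y : Fin n → ℂ) :
    ENNReal.ofReal (H y - H x) ≤ gdist g x y := by
  let _ := tangentENorm g
  have := tangentENormSMulClass g
  refine le_of_forall_gt fun r hr => ?_
  obtain ⟨γ, h0, h1, hγ, hlt, -⟩ := Manifold.exists_lt_locally_constant_of_riemannianEDist_lt
    (I := 𝓘(ℝ, Fin n → ℂ)) (M := Fin n → ℂ) hr zero_lt_one
  refine lt_of_le_of_lt ?_ hlt
  have hγ' : ContDiff ℝ 1 γ := contMDiff_iff_contDiff.1 hγ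
  have hd : ∀ t, HasDerivAt (fun t => H (γ t)) (fderiv ℝ H (γ t) (deriv γ t)) t := fun t =>
    ((hH.differentiable one_ne_zero (γ t)).hasFDerivAt).comp_hasDerivAt t
      (hγ'.differentiable one_ne_zero t).hasDerivAt
  have hc : Continuous fun t => fderiv ℝ H (γ t) (deriv γ t) :=
    ((hH.continuous_fderiv one_ne_zero).comp hγ'.continuous).clm_apply
      (hγ'.continuous_deriv le_rfl)
  have hintegral : ∫ t in Set.Icc (0 : ℝ) 1, fderiv ℝ H (γ t) (deriv γ t) = H y - H x := by
    rw [integral_Icc_eq_integral_Ioc, ← intervalIntegral.integral_of_le zero_le_one,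
      intervalIntegral.integral_eq_sub_of_hasDerivAt (f := fun t => H (γ t)) (fun t _ => hd t)
        (hc.intervalIntegrable _ _), h0, h1]
  rw [← hintegral, Manifold.pathELength_eq_lintegral_mfderiv_Icc]
  refine le_trans ?_ ((enorm_integral_le_lintegral_enorm
    (μ := volume.restrict (Set.Icc 0 1)) fun t => fderiv ℝ H (γ t) (deriv γ t)).trans (lintegral_mono fun t => ?_))
  · rw [Real.enorm_eq_ofReal_abs]
    exact ENNReal.ofReal_le_ofReal (le_abs_self _)
  · rw [Real.enorm_eq_ofReal_abs]
    refine ENNReal.ofReal_le_ofReal ((hle _ _).trans (le_of_eq ?_))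
    rw [mfderiv_eq_fderiv]
    rfl

end

/-! ### Distance from the origin, completeness, quadratic decay. -/

namespace IsRadialSoliton

variable {n : ℕ} {lam : ℝ} {Φ a : ℝ → ℝ}

theorem antitoneOn (h : IsRadialSoliton n lam Φ a) (hlam : 1 < lam) :
    AntitoneOn a (Set.Ici 0) := by
  refine antitoneOn_of_hasDerivWithinAt_nonpos (convex_Ici 0)
    (fun s hs => (h.hasDerivAt s hs).continuousAt.continuousWithinAt)
    (fun s hs => (h.hasDerivAt s (interior_subset hs)).hasDerivWithinAt) fun s hs => ?_
  have := mul_nonneg (sq_nonneg (a s)) (curvFun_pos n hlam (s * a s)).le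
  linarith

theorem strictMonoOn_moment (h : IsRadialSoliton n lam Φ a) (hn : 1 ≤ n) (hlam : 1 < lam) :
    StrictMonoOn (fun s => s * a s) (Set.Ici 0) := by
  refine strictMonoOn_of_hasDerivWithinAt_pos (convex_Ici 0)
    (fun s hs => (h.hasDerivAt_mul hs).continuousAt.continuousWithinAt)
    (fun s hs => (h.hasDerivAt_mul (interior_subset hs)).hasDerivWithinAt) fun s hs =>
      h.b_pos hn hlam (interior_subset hs)

/-- a decreases, so on a segment outside {|z|² < s} the metric is at most a(s) times the Euclidean
one. -/
theorem gdist_le_of_le (h : IsRadialSoliton n lam Φ a) (hn : 1 ≤ n) (hlam : 1 < lam)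
    {x y : Fin n → ℂ} {s : ℝ} (hs : 0 ≤ s)
    (hle : ∀ t ∈ Set.Icc (0 : ℝ) 1, s ≤ nsq (x + t • (y - x))) :
    gdist (radialMetric n a (solD₁ n lam a)) x y ≤ ENNReal.ofReal (√(a s) * √(nsq (y - x))) := by
  refine gdist_le_of_segment _ fun t ht => ?_
  rw [← Real.sqrt_mul (h.pos s hs).le]
  refine Real.le_sqrt_of_sq_le ((h.vecNorm_sq_le hn hlam _ _).trans ?_)
  exact mul_le_mul_of_nonneg_right (h.antitoneOn hlam hs (nsq_nonneg _) (hle t ht)) (nsq_nonneg _)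

/-- Along the ray t z the speed is √(|z|² aG), and the derivative of √(λφ) is √(λ|z|² a) G; the
comparison amounts to 1 ≤ λG. -/
theorem gdist_zero_le (h : IsRadialSoliton n lam Φ a) (hn : 1 ≤ n) (hlam : 1 < lam)
    (z : Fin n → ℂ) : gdist (radialMetric n a (solD₁ n lam a)) 0 z ≤
      ENNReal.ofReal √(lam * (nsq z * a (nsq z))) := by
  have hl0 : 0 < lam := by linarith
  have hpos : ∀ t : ℝ, 0 ≤ t ^ 2 * nsq z := fun t => mul_nonneg (sq_nonneg t) (nsq_nonneg z)
  have hγ' : ∀ t : ℝ, HasDerivAt (fun t : ℝ => t • z) z t := fun t => by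
    simpa using (hasDerivAt_id' t).smul_const z
  -- √(λφ) along the ray, written with t outside the root so that it is differentiable at t = 0.
  have hq : ∀ t : ℝ, HasDerivAt (fun t : ℝ => √(lam * nsq z) * (t * √(a (t ^ 2 * nsq z))))
      (√(lam * nsq z) * (√(a (t ^ 2 * nsq z)) * solG n lam a (t ^ 2 * nsq z))) t := fun t => by
    have h0 := h.pos _ (hpos t)
    have h1 : HasDerivAt (fun t : ℝ => t ^ 2 * nsq z) (2 * t * nsq z) t := by
      simpa using (hasDerivAt_pow 2 t).mul_const (nsq z)
    have h2 := ((h.hasDerivAt _ (hpos t)).comp t h1).sqrt h0.ne'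
    refine (((hasDerivAt_id' t).fun_mul h2).const_mul _).congr_deriv ?_
    congr 1
    have h3 : a (t ^ 2 * nsq z) = √(a (t ^ 2 * nsq z)) ^ 2 := (Real.sq_sqrt h0.le).symm
    have h4 : √(a (t ^ 2 * nsq z)) ≠ 0 := (Real.sqrt_pos.2 h0).ne'
    simp only [Function.comp_apply, solG]
    generalize curvFun n lam (t ^ 2 * nsq z * a (t ^ 2 * nsq z)) = k
    generalize √(a (t ^ 2 * nsq z)) = c at *
    rw [h3]
    field_simp
    ring
  have hsolG : ∀ t : ℝ, ContinuousAt (fun t : ℝ => solG n lam a (t ^ 2 * nsq z)) t := fun t =>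
    ContinuousAt.comp (g := solG n lam a) (f := fun t : ℝ => t ^ 2 * nsq z)
      (h.hasDerivAt_solG (hpos t)).continuousAt (by fun_prop)
  have ha : ∀ t : ℝ, ContinuousAt (fun t : ℝ => a (t ^ 2 * nsq z)) t := fun t =>
    ContinuousAt.comp (g := a) (f := fun t : ℝ => t ^ 2 * nsq z)
      (h.hasDerivAt _ (hpos t)).continuousAt (by fun_prop)
  have hle := gdist_le_of_deriv_le (radialMetric n a (solD₁ n lam a)) (γ := fun t : ℝ => t • z)
    (contDiff_id.smul contDiff_const) hγ' (fun t _ => hq t)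
    (fun t _ => (continuousAt_const.mul ((ha t).sqrt.mul (hsolG t))).continuousWithinAt)
    fun t _ => ?_
  · simpa [Real.sqrt_mul hl0.le, Real.sqrt_mul (nsq_nonneg z), mul_assoc] using hle
  · have h0 := h.pos _ (hpos t)
    have hG := solG_pos (a := a) hn hlam (t ^ 2 * nsq z)
    have hG' := one_lt_mul_solG (a := a) hn hlam (t ^ 2 * nsq z)
    refine le_of_sq_le_sq ?_ (by positivity)
    have hd : ‖hdot (t • z) z‖ ^ 2 = t ^ 2 * nsq z ^ 2 := by
      have : hdot (t • z) z = ((t * nsq z : ℝ) : ℂ) := by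
        rw [Complex.ofReal_mul, ofReal_nsq, hdot, Finset.mul_sum]
        refine Finset.sum_congr rfl fun i _ => ?_
        rw [Pi.smul_apply, Complex.real_smul, star_mul', show star (t : ℂ) = t from
          Complex.conj_ofReal _]
        ring
      rw [this, Complex.norm_real, Real.norm_eq_abs, sq_abs, mul_pow]
    rw [h.vecNorm_sq hn hlam, hd, nsq_smul, mul_pow, mul_pow,
      Real.sq_sqrt (mul_nonneg hl0.le (nsq_nonneg z)), Real.sq_sqrt h0.le]
    have e := add_solD₁ n lam a (t ^ 2 * nsq z)
    have h5 := mul_nonneg (mul_nonneg (nsq_nonneg z) (mul_pos h0 hG).le) (sub_pos.2 hG').le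
    calc _ = nsq z * (a (t ^ 2 * nsq z) + t ^ 2 * nsq z * solD₁ n lam a (t ^ 2 * nsq z)) := by ring
      _ ≤ _ := by rw [e]; linarith

/-- The function √(λ(φ + c)) with c = (λ-1)n/λ has gradient of length at most one: the squared
radial derivative is bounded by λφG/(φ + c), and `mul_one_sub_le` applies. The shift c also makes it
smooth at the origin. -/
theorem le_gdist_zero (h : IsRadialSoliton n lam Φ a) (hn : 1 ≤ n) (hlam : 1 < lam)
    (z : Fin n → ℂ) : ENNReal.ofReal (√(lam * (nsq z * a (nsq z) + (lam - 1) * n / lam))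
      - √((lam - 1) * n)) ≤ gdist (radialMetric n a (solD₁ n lam a)) 0 z := by
  have hl0 : 0 < lam := by linarith
  have hn' : (1 : ℝ) ≤ n := by exact_mod_cast hn
  have hc : 0 < (lam - 1) * n / lam := div_pos (mul_pos (by linarith) (by linarith)) hl0
  have hF : ∀ w : Fin n → ℂ, 0 < lam * (nsq w * a (nsq w) + (lam - 1) * n / lam) := fun w =>
    mul_pos hl0 (by linarith [h.moment_nonneg (nsq_nonneg w)])
  have hd : ∀ w : Fin n → ℂ, HasFDerivAt
      (fun w : Fin n → ℂ => √(lam * (nsq w * a (nsq w) + (lam - 1) * n / lam)))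
      ((lam * (a (nsq w) * solG n lam a (nsq w)) /
        (2 * √(lam * (nsq w * a (nsq w) + (lam - 1) * n / lam)))) • nsqDeriv w) w := fun w =>
    hasFDerivAt_radial (f := fun s => √(lam * (s * a s + (lam - 1) * n / lam)))
      ((((h.hasDerivAt_mul (nsq_nonneg w)).add_const _).const_mul lam).sqrt (hF w).ne')
  have key := ofReal_sub_le_gdist (radialMetric n a (solD₁ n lam a))
    (H := fun w : Fin n → ℂ => √(lam * (nsq w * a (nsq w) + (lam - 1) * n / lam)))
    ?_ (fun w v => ?_) 0 z
  · convert key using 3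
    rw [nsq_zero]
    field_simp
    simp
  · exact (ContDiff.sqrt (contDiff_const.mul ((contDiff_nsq.mul h.contDiff_comp_nsq).add
      contDiff_const)) fun w => (hF w).ne').of_le (by simp)
  · rw [(hd w).fderiv, smul_apply, nsqDeriv_apply, smul_eq_mul]
    set V := vecNorm (radialMetric n a (solD₁ n lam a)) w v
    have hV : 0 ≤ V := vecNorm_nonneg _ _ _
    have hq := h.quad_lower hlam w v
    rw [← h.vecNorm_sq hn hlam] at hq
    have hb := h.b_pos hn hlam (nsq_nonneg w)
    have hm := mul_one_sub_le hn hlam (nsq w * a (nsq w))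
    have hm' : lam * (nsq w * (a (nsq w) * solG n lam a (nsq w))) ≤
        nsq w * a (nsq w) + (lam - 1) * n / lam := by
      rw [solG]; linarith
    have hcs := norm_hdot_sq_le w v
    have hre : (hdot w v).re ^ 2 ≤ ‖hdot w v‖ ^ 2 := by
      rw [← sq_abs]
      exact pow_le_pow_left₀ (abs_nonneg _) (Complex.abs_re_le_norm _) 2
    have hFw := hF w
    change |_ * (2 * (hdot w v).re)| ≤ V
    refine abs_le_of_sq_le_sq ?_ hV
    set b := a (nsq w) * solG n lam a (nsq w)
    set M := nsq w * a (nsq w) + (lam - 1) * n / lam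
    rw [mul_pow, div_pow, mul_pow 2, mul_pow 2, Real.sq_sqrt hFw.le]
    have hM : 0 < M := pos_of_mul_pos_right hFw hl0.le
    have h1 : b * (hdot w v).re ^ 2 ≤ nsq w * V ^ 2 := by
      calc b * (hdot w v).re ^ 2 ≤ b * (nsq w * nsq v) := by gcongr; exact hre.trans hcs
        _ = nsq w * (b * nsq v) := by ring
        _ ≤ _ := mul_le_mul_of_nonneg_left hq (nsq_nonneg w)
    rw [show (lam * b) ^ 2 / (2 ^ 2 * (lam * M)) * (2 ^ 2 * (hdot w v).re ^ 2) =
      lam * b * (b * (hdot w v).re ^ 2) / M by field_simp, div_le_iff₀ hM]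
    calc lam * b * (b * (hdot w v).re ^ 2) ≤ lam * b * (nsq w * V ^ 2) := by gcongr
      _ = lam * (nsq w * b) * V ^ 2 := by ring
      _ ≤ M * V ^ 2 := by gcongr
      _ = _ := by ring

theorem mul_moment_le_of_gdist_le (h : IsRadialSoliton n lam Φ a) (hn : 1 ≤ n) (hlam : 1 < lam)
    {z : Fin n → ℂ} {r : ℝ} (hr : 0 ≤ r)
    (hle : gdist (radialMetric n a (solD₁ n lam a)) 0 z ≤ ENNReal.ofReal r) :
    lam * (nsq z * a (nsq z) + (lam - 1) * n / lam) ≤ (r + √((lam - 1) * n)) ^ 2 := by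
  have h1 := (ENNReal.ofReal_le_ofReal_iff hr).1 ((h.le_gdist_zero hn hlam z).trans hle)
  exact (Real.sqrt_le_iff.1 (sub_le_iff_le_add.1 h1)).2

theorem isCompleteMetric (h : IsRadialSoliton n lam Φ a) (hn : 1 ≤ n) (hlam : 1 < lam) :
    IsCompleteMetric (radialMetric n a (solD₁ n lam a)) := by
  intro x hx
  set g := radialMetric n a (solD₁ n lam a)
  have hl0 : 0 < lam := by linarith
  obtain ⟨N, hN⟩ := hx 1 one_pos
  set D := √(lam * (nsq (x N) * a (nsq (x N)))) + 1
  have hD : 0 ≤ D := by positivity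
  -- A Cauchy tail stays at bounded distance from 0, so φ is bounded on it, hence so is |z|²; this
  -- gives a Euclidean compact set.
  obtain ⟨S, hS, hSa⟩ := h.surj ((D + √((lam - 1) * n)) ^ 2 / lam) (by positivity)
  have hb : ∀ i ≥ N, nsq (x i) ≤ S := fun i hi => by
    have h1 : gdist g 0 (x i) ≤ ENNReal.ofReal D := by
      rw [ENNReal.ofReal_add (Real.sqrt_nonneg _) zero_le_one]
      exact (gdist_triangle g 0 (x N) (x i)).trans
        (add_le_add (h.gdist_zero_le hn hlam _) (hN N le_rfl i hi).le)
    have h2 := h.mul_moment_le_of_gdist_le hn hlam hD h1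
    refine ((h.strictMonoOn_moment hn hlam).le_iff_le (nsq_nonneg _) hS).1 ?_
    change nsq (x i) * a (nsq (x i)) ≤ S * a S
    rw [hSa, le_div_iff₀ hl0]
    have h3 : 0 ≤ lam * ((lam - 1) * n / lam) :=
      mul_nonneg hl0.le (div_nonneg (mul_nonneg (by linarith) (Nat.cast_nonneg n)) hl0.le)
    linarith
  have hball : ∀ i, x (N + i) ∈ Metric.closedBall (0 : Fin n → ℂ) √S := fun i => by
    rw [mem_closedBall_zero_iff, pi_norm_le_iff_of_nonneg (Real.sqrt_nonneg S)]
    intro j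
    refine Real.le_sqrt_of_sq_le (le_trans ?_ (hb _ (Nat.le_add_right N i)))
    exact Finset.single_le_sum (f := fun j => ‖x (N + i) j‖ ^ 2) (fun _ _ => sq_nonneg _)
      (Finset.mem_univ j)
  obtain ⟨y, -, ψ, hψ, hlim⟩ := (isCompact_closedBall (0 : Fin n → ℂ) √S).tendsto_subseq hball
  -- Since a ≤ a(0), Euclidean convergence implies convergence in the Riemannian distance.
  have hle : ∀ w, gdist g w y ≤ ENNReal.ofReal (√(a 0) * √(nsq (y - w))) := fun w =>
    h.gdist_le_of_le hn hlam le_rfl fun t _ => nsq_nonneg _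
  have hlim' : Tendsto (fun i => gdist g (x (N + ψ i)) y) atTop (𝓝 0) := by
    have hc : Tendsto (fun w : Fin n → ℂ => ENNReal.ofReal (√(a 0) * √(nsq (y - w)))) (𝓝 y)
        (𝓝 0) := by
      have : Continuous fun w : Fin n → ℂ => ENNReal.ofReal (√(a 0) * √(nsq (y - w))) :=
        ENNReal.continuous_ofReal.comp (continuous_const.mul ((contDiff_nsq.continuous.comp
          (continuous_const.sub continuous_id)).sqrt))
      simpa [nsq_zero] using this.tendsto y
    exact tendsto_of_tendsto_of_tendsto_of_le_of_le tendsto_const_nhds (hc.comp hlim)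
      (fun _ => zero_le) fun i => hle _
  refine ⟨y, ENNReal.tendsto_nhds_zero.2 fun ε hε => ?_⟩
  obtain ⟨r, hr0, hr⟩ := ENNReal.lt_iff_exists_nnreal_btwn.1 hε
  have hr0' : (0 : ℝ) < r := by exact_mod_cast hr0
  obtain ⟨M, hM⟩ := hx (r / 2) (by positivity)
  have hev := (hlim'.eventually (Iic_mem_nhds (b := 0) (a := ENNReal.ofReal (r / 2)) (by simpa))).and
    (eventually_ge_atTop M)
  obtain ⟨j, hj, hjM⟩ := hev.exists
  filter_upwards [eventually_ge_atTop M] with i hi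
  have hψM : M ≤ N + ψ j := (hjM.trans hψ.le_apply).trans (Nat.le_add_left _ _)
  calc gdist g (x i) y ≤ gdist g (x i) (x (N + ψ j)) + gdist g (x (N + ψ j)) y :=
        gdist_triangle g _ _ _
    _ ≤ ENNReal.ofReal (r / 2) + ENNReal.ofReal (r / 2) := add_le_add (hM i hi _ hψM).le hj
    _ = r := by
        rw [← ENNReal.ofReal_add (by positivity) (by positivity), add_halves,
          ENNReal.ofReal_coe_nnreal]
    _ ≤ ε := hr.le

theorem hasQuadraticCurvatureDecay (h : IsRadialSoliton n lam Φ a) (hn : 1 ≤ n) (hlam : 1 < lam) :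
    HasQuadraticCurvatureDecay (radialMetric n a (solD₁ n lam a)) := by
  obtain ⟨K, hK, hb⟩ := h.curvature_bound hn hlam
  set g := radialMetric n a (solD₁ n lam a)
  have hle : ∀ z, K / (1 + nsq z * a (nsq z)) ≤ lam * K / (1 + (gdist g 0 z).toReal ^ 2) := by
    intro z
    have hy := h.moment_nonneg (nsq_nonneg z)
    have h1 : (gdist g 0 z).toReal ^ 2 ≤ lam * (nsq z * a (nsq z)) := by
      rw [← Real.le_sqrt ENNReal.toReal_nonneg (by positivity)]
      exact ENNReal.toReal_le_of_le_ofReal (Real.sqrt_nonneg _) (h.gdist_zero_le hn hlam z)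
    rw [div_le_div_iff₀ (by positivity) (by positivity)]
    calc K * (1 + (gdist g 0 z).toReal ^ 2) ≤ K * (lam * (1 + nsq z * a (nsq z))) := by
          gcongr; linarith
      _ = _ := by ring
  refine ⟨lam * K, fun z => ⟨fun X Y Z W => ((hb z).1 X Y Z W).trans ?_, (hb z).2.trans (hle z)⟩⟩
  have hX := vecNorm_nonneg g z X
  have hY := vecNorm_nonneg g z Y
  have hZ := vecNorm_nonneg g z Z
  have hW := vecNorm_nonneg g z W
  exact mul_le_mul_of_nonneg_right (hle z) (by positivity)

end IsRadialSoliton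

/-! ### Volume -/

section

variable {n : ℕ}

/-- The matrix determinant lemma for a rank one perturbation of the identity. -/
theorem det_radialMetric {a a₁ : ℝ → ℝ} {z : Fin n → ℂ} (ha : a (nsq z) ≠ 0) :
    (radialMetric n a a₁ z).det =
      ((a (nsq z) ^ n * (1 + a₁ (nsq z) / a (nsq z) * nsq z) : ℝ) : ℂ) := by
  have ha' : (a (nsq z) : ℂ) ≠ 0 := by exact_mod_cast ha
  have e : radialMetric n a a₁ z = (a (nsq z) : ℂ) • (1 + Matrix.replicateCol Unit
      (fun i => (a₁ (nsq z) / a (nsq z) : ℂ) * star (z i)) * Matrix.replicateRow Unit z) := by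
    ext i j
    simp only [radialMetric_apply, kron, Matrix.smul_apply, Matrix.add_apply, Matrix.one_apply,
      Matrix.mul_apply, Matrix.replicateCol_apply, Matrix.replicateRow_apply, smul_eq_mul,
      Finset.univ_unique, Finset.sum_singleton]
    field_simp
  rw [e, Matrix.det_smul, Matrix.det_one_add_replicateCol_mul_replicateRow, Fintype.card_fin]
  push_cast
  rw [ofReal_nsq, dotProduct, Finset.mul_sum]
  congr 2
  exact Finset.sum_congr rfl fun i _ => by ring

theorem volume_nsq_lt (hn : 1 ≤ n) {S : ℝ} (hS : 0 ≤ S) :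
    volume {z : Fin n → ℂ | nsq z < S} = ENNReal.ofReal (Real.pi ^ n / n.factorial * S ^ n) := by
  have : Nonempty (Fin n) := ⟨⟨0, hn⟩⟩
  have h := Complex.volume_sum_rpow_lt (Fin n) (p := 2) one_le_two √S
  have e : {z : Fin n → ℂ | nsq z < S} =
      {x : Fin n → ℂ | (∑ i, ‖x i‖ ^ (2 : ℝ)) ^ (1 / (2 : ℝ)) < √S} := by
    ext z
    simp only [Set.mem_ofPred_eq, Real.rpow_two, ← Real.sqrt_eq_rpow]
    exact (Real.sqrt_lt_sqrt_iff (nsq_nonneg z)).symm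
  rw [e, h, Fintype.card_fin, pow_mul, ← ENNReal.ofReal_pow (Real.sqrt_nonneg S), Real.sq_sqrt hS,
    ← ENNReal.ofReal_pow hS, ← ENNReal.ofReal_mul (by positivity), mul_comm]
  norm_num [Real.Gamma_two, Real.Gamma_nat_eq_factorial]

/-- The image of Lebesgue measure under `z ↦ |z|²`. -/
theorem map_nsq_volume (hn : 1 ≤ n) :
    (volume : Measure (Fin n → ℂ)).map nsq = (volume.restrict (Set.Ioi 0)).withDensity
      fun s => ENNReal.ofReal (Real.pi ^ n / n.factorial * (n * s ^ (n - 1))) := by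
  have hm : Measurable (nsq : (Fin n → ℂ) → ℝ) := contDiff_nsq.continuous.measurable
  -- Both measures are compared on half-lines, where they are finite; the maximum with 0 covers
  -- negative endpoints.
  have h1 : ∀ b, (volume : Measure (Fin n → ℂ)).map nsq (Set.Iio b) =
      ENNReal.ofReal (Real.pi ^ n / n.factorial * (max b 0) ^ n) := fun b => by
    rw [Measure.map_apply hm measurableSet_Iio]
    rcases le_total 0 b with hb | hb
    · rw [max_eq_left hb]
      exact volume_nsq_lt hn hb
    · have : (nsq : (Fin n → ℂ) → ℝ) ⁻¹' Set.Iio b = ∅ :=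
        Set.eq_empty_of_forall_notMem fun z hz => not_lt_of_ge (hb.trans (nsq_nonneg z)) hz
      rw [this, max_eq_right hb, zero_pow (by omega)]
      simp
  have h2 : ∀ b, ((volume.restrict (Set.Ioi 0)).withDensity
      fun s => ENNReal.ofReal (Real.pi ^ n / n.factorial * (n * s ^ (n - 1)))) (Set.Iio b) =
      ENNReal.ofReal (Real.pi ^ n / n.factorial * (max b 0) ^ n) := fun b => by
    rw [withDensity_apply _ measurableSet_Iio, Measure.restrict_restrict measurableSet_Iio,
      Set.inter_comm, Set.Ioi_inter_Iio]
    rcases le_total 0 b with hb | hb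
    · have hc : Continuous fun s : ℝ => Real.pi ^ n / n.factorial * (n * s ^ (n - 1)) := by fun_prop
      rw [max_eq_left hb, restrict_Ioo_eq_restrict_Ioc, ← ofReal_integral_eq_lintegral_ofReal,
        ← intervalIntegral.integral_of_le hb,
        intervalIntegral.integral_eq_sub_of_hasDerivAt
          (f := fun s => Real.pi ^ n / n.factorial * s ^ n)
          (fun s _ => (hasDerivAt_pow n s).const_mul _) (hc.intervalIntegrable _ _)]
      · simp [zero_pow (show n ≠ 0 by omega)]
      · exact (hc.intervalIntegrable _ _).1
      · exact (ae_restrict_iff' measurableSet_Ioc).2 (Eventually.of_forall fun s hs => by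
          have := hs.1.le
          positivity)
    · rw [max_eq_right hb, zero_pow (by omega), Set.Ioo_eq_empty (not_lt.2 hb)]
      simp
  refine Measure.ext_of_Ico' _ _ (fun b c hbc => ?_) fun b c hbc => ?_
  · refine ((measure_mono Set.Ico_subset_Iio_self).trans_lt ?_).ne
    rw [h1]
    exact ENNReal.ofReal_lt_top
  · rw [← Set.Iio_sdiff_Iio, measure_sdiff (Set.Iio_subset_Iio hbc.le)
      measurableSet_Iio.nullMeasurableSet, measure_sdiff (Set.Iio_subset_Iio hbc.le)
      measurableSet_Iio.nullMeasurableSet, h1, h1, h2, h2]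
    · rw [h2]; exact ENNReal.ofReal_ne_top
    · rw [h1]; exact ENNReal.ofReal_ne_top

end

/-! ### Volumes of balls about the origin. -/

namespace IsRadialSoliton

variable {n : ℕ} {lam : ℝ} {Φ a : ℝ → ℝ}

theorem det_eq (h : IsRadialSoliton n lam Φ a) (z : Fin n → ℂ) :
    (radialMetric n a (solD₁ n lam a) z).det.re = a (nsq z) ^ n * solG n lam a (nsq z) := by
  have h0 := h.pos _ (nsq_nonneg z)
  rw [det_radialMetric h0.ne', Complex.ofReal_re]
  congr 1
  have e := add_solD₁ n lam a (nsq z)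
  field_simp
  linarith

/-- The density a^n G times n s^{n-1} is the derivative of (sa)^n, because (sa)' = aG. So the volume
is that of the Euclidean ball {|z|² < φ}. -/
theorem gvol_nsq_lt (h : IsRadialSoliton n lam Φ a) (hn : 1 ≤ n) (hlam : 1 < lam) {S : ℝ}
    (hS : 0 ≤ S) : gvol (radialMetric n a (solD₁ n lam a)) {z | nsq z < S} =
      ENNReal.ofReal (Real.pi ^ n / n.factorial * (S * a S) ^ n) := by
  have hm : Measurable (nsq : (Fin n → ℂ) → ℝ) := contDiff_nsq.continuous.measurable
  -- a is controlled only for s ≥ 0; the truncation makes the density continuous, hence measurable,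
  -- on the whole line.
  set D : ℝ → ℝ := fun s => a (max s 0) ^ n * solG n lam a (max s 0)
  have hD : Continuous D := by
    have h1 : Continuous fun s => a (max s 0) := continuous_iff_continuousAt.2 fun s =>
      ContinuousAt.comp (g := a) (h.hasDerivAt _ (le_max_right s 0)).continuousAt (by fun_prop)
    have h2 : Continuous fun s => solG n lam a (max s 0) := continuous_iff_continuousAt.2 fun s =>
      ContinuousAt.comp (g := solG n lam a) (h.hasDerivAt_solG (le_max_right s 0)).continuousAt
        (by fun_prop)
    exact (h1.pow n).mul h2
  have hD0 : ∀ s, 0 ≤ D s := fun s => mul_nonneg (pow_nonneg (h.pos _ (le_max_right s 0)).le n)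
    (solG_pos hn hlam _).le
  have hDeq : ∀ s, 0 ≤ s → D s = a s ^ n * solG n lam a s := fun s hs => by
    simp only [D, max_eq_left hs]
  have hms : MeasurableSet {z : Fin n → ℂ | nsq z < S} := hm measurableSet_Iio
  have hderiv : ∀ s ∈ Set.uIcc 0 S, HasDerivAt
      (fun s => Real.pi ^ n / n.factorial * (s * a s) ^ n)
      (Real.pi ^ n / n.factorial * (n * s ^ (n - 1)) * D s) s := fun s hs => by
    rw [Set.uIcc_of_le hS] at hs
    refine (((h.hasDerivAt_mul hs.1).fun_pow n).const_mul _).congr_deriv ?_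
    rw [hDeq s hs.1]
    obtain ⟨m, rfl⟩ : ∃ m, n = m + 1 := ⟨n - 1, by omega⟩
    rw [Nat.add_sub_cancel]
    ring
  have hc : Continuous fun s : ℝ => Real.pi ^ n / n.factorial * (n * s ^ (n - 1)) * D s := by
    fun_prop
  calc gvol (radialMetric n a (solD₁ n lam a)) {z | nsq z < S}
      = ∫⁻ z in nsq ⁻¹' Set.Iio S, ENNReal.ofReal (D (nsq z)) := by
        rw [gvol, withDensity_apply _ hms]
        refine setLIntegral_congr_fun hms fun z _ => ?_
        simp only [h.det_eq, hDeq _ (nsq_nonneg z)]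
    _ = ∫⁻ s in Set.Iio S, ENNReal.ofReal (D s) ∂(volume : Measure (Fin n → ℂ)).map nsq :=
        (setLIntegral_map measurableSet_Iio (ENNReal.continuous_ofReal.comp hD).measurable hm).symm
    _ = ∫⁻ s in Set.Ioc 0 S,
          ENNReal.ofReal (Real.pi ^ n / n.factorial * (n * s ^ (n - 1)) * D s) := by
        rw [map_nsq_volume hn, setLIntegral_withDensity_eq_setLIntegral_mul _ (by fun_prop)
          (by fun_prop) measurableSet_Iio, Measure.restrict_restrict measurableSet_Iio,
          Set.inter_comm, Set.Ioi_inter_Iio, restrict_Ioo_eq_restrict_Ioc]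
        refine setLIntegral_congr_fun measurableSet_Ioc fun s hs => ?_
        have := hs.1.le
        simp only [Pi.mul_apply]
        rw [← ENNReal.ofReal_mul (by positivity)]
    _ = ENNReal.ofReal (∫ s in (0)..S, Real.pi ^ n / n.factorial * (n * s ^ (n - 1)) * D s) := by
        rw [intervalIntegral.integral_of_le hS,
          ofReal_integral_eq_lintegral_ofReal (hc.intervalIntegrable _ _).1]
        exact (ae_restrict_iff' measurableSet_Ioc).2 (Eventually.of_forall fun s hs => by
          have := hs.1.le
          exact mul_nonneg (by positivity) (hD0 s))
    _ = _ := by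
        rw [intervalIntegral.integral_eq_sub_of_hasDerivAt hderiv (hc.intervalIntegrable _ _)]
        simp [zero_pow (show n ≠ 0 by omega)]

/-- By `gdist_zero_le`, the set {φ < r²/λ} lies in the ball of radius r. -/
theorem le_gvol_gball_zero (h : IsRadialSoliton n lam Φ a) (hn : 1 ≤ n) (hlam : 1 < lam) :
    HasEuclideanVolumeGrowthAt (radialMetric n a (solD₁ n lam a)) 0
      (Real.pi ^ n / (n.factorial * lam ^ n)) := by
  intro r hr
  have hl0 : 0 < lam := by linarith
  obtain ⟨S, hS, hSa⟩ := h.surj (r ^ 2 / lam) (by positivity)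
  have e : Real.pi ^ n / (n.factorial * lam ^ n) * r ^ (2 * n) =
      Real.pi ^ n / n.factorial * (S * a S) ^ n := by
    rw [hSa, div_pow, pow_mul]
    field_simp
  rw [e, ← h.gvol_nsq_lt hn hlam hS]
  refine measure_mono fun z hz => (h.gdist_zero_le hn hlam z).trans_lt ?_
  have h1 := (h.strictMonoOn_moment hn hlam) (nsq_nonneg z) hS hz
  simp only [hSa] at h1
  rw [lt_div_iff₀ hl0] at h1
  rw [ENNReal.ofReal_lt_ofReal_iff_of_nonneg (Real.sqrt_nonneg _)]
  exact (Real.sqrt_lt' (lt_of_le_of_ne hr fun h0 => by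
    rw [← h0] at h1
    linarith [mul_nonneg (h.moment_nonneg (nsq_nonneg z)) hl0.le])).2 (by linarith)

/-- The opposite inclusion, from `le_gdist_zero`; the radius grows by a fixed amount, which is
negligible as r → ∞. -/
theorem gvol_gball_zero_le (h : IsRadialSoliton n lam Φ a) (hn : 1 ≤ n) (hlam : 1 < lam) {r : ℝ}
    (hr : 0 ≤ r) : gvol (radialMetric n a (solD₁ n lam a))
      (gball (radialMetric n a (solD₁ n lam a)) 0 r) ≤
      ENNReal.ofReal (Real.pi ^ n / (n.factorial * lam ^ n) *
        (r + √((lam - 1) * n)) ^ (2 * n)) := by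
  have hl0 : 0 < lam := by linarith
  have hn' : (1 : ℝ) ≤ n := by exact_mod_cast hn
  obtain ⟨S, hS, hSa⟩ := h.surj ((r + √((lam - 1) * n)) ^ 2 / lam) (by positivity)
  have e : Real.pi ^ n / (n.factorial * lam ^ n) * (r + √((lam - 1) * n)) ^ (2 * n) =
      Real.pi ^ n / n.factorial * (S * a S) ^ n := by
    rw [hSa, div_pow, pow_mul]
    field_simp
  rw [e, ← h.gvol_nsq_lt hn hlam hS]
  refine measure_mono fun z hz => ?_
  have h1 := h.mul_moment_le_of_gdist_le hn hlam hr (le_of_lt hz)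
  refine ((h.strictMonoOn_moment hn hlam).lt_iff_lt (nsq_nonneg z) hS).1 ?_
  simp only [hSa]
  rw [lt_div_iff₀ hl0]
  have h3 : 0 < lam * ((lam - 1) * n / lam) :=
    mul_pos hl0 (div_pos (mul_pos (by linarith) (by linarith)) hl0)
  linarith

theorem tendsto_gvol_gball_zero (h : IsRadialSoliton n lam Φ a) (hn : 1 ≤ n) (hlam : 1 < lam) :
    Tendsto (fun r : ℝ => (gvol (radialMetric n a (solD₁ n lam a))
      (gball (radialMetric n a (solD₁ n lam a)) 0 r)).toReal / r ^ (2 * n)) atTop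
      (𝓝 (Real.pi ^ n / (n.factorial * lam ^ n))) := by
  have hl0 : 0 < lam := by linarith
  set C := Real.pi ^ n / (n.factorial * lam ^ n)
  set κ := √((lam - 1) * n)
  have hC : 0 ≤ C := by positivity
  have hlim : Tendsto (fun r : ℝ => C * (1 + κ / r) ^ (2 * n)) atTop (𝓝 C) := by
    have := (((tendsto_const_nhds (x := κ)).div_atTop tendsto_id).const_add (1 : ℝ)).pow (2 * n)
    simpa using this.const_mul C
  refine tendsto_of_tendsto_of_tendsto_of_le_of_le' tendsto_const_nhds hlim ?_ ?_
  · filter_upwards [eventually_gt_atTop 0] with r hr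
    rw [le_div_iff₀ (by positivity), ← ENNReal.ofReal_le_iff_le_toReal]
    · exact h.le_gvol_gball_zero hn hlam r hr.le
    · exact ((h.gvol_gball_zero_le hn hlam hr.le).trans_lt ENNReal.ofReal_lt_top).ne
  · filter_upwards [eventually_gt_atTop 0] with r hr
    have hk : 0 ≤ κ := Real.sqrt_nonneg _
    rw [div_le_iff₀ (by positivity), mul_assoc, ← mul_pow, add_mul, one_mul,
      div_mul_cancel₀ _ hr.ne']
    exact ENNReal.toReal_le_of_le_ofReal (by positivity) (h.gvol_gball_zero_le hn hlam hr.le)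

end IsRadialSoliton

/-! ### Volume growth at arbitrary centres. -/

section

variable {n : ℕ}

theorem nsq_add (x v : Fin n → ℂ) : nsq (x + v) = nsq x + 2 * (hdot x v).re + nsq v := by
  simp only [nsq, hdot, Complex.re_sum, Finset.mul_sum, ← Finset.sum_add_distrib]
  refine Finset.sum_congr rfl fun i _ => ?_
  simp only [← Complex.normSq_eq_norm_sq, Complex.normSq_apply, Pi.add_apply, Complex.add_re,
    Complex.add_im, Complex.mul_re, Complex.star_def, Complex.conj_re, Complex.conj_im]
  ring

theorem hdot_smul (x v : Fin n → ℂ) (t : ℝ) : hdot x (t • v) = t * hdot x v := by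
  simp only [hdot, Finset.mul_sum, Pi.smul_apply, Complex.real_smul]
  exact Finset.sum_congr rfl fun i _ => by ring

theorem hdot_add (x v w : Fin n → ℂ) : hdot x (v + w) = hdot x v + hdot x w := by
  simp only [hdot, Pi.add_apply, mul_add, Finset.sum_add_distrib]

theorem hdot_self (x : Fin n → ℂ) : hdot x x = nsq x := (ofReal_nsq x).symm

theorem nsq_add_le (x v : Fin n → ℂ) : nsq (x + v) ≤ 2 * nsq x + 2 * nsq v := by
  have h := nsq_nonneg (x + (-1 : ℝ) • v)
  rw [nsq_add, hdot_smul, nsq_smul, Complex.re_ofReal_mul] at h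
  rw [nsq_add]
  linarith

end

namespace IsRadialSoliton

variable {n : ℕ} {lam : ℝ} {Φ a : ℝ → ℝ}

/-- A large part of a small geodesic ball lies on the far side of its centre, where the metric
is dominated by its value at the centre. -/
theorem ball_subset_gball (h : IsRadialSoliton n lam Φ a) (hn : 1 ≤ n) (hlam : 1 < lam)
    {x : Fin n → ℂ} {r δ : ℝ} (hδ : 0 < δ) (hδx : δ ^ 2 ≤ nsq x)
    (hr : √(a (nsq x)) * δ < r) {y : Fin n → ℂ}
    (hy : y ∈ Metric.ball ((1 + δ / (2 * √(nsq x))) • x) (δ / (2 * n))) :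
    y ∈ gball (radialMetric n a (solD₁ n lam a)) x r ∧
      nsq x ≤ nsq y ∧ nsq y ≤ 4 * nsq x := by
  have hn' : (1 : ℝ) ≤ n := by exact_mod_cast hn
  have hs : 0 < nsq x := lt_of_lt_of_le (by positivity) hδx
  set σ := √(nsq x)
  have hσ : 0 < σ := Real.sqrt_pos.2 hs
  have hσ2 : σ ^ 2 = nsq x := Real.sq_sqrt hs.le
  set ε := δ / (2 * σ)
  have hεσ : ε * σ = δ / 2 := by simp only [ε]; field_simp
  have hε : 0 < ε := by positivity
  set w := y - (1 + ε) • x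
  -- The ball is a sup-norm ball; radius δ/(2n) keeps the Euclidean length below δ/2.
  have hw : nsq w ≤ (δ / 2) ^ 2 := by
    rw [Metric.mem_ball, dist_eq_norm] at hy
    have h1 : ∀ i, ‖w i‖ ^ 2 ≤ (δ / (2 * n)) ^ 2 := fun i =>
      pow_le_pow_left₀ (norm_nonneg _) ((norm_le_pi_norm w i).trans hy.le) 2
    calc nsq w ≤ ∑ _i : Fin n, (δ / (2 * n)) ^ 2 := Finset.sum_le_sum fun i _ => h1 i
      _ = (δ / 2) ^ 2 / n := by
        rw [Finset.sum_const, Finset.card_univ, Fintype.card_fin, nsmul_eq_mul]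
        field_simp
      _ ≤ (δ / 2) ^ 2 := div_le_self (by positivity) hn'
  have hv : y - x = ε • x + w := by
    simp only [w, add_smul, one_smul]
    abel
  -- The outward shift ε x has length δ/2 and outweighs w, so y - x points away from the origin and
  -- |·|² does not drop below |x|² on the segment.
  have hre : 0 ≤ (hdot x (y - x)).re := by
    have h1 : -(σ * (δ / 2)) ≤ (hdot x w).re := by
      refine (abs_le.1 ((Complex.abs_re_le_norm _).trans ((norm_hdot_le x w).trans ?_))).1
      exact mul_le_mul_of_nonneg_left (Real.sqrt_le_iff.2 ⟨by positivity, hw⟩) hσ.le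
    rw [hv, hdot_add, hdot_smul, hdot_self, Complex.add_re, ← Complex.ofReal_mul, Complex.ofReal_re,
      ← hσ2]
    have : ε * σ ^ 2 = σ * (δ / 2) := by rw [← hεσ]; ring
    linarith
  have hvle : nsq (y - x) ≤ δ ^ 2 := by
    rw [hv]
    refine (nsq_add_le _ _).trans ?_
    have : nsq (ε • x) = (δ / 2) ^ 2 := by rw [nsq_smul, ← hσ2, ← mul_pow, hεσ]
    linarith
  have hseg : ∀ t : ℝ, 0 ≤ t → nsq x ≤ nsq (x + t • (y - x)) := fun t ht => by
    rw [nsq_add, hdot_smul, Complex.re_ofReal_mul]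
    linarith [mul_nonneg ht hre, nsq_nonneg (t • (y - x))]
  refine ⟨?_, ?_, ?_⟩
  · refine (h.gdist_le_of_le hn hlam hs.le fun t ht => hseg t ht.1).trans_lt ?_
    rw [ENNReal.ofReal_lt_ofReal_iff_of_nonneg (by positivity)]
    refine lt_of_le_of_lt ?_ hr
    exact mul_le_mul_of_nonneg_left (Real.sqrt_le_iff.2 ⟨hδ.le, hvle⟩) (Real.sqrt_nonneg _)
  · simpa using hseg 1 zero_le_one
  · have := nsq_add_le x (y - x)
    rw [add_sub_cancel] at this
    linarith

/-- On the Euclidean ball of `ball_subset_gball`, φ is at least φ(x) while |y|² ≤ 4|x|², so a(y) ≥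
a(x)/4. With G ≥ 1/λ this bounds the density below by (a(x)/4)^n/λ. -/
theorem le_gvol_gball_of_lt (h : IsRadialSoliton n lam Φ a) (hn : 1 ≤ n) (hlam : 1 < lam)
    {x : Fin n → ℂ} {r : ℝ} (hr : 0 < r) (hlt : r ^ 2 ≤ 4 * (lam * (nsq x * a (nsq x)))) :
    ENNReal.ofReal (1 / lam * (Real.pi / (64 * lam * n ^ 2)) ^ n * r ^ (2 * n)) ≤
      gvol (radialMetric n a (solD₁ n lam a)) (gball (radialMetric n a (solD₁ n lam a)) x r) := by
  have hl0 : 0 < lam := by linarith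
  have hn' : (1 : ℝ) ≤ n := by exact_mod_cast hn
  have hA := h.pos _ (nsq_nonneg x)
  have hl1 : 1 < √lam := by rwa [Real.lt_sqrt zero_le_one, one_pow]
  set A := a (nsq x)
  -- The hypothesis on r is then exactly δ² ≤ |x|², and √A δ = r/(2√λ) < r because λ > 1. The powers
  -- of A cancel in the volume: (A/4) π (δ/(2n))² = π r²/(64 λ n²).
  set δ := r / (2 * √lam * √A)
  have hδ : 0 < δ := by positivity
  have hδ2 : δ ^ 2 = r ^ 2 / (4 * lam * A) := by
    rw [div_pow, mul_pow, mul_pow, Real.sq_sqrt hl0.le, Real.sq_sqrt hA.le]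
    norm_num
  have hδx : δ ^ 2 ≤ nsq x := by
    rw [hδ2, div_le_iff₀ (by positivity)]
    linarith
  have hδr : √A * δ < r := by
    have : √A * δ = r / (2 * √lam) := by simp only [δ]; field_simp
    rw [this]
    exact div_lt_self hr (by linarith)
  have hs : 0 < nsq x := lt_of_lt_of_le (by positivity) hδx
  set B := Metric.ball ((1 + δ / (2 * √(nsq x))) • x) (δ / (2 * n))
  have hsub := fun y (hy : y ∈ B) => h.ball_subset_gball hn hlam hδ hδx hδr hy
  have hdet : ∀ y ∈ B, (A / 4) ^ n * (1 / lam) ≤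
      (radialMetric n a (solD₁ n lam a) y).det.re := fun y hy => by
    obtain ⟨-, h1, h2⟩ := hsub y hy
    have h3 : A / 4 ≤ a (nsq y) := by
      have h4 : nsq x * A ≤ nsq y * a (nsq y) :=
        (h.strictMonoOn_moment hn hlam).monotoneOn hs.le (nsq_nonneg y) h1
      have h5 : nsq y * a (nsq y) ≤ 4 * nsq x * a (nsq y) :=
        mul_le_mul_of_nonneg_right h2 (h.pos _ (nsq_nonneg y)).le
      have h6 : nsq x * A ≤ nsq x * (4 * a (nsq y)) := by linarith
      linarith [le_of_mul_le_mul_left h6 hs]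
    rw [h.det_eq]
    have h7 : 1 / lam ≤ solG n lam a (nsq y) := by
      rw [div_le_iff₀ hl0]
      linarith [one_lt_mul_solG (a := a) hn hlam (nsq y)]
    gcongr
    exact pow_nonneg (h.pos _ (nsq_nonneg y)).le n
  have hvol : volume B = ENNReal.ofReal ((Real.pi * (δ / (2 * n)) ^ 2) ^ n) := by
    have hη : 0 < δ / (2 * n) := by positivity
    simp only [B]
    rw [volume_pi_ball _ hη]
    simp only [Complex.volume_ball]
    rw [Finset.prod_const, Finset.card_univ, Fintype.card_fin, ENNReal.ofReal_pow (by positivity),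
      mul_comm Real.pi, ENNReal.ofReal_mul (by positivity), ENNReal.ofReal_pow hη.le,
      ← NNReal.coe_real_pi, ENNReal.ofReal_coe_nnreal]
  calc ENNReal.ofReal (1 / lam * (Real.pi / (64 * lam * n ^ 2)) ^ n * r ^ (2 * n))
      = ENNReal.ofReal ((A / 4) ^ n * (1 / lam)) * volume B := by
        rw [hvol, ← ENNReal.ofReal_mul (by positivity)]
        congr 1
        have : Real.pi / (64 * lam * n ^ 2) * r ^ 2 = A / 4 * (Real.pi * (δ / (2 * n)) ^ 2) := by
          rw [div_pow, hδ2]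
          field_simp
          norm_num
        rw [pow_mul, mul_assoc, ← mul_pow, this, mul_pow]
        ring
    _ = ∫⁻ _ in B, ENNReal.ofReal ((A / 4) ^ n * (1 / lam)) := (setLIntegral_const _ _).symm
    _ ≤ ∫⁻ y in B, ENNReal.ofReal (radialMetric n a (solD₁ n lam a) y).det.re :=
        setLIntegral_mono' Metric.isOpen_ball.measurableSet fun y hy =>
          ENNReal.ofReal_le_ofReal (hdet y hy)
    _ ≤ gvol (radialMetric n a (solD₁ n lam a)) B := withDensity_apply_le _ _
    _ ≤ _ := measure_mono fun y hy => (hsub y hy).1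

/-- The dichotomy compares r with 2√(λφ(x)), which bounds 2 d(0,x). For larger r the ball contains
the one of radius r/2 about the origin; for smaller r the local estimate applies. -/
theorem exists_le_gvol_gball (h : IsRadialSoliton n lam Φ a) (hn : 1 ≤ n) (hlam : 1 < lam) :
    ∃ c : ℝ, 0 < c ∧ ∀ x, HasEuclideanVolumeGrowthAt (radialMetric n a (solD₁ n lam a)) x c := by
  have hl0 : 0 < lam := by linarith
  have hn' : (0 : ℝ) < n := by exact_mod_cast hn
  set g := radialMetric n a (solD₁ n lam a)
  refine ⟨min (Real.pi ^ n / (n.factorial * lam ^ n) * (1 / 2) ^ (2 * n))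
    (1 / lam * (Real.pi / (64 * lam * n ^ 2)) ^ n), by positivity, fun x r hr => ?_⟩
  have hx := h.moment_nonneg (nsq_nonneg x)
  rcases le_total (r ^ 2) (4 * (lam * (nsq x * a (nsq x)))) with hlt | hge
  · rcases hr.eq_or_lt with rfl | hr0
    · simp [zero_pow (show 2 * n ≠ 0 by omega)]
    · refine le_trans (ENNReal.ofReal_le_ofReal ?_) (h.le_gvol_gball_of_lt hn hlam hr0 hlt)
      gcongr
      exact min_le_right _ _
  · have h1 := h.le_gvol_gball_zero hn hlam (r / 2) (by positivity)
    have h2 : gball g 0 (r / 2) ⊆ gball g x r := fun y hy => by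
      have h3 : gdist g x 0 ≤ ENNReal.ofReal (r / 2) := by
        rw [gdist_comm]
        refine (h.gdist_zero_le hn hlam x).trans (ENNReal.ofReal_le_ofReal ?_)
        exact Real.sqrt_le_iff.2 ⟨by positivity, by linarith⟩
      calc gdist g x y ≤ gdist g x 0 + gdist g 0 y := gdist_triangle g _ _ _
        _ < ENNReal.ofReal (r / 2) + ENNReal.ofReal (r / 2) :=
          ENNReal.add_lt_add_of_le_of_lt (h3.trans_lt ENNReal.ofReal_lt_top).ne h3 hy
        _ = ENNReal.ofReal r := by
          rw [← ENNReal.ofReal_add (by positivity) (by positivity), add_halves]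
    refine le_trans (ENNReal.ofReal_le_ofReal ?_) (h1.trans (measure_mono h2))
    rw [show (r / 2) ^ (2 * n) = (1 / 2) ^ (2 * n) * r ^ (2 * n) by rw [← mul_pow]; ring,
      ← mul_assoc]
    gcongr
    exact min_le_left _ _

end IsRadialSoliton

/-! ### Cao's metrics as radial solitons -/

theorem tendsto_atBot_of_isRadialSoliton {n : ℕ} {lam : ℝ} {Φ a u : ℝ → ℝ}
    (h : IsRadialSoliton n lam Φ a) (hu : ∀ t, u t = Φ (Real.exp t)) :
    Tendsto u atBot (𝓝 (Φ 0)) := by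
  rw [show u = fun t => Φ (Real.exp t) from funext hu]
  exact (h.hasDerivAt_pot 0 le_rfl).continuousAt.tendsto.comp Real.tendsto_exp_atBot

theorem caoPotential_eq {n : ℕ} {lam : ℝ} {Φ a u : ℝ → ℝ}
    (h : IsRadialSoliton n lam Φ a) (hu : ∀ t, u t = Φ (Real.exp t)) :
    caoPotential (n := n) u = fun z => Φ (nsq z) := by
  funext z
  rw [caoPotential]
  split_ifs with hz
  · rw [hz, nsq_zero]
    exact (tendsto_atBot_of_isRadialSoliton h hu).limUnder_eq
  · rw [hu]
    congr 1
    exact Real.exp_log (nsq_pos hz)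

theorem caoMetric_eq {n : ℕ} {lam : ℝ} {Φ a u : ℝ → ℝ}
    (h : IsRadialSoliton n lam Φ a) (hu : ∀ t, u t = Φ (Real.exp t)) :
    caoMetric n u = radialMetric n a (solD₁ n lam a) := by
  funext z
  ext α β
  rw [caoMetric, Matrix.of_apply, caoPotential_eq h hu]
  exact dz_dzbar_radial (fun s hs => h.hasDerivAt_pot s hs) (fun s hs => h.hasDerivAt s hs) z α β

end CaoSoliton

end

open CaoSoliton in
theorem mainTheorem7 (n : ℕ) (hn : 1 ≤ n) (lam : ℝ) (hlam : 1 < lam) :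
    (∃ u : ℝ → ℝ, IsCaoProfile n lam u) ∧
    ∀ u : ℝ → ℝ, IsCaoProfile n lam u →
      -- the potential is smooth on all of `ℂⁿ`, and the metric is an expanding soliton
      ContDiff ℝ ∞ (caoPotential (n := n) u) ∧
      IsExpandingGradientSoliton (caoMetric n u) 1 ∧
      HasPositiveCurvatureOperatorOn11 (caoMetric n u) ∧
      -- Euclidean volume growth, uniform in the centre, with the sharp constant at the origin
      (∃ c : ℝ, 0 < c ∧ ∀ x, HasEuclideanVolumeGrowthAt (caoMetric n u) x c) ∧
      HasEuclideanVolumeGrowthAt (caoMetric n u) 0 (Real.pi ^ n / (n.factorial * lam ^ n)) ∧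
      Tendsto
        (fun r : ℝ => (gvol (caoMetric n u) (gball (caoMetric n u) 0 r)).toReal / r ^ (2 * n))
        atTop (𝓝 (Real.pi ^ n / (n.factorial * lam ^ n))) ∧
      HasQuadraticCurvatureDecay (caoMetric n u) ∧
      IsMaximalVolumeGrowthKahler (caoMetric n u) := by
  refine ⟨exists_isCaoProfile hn hlam, fun u hu => ?_⟩
  obtain ⟨Φ, a, h, hΦ⟩ := hu.exists_isRadialSoliton hn hlam
  have hl0 : 0 < lam := by linarith
  -- For n ≥ 1 the space ℂⁿ is nontrivial, which noncompactness requires.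
  have : Nonempty (Fin n) := ⟨⟨0, hn⟩⟩
  rw [caoMetric_eq h hΦ, caoPotential_eq h hΦ]
  exact ⟨h.contDiff_pot_comp_nsq, h.isExpandingGradientSoliton hn hlam,
    h.hasPositiveCurvatureOperatorOn11 hn hlam, h.exists_le_gvol_gball hn hlam,
    h.le_gvol_gball_zero hn hlam, h.tendsto_gvol_gball_zero hn hlam,
    h.hasQuadraticCurvatureDecay hn hlam,
    { kahler := h.isKahler hn hlam
      complete := h.isCompleteMetric hn hlam
      noncompact := NormedSpace.noncompactSpace ℝ (Fin n → ℂ)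
      bounded := h.hasBoundedCurvature hn hlam
      nonneg := h.hasNonnegCurvatureOperator hn hlam
      volumeGrowth := ⟨0, _, by positivity, h.le_gvol_gball_zero hn hlam⟩ }⟩
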